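/- For a finite simple graph $G=(V,E)$, $X\subseteq V$ and positive integers $k,m$: a set $T\subseteq V$ is $k$-connected if $G[T]$ remains connected whenever at most $k-1$ of its nodes are removed (the empty graph counts as connected, so a graph on at most $k$ nodes is $k$-connected iff it is complete); $D\subseteq V$ is $m$-dominating if every node of $V\setminus D$ has at least $m$ neighbours in $D$; a $(k,m)$-CDS is a set that is both. $\Gamma(X)$ is the set of nodes of $V\setminus X$ with a neighbour in $X$, and $X^+=X\cup\Gamma(X)$. A unit disk graph is a graph whose nodes can be placed in the Euclidean plane so that two distinct nodes are adjacent iff their distance is at most $1$. The unweighted $(k,m)$-CDS problem asks for a $(k,m)$-CDS of minimum cardinality $\mathrm{OPT}$. *Algorithm of Shang et al.* For $i=1,\dots,m$ let $I_i$ be a maximal independent set of $G[V\setminus(I_1\cup\dots\cup I_{i-1})]$; let $C\subseteq V\setminus I_1$ be such that $|C|\le|I_1|$ and $G[C\cup I_1]$ is connected; output $I_1\cup\dots\cup I_m\cup C$. *Augmentation of $T$ to connectivity $j$.* Start with $S=\emptyset$. While $T\cup S$ is not $j$-connected, choose an inclusion-minimal set $X$ among the sets such that $\emptyset\ne X\subseteq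 T$, $T\not\subseteq X^+$, $|\Gamma(X)\cap T|=j-1$, and no path of $G[T\cup S]$ whose end nodes are in $X$ and in $T\setminus X^+$ and whose inner nodes are outside $T$ exists; choose a shortest path of $G$ whose end nodes are in $X$ and in $T\setminus X^+$ and whose inner nodes are outside $T$, and add its inner nodes to $S$. The output is $T\cup S$. **Corollary.** There are an absolute constant $c$, a polynomial $q$, and one deterministic algorithm with the following property. Given integers $1\le k\le m$ and (the adjacency matrix of) a unit disk graph $G$ on $n$ nodes that has a $(k,m)$-CDS, the algorithm halts within $q(n)$ steps (on a random access machine with addition, subtraction and comparison as unit-cost arithmetic) and outputs a $(k,m)$-CDS of $G$ of size at most $c\cdot 5^k\,k!\cdot\mathrm{OPT}$; that is, it is an $O(5^k k!)$-approximation algorithm for the unweighted $(k,m)$-CDS problem in unit disk graphs with $m\ge k$. Moreover its output is the last set of a sequence $T_1,\dots,T_k$ in which $T_1$ is an $m$-dominating set that is an output of the algorithm of Shang et al., and, for $2\le j\le k$, $T_j$ is an output of the augmentation of $T_{j-1}$ to connectivity $j$ and $|T_j|\le 5j\,|T_{j-1}|$. -/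

import Mathlib

namespace KMCDS

/-! ### Graph notions -/

section Graph

variable {V : Type*} [Fintype V] [DecidableEq V]

/-- `G` is a unit disk graph: its nodes can be placed in the Euclidean plane so that two
distinct nodes are adjacent exactly when their distance is at most one. -/
def IsUnitDiskGraph {W : Type*} (G : SimpleGraph W) : Prop :=
  ∃ p : W → EuclideanSpace ℝ (Fin 2), ∀ u v, G.Adj u v ↔ u ≠ v ∧ dist (p u) (p v) ≤ 1

open Classical in
/-- `Γ(X)`: the nodes outside `X` that have a neighbour in `X`. -/
noncomputable def boundary (G : SimpleGraph V) (X : Finset V) : Finset V :=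
  Finset.univ.filter fun v => v ∉ X ∧ ∃ u ∈ X, G.Adj u v

/-- `X⁺ = X ∪ Γ(X)`. -/
noncomputable def closedNbhd (G : SimpleGraph V) (X : Finset V) : Finset V :=
  X ∪ boundary G X

/-- `T` is `k`-connected: the subgraph induced by `T` stays connected whenever at most `k - 1`
of its nodes are removed. The empty graph counts as connected, so a set of at most `k` nodes is
`k`-connected exactly when it induces a complete graph. -/
def IsKConnected (G : SimpleGraph V) (k : ℕ) (T : Finset V) : Prop :=
  ∀ Z ⊆ T, Z.card < k → (G.induce (↑(T \ Z) : Set V)).Preconnected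

open Classical in
/-- Every node outside `D` has at least `m` neighbours in `D`. -/
def IsDominating (G : SimpleGraph V) (m : ℕ) (D : Finset V) : Prop :=
  ∀ v, v ∉ D → m ≤ (D.filter fun u => G.Adj v u).card

/-- `k`-connected `m`-dominating sets. -/
def IsCDS (G : SimpleGraph V) (k m : ℕ) (S : Finset V) : Prop :=
  IsKConnected G k S ∧ IsDominating G m S

/-- `X` is a `T`-cut. -/
def IsCut (G : SimpleGraph V) (T X : Finset V) : Prop :=
  X ⊆ T ∧ X.Nonempty ∧ (T \ closedNbhd G X).Nonempty

/-- `X` is a demand cut for raising the connectivity of `T` to `k`: a `T`-cut with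
`|Γ_T(X)| = k - 1`. -/
def IsDemandCut (G : SimpleGraph V) (k : ℕ) (T X : Finset V) : Prop :=
  IsCut G T X ∧ (boundary G X ∩ T).card + 1 = k

/-- `P` is a `T`-path: both its end nodes are in `T` and no inner node is. -/
def IsTPath (G : SimpleGraph V) (T : Finset V) {u v : V} (P : G.Walk u v) : Prop :=
  P.IsPath ∧ u ∈ T ∧ v ∈ T ∧ ∀ w ∈ P.support, w ∈ T → w = u ∨ w = v

/-- `P` is a `T`-path that covers `X`, directed away from `X`: it goes from `X` to `T \ X⁺`. -/
def CoversCut (G : SimpleGraph V) (T X : Finset V) {u v : V} (P : G.Walk u v) : Prop :=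
  IsTPath G T P ∧ u ∈ X ∧ v ∈ T \ closedNbhd G X

/-- No `T`-path in `G[T ∪ S]` covers `X`. -/
def IsUncovered (G : SimpleGraph V) (T S X : Finset V) : Prop :=
  ∀ (u v : V) (P : G.Walk u v), (∀ w ∈ P.support, w ∈ T ∪ S) → ¬ CoversCut G T X P

/-- One iteration of the path-adding augmentation from `T` towards `k`-connectivity. If `T ∪ S`
is not yet `k`-connected, take an inclusion-minimal demand cut `X` among those that no `T`-path
in `G[T ∪ S]` covers and a shortest `T`-path of `G` that covers `X`, and add the inner nodes of
that path to `S`. -/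
def AugmentationStep (G : SimpleGraph V) (k : ℕ) (T S S' : Finset V) : Prop :=
  ¬ IsKConnected G k (T ∪ S) ∧
    ∃ X : Finset V, Minimal (fun Y => IsDemandCut G k T Y ∧ IsUncovered G T S Y) X ∧
      ∃ (u v : V) (P : G.Walk u v), CoversCut G T X P ∧
        (∀ (u' v' : V) (P' : G.Walk u' v'), CoversCut G T X P' → P.length ≤ P'.length) ∧
        S' = S ∪ (P.support.toFinset \ T)

/-- `T' = T ∪ S` for the output `S` of a complete run of the path-adding augmentation, started
with the empty set and stopped as soon as `T ∪ S` is `k`-connected. -/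
def IsAugmentation (G : SimpleGraph V) (k : ℕ) (T T' : Finset V) : Prop :=
  ∃ S : Finset V, Relation.ReflTransGen (AugmentationStep G k T) ∅ S ∧
    IsKConnected G k (T ∪ S) ∧ T' = T ∪ S

/-- `T` is an output of the algorithm of Shang et al. for connected `m`-dominating sets: each of
`I 0, …, I (m - 1)` is a maximal independent set of what the earlier ones leave over, `C` is a
set of at most `|I 0|` further nodes for which `C ∪ I 0` induces a connected graph, and `T` is
the union of all these sets. -/
def IsShangOutput (G : SimpleGraph V) (m : ℕ) (T : Finset V) : Prop :=
  ∃ (I : ℕ → Finset V) (C : Finset V),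
    (∀ i < m, Maximal (fun J : Finset V =>
      G.IsIndepSet (J : Set V) ∧ Disjoint J ((Finset.range i).biUnion I)) (I i)) ∧
    Disjoint C (I 0) ∧ C.card ≤ (I 0).card ∧
    (G.induce (↑(C ∪ I 0) : Set V)).Preconnected ∧
    T = (Finset.range m).biUnion I ∪ C

end Graph

/-! ### Random access programs with a step count

A memory holds natural numbers in scalar variables and in two-dimensional arrays. The only
arithmetic operations are addition, truncated subtraction and comparison, so that within `t`
steps numbers gain at most `t` bits, and step counts agree with Turing machine time up to a
polynomial. -/

/-- Memory: scalar variables and two-dimensional arrays, both numbered. -/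
structure Memory where
  var : ℕ → ℕ
  arr : ℕ → ℕ → ℕ → ℕ

/-- Expressions; `cell a i j` reads the entry `(i, j)` of the array `a`. -/
inductive Expr : Type where
  | lit (c : ℕ) : Expr
  | var (x : ℕ) : Expr
  | cell (a : ℕ) (i j : Expr) : Expr
  | add (e f : Expr) : Expr
  | sub (e f : Expr) : Expr
  | lt (e f : Expr) : Expr
  | eq (e f : Expr) : Expr

/-- The value of an expression; comparisons return `1` or `0`. -/
def Expr.eval (s : Memory) : Expr → ℕ
  | .lit c => c
  | .var x => s.var x
  | .cell a i j => s.arr a (i.eval s) (j.eval s)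
  | .add e f => e.eval s + f.eval s
  | .sub e f => e.eval s - f.eval s
  | .lt e f => if e.eval s < f.eval s then 1 else 0
  | .eq e f => if e.eval s = f.eval s then 1 else 0

/-- The number of steps that the evaluation of an expression takes: one for each of its nodes. -/
def Expr.cost : Expr → ℕ
  | .lit _ => 1
  | .var _ => 1
  | .cell _ i j => i.cost + j.cost + 1
  | .add e f => e.cost + f.cost + 1
  | .sub e f => e.cost + f.cost + 1
  | .lt e f => e.cost + f.cost + 1
  | .eq e f => e.cost + f.cost + 1

/-- Programs. A condition holds when its value is not `0`. -/
inductive Program : Type where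
  | skip : Program
  | assign (x : ℕ) (e : Expr) : Program
  | store (a : ℕ) (i j e : Expr) : Program
  | seq (p q : Program) : Program
  | ite (b : Expr) (p q : Program) : Program
  | while (b : Expr) (p : Program) : Program

/-- Write `c` into the variable `x`. -/
def Memory.setVar (s : Memory) (x c : ℕ) : Memory :=
  { s with var := fun y => if y = x then c else s.var y }

/-- Write `c` into the entry `(i, j)` of the array `a`. -/
def Memory.setCell (s : Memory) (a i j c : ℕ) : Memory :=
  { s with arr := fun a' i' j' => if a' = a ∧ i' = i ∧ j' = j then c else s.arr a' i' j' }

/-- `Exec p s t s'`: started in the memory `s`, the program `p` halts after exactly `t` steps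
with the memory `s'`. -/
inductive Exec : Program → Memory → ℕ → Memory → Prop where
  | skip (s : Memory) : Exec .skip s 1 s
  | assign (s : Memory) (x : ℕ) (e : Expr) :
      Exec (.assign x e) s (e.cost + 1) (s.setVar x (e.eval s))
  | store (s : Memory) (a : ℕ) (i j e : Expr) :
      Exec (.store a i j e) s (i.cost + j.cost + e.cost + 1)
        (s.setCell a (i.eval s) (j.eval s) (e.eval s))
  | seq {p q : Program} {s s' s'' : Memory} {t t' : ℕ} :
      Exec p s t s' → Exec q s' t' s'' → Exec (.seq p q) s (t + t') s''
  | iteTrue {b : Expr} {p q : Program} {s s' : Memory} {t : ℕ} :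
      b.eval s ≠ 0 → Exec p s t s' → Exec (.ite b p q) s (b.cost + t + 1) s'
  | iteFalse {b : Expr} {p q : Program} {s s' : Memory} {t : ℕ} :
      b.eval s = 0 → Exec q s t s' → Exec (.ite b p q) s (b.cost + t + 1) s'
  | whileTrue {b : Expr} {p : Program} {s s' s'' : Memory} {t t' : ℕ} :
      b.eval s ≠ 0 → Exec p s t s' → Exec (.while b p) s' t' s'' →
        Exec (.while b p) s (b.cost + t + t' + 1) s''
  | whileFalse {b : Expr} {p : Program} {s : Memory} :
      b.eval s = 0 → Exec (.while b p) s (b.cost + 1) s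

/-- Programs are deterministic: step count and final memory are unique. -/
theorem Exec.unique {p : Program} {s s₁ s₂ : Memory} {t₁ t₂ : ℕ}
    (h₁ : Exec p s t₁ s₁) (h₂ : Exec p s t₂ s₂) : t₁ = t₂ ∧ s₁ = s₂ := by
  induction h₁ generalizing t₂ s₂ with
  | skip => cases h₂; exact ⟨rfl, rfl⟩
  | assign => cases h₂; exact ⟨rfl, rfl⟩
  | store => cases h₂; exact ⟨rfl, rfl⟩
  | seq _ _ ih ih' =>
    cases h₂ with
    | seq g g' =>
      obtain ⟨rfl, rfl⟩ := ih g
      obtain ⟨rfl, rfl⟩ := ih' g'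
      exact ⟨rfl, rfl⟩
  | iteTrue hb _ ih =>
    cases h₂ with
    | iteTrue _ g => obtain ⟨rfl, rfl⟩ := ih g; exact ⟨rfl, rfl⟩
    | iteFalse hb' _ => exact absurd hb' hb
  | iteFalse hb _ ih =>
    cases h₂ with
    | iteTrue hb' _ => exact absurd hb hb'
    | iteFalse _ g => obtain ⟨rfl, rfl⟩ := ih g; exact ⟨rfl, rfl⟩
  | whileTrue hb _ _ ih ih' =>
    cases h₂ with
    | whileTrue _ g g' =>
      obtain ⟨rfl, rfl⟩ := ih g
      obtain ⟨rfl, rfl⟩ := ih' g'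
      exact ⟨rfl, rfl⟩
    | whileFalse hb' => exact absurd hb' hb
  | whileFalse hb =>
    cases h₂ with
    | whileTrue hb' _ _ => exact absurd hb hb'
    | whileFalse _ => exact ⟨rfl, rfl⟩

open Classical in
/-- The memory that encodes an instance: `n`, `k`, `m` are in the variables `0`, `1`, `2`, the
adjacency matrix of `G` is in the array `0`, and everything else is zero. -/
noncomputable def inputMemory (k m : ℕ) {n : ℕ} (G : SimpleGraph (Fin n)) : Memory where
  var := fun x => if x = 0 then n else if x = 1 then k else if x = 2 then m else 0
  arr := fun a i j =>
    if a = 0 ∧ ∃ (hi : i < n) (hj : j < n), G.Adj ⟨i, hi⟩ ⟨j, hj⟩ then 1 else 0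

/-- The set of nodes that a memory encodes: the nodes `v` for which the entry `(v, 0)` of the
array `1` is not zero. -/
def outputSet (n : ℕ) (s : Memory) : Finset (Fin n) :=
  Finset.univ.filter fun v => s.arr 1 v 0 ≠ 0

end KMCDS

/-!
The first set of the sequence is built by growing a maximal independent set one node at a time, each
new node at distance two from the nodes chosen so far, together with one connecting node for each
(`shangC_spec`). A closed unit disk is covered by 25 cells of diameter less than one, so
a node of a unit disk graph has at most 25 pairwise non-adjacent neighbours; counting the edges
between the layers and an arbitrary `m`-dominating set shows that the first set has at most `52`
times its size (`IsShangOutput.card_le`).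

*Size of an augmentation.* Since the set `T` that is augmented is dominating, a shortest covering
path has at most two inner nodes. For the number of steps, a covering path is replaced by the pair of
its end nodes. The `i`-th pair is separated by a demand cut that no earlier pair crosses, and this
already bounds the number of pairs: a node in few pairs is deleted, and otherwise the
node set is split along the last cut, as in Mader's theorem on graphs without highly connected
subgraphs (`SeparatedPairs.card_inside_add_le`). This gives at most `(2 * j - 1) * |T|` steps, hence
`4 * j - 1 ≤ 5 * j` as the growth factor (`IsAugmentation.card_le`), and the product of
these factors is `5 ^ k * k!`.

*Finding a minimal demand cut.* For two non-adjacent nodes `s`, `t` of `T`, a maximum system of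
internally disjoint `s`-`t` paths in `G[T ∪ S]` is computed by augmentation. The system is encoded by
the predecessor map, which is a matching between the nodes and their predecessors, with `s` matched
several times and unused nodes matched to themselves; an augmenting path is then an alternating path.
When the search gets stuck, the nodes it has scanned form the least of the minimum cuts
(`IsLinkage.scanned_cut`), and their trace on `T` is contained in every uncovered demand cut that
separates `s` from `t`. The inclusion-minimal sets among these traces are the cuts that the
augmentation asks for (`augmentC_spec`).

*Running time.* The algorithm is written in a small language whose statements are simultaneous
first-order updates of binary relations on the nodes, conditionals, and loops that run over the nodes
once. Every program of this language is compiled to the random access machine, with a polynomial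
bound for the number of steps that holds for all inputs (`Command.compile_correct`), so that only
the meaning of the programs is left to verify.
-/

set_option linter.unusedSectionVars false

namespace KMCDS

/-! ### A relational loop language and its compilation -/

/-- First-order formulas over the nodes of the input, in higher-order abstract form: a variable is
the number of quantifiers and loops in whose scope it is bound, and a quantifier passes this
number to its body. Besides the order of the nodes there are the binary relations of the state
and the comparisons of a node number with the parameters `k` and `m`. -/
inductive Formula : Type where
  | rel (a i j : ℕ) : Formula
  | eq (i j : ℕ) : Formula
  | lt (i j : ℕ) : Formula
  | ltK (i : ℕ) : Formula
  | ltM (i : ℕ) : Formula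
  | neg (φ : Formula) : Formula
  | and (φ ψ : Formula) : Formula
  | or (φ ψ : Formula) : Formula
  | ex (φ : ℕ → Formula) : Formula

/-- Commands of the loop language: redefinition of a relation by a formula, composition,
branching, and loops over all nodes in increasing order. -/
inductive Command : Type where
  | upd (a : ℕ) (φ : ℕ → ℕ → Formula) : Command
  | seq (c c' : Command) : Command
  | ite (φ : Formula) (c c' : Command) : Command
  | loop (c : ℕ → Command) : Command
  | nop : Command

/-- A state of the loop language: numbered binary relations on the nodes. -/
abbrev State (n : ℕ) : Type := ℕ → Fin n → Fin n → Prop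

section Semantics

variable {n : ℕ} (k m : ℕ)

/-- Truth of a formula at depth `d`, under the assignment `e` of nodes to variables. -/
def Formula.Holds (σ : State n) : ℕ → (ℕ → Fin n) → Formula → Prop
  | _, e, .rel a i j => σ a (e i) (e j)
  | _, e, .eq i j => e i = e j
  | _, e, .lt i j => e i < e j
  | _, e, .ltK i => (e i : ℕ) < k
  | _, e, .ltM i => (e i : ℕ) < m
  | d, e, .neg φ => ¬ φ.Holds σ d e
  | d, e, .and φ ψ => φ.Holds σ d e ∧ ψ.Holds σ d e
  | d, e, .or φ ψ => φ.Holds σ d e ∨ ψ.Holds σ d e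
  | d, e, .ex φ => ∃ x, (φ d).Holds σ (d + 1) (Function.update e d x)

open Classical in
/-- The state after a command at depth `d`, under the assignment `e` of nodes to variables. -/
noncomputable def Command.run : ℕ → (ℕ → Fin n) → Command → State n → State n
  | d, e, .upd a φ, σ => Function.update σ a fun i j =>
      (φ d (d + 1)).Holds k m σ (d + 2) (Function.update (Function.update e d i) (d + 1) j)
  | d, e, .seq c c', σ => c'.run d e (c.run d e σ)
  | d, e, .ite φ c c', σ => if φ.Holds k m σ d e then c.run d e σ else c'.run d e σ
  | d, e, .loop c, σ =>
      (List.finRange n).foldl (fun τ i => (c d).run (d + 1) (Function.update e d i) τ) σ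
  | _, _, .nop, σ => σ

/-- The command does not redefine the relation `a`. -/
def Command.Avoids (a : ℕ) : Command → Prop
  | .upd b _ => a ≠ b
  | .seq c c' => c.Avoids a ∧ c'.Avoids a
  | .ite _ c c' => c.Avoids a ∧ c'.Avoids a
  | .loop c => ∀ d, (c d).Avoids a
  | .nop => True

/-- Invariant rule for a fold over all elements of `Fin n`. -/
theorem foldl_finRange_induction {α : Type*} {f : α → Fin n → α} {P : ℕ → α → Prop} {a : α}
    (h0 : P 0 a) (hs : ∀ (i : Fin n) b, P i b → P (i + 1) (f b i)) :
    P n ((List.finRange n).foldl f a) := by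
  have key : ∀ r, r ≤ n → P r (((List.finRange n).take r).foldl f a) := by
    intro r
    induction r with
    | zero => intro _; simpa using h0
    | succ r ih =>
      intro hr
      have hr' : r < (List.finRange n).length := by simpa using hr
      rw [List.take_add_one, List.getElem?_eq_getElem hr']
      simpa [List.foldl_append] using hs ⟨r, hr⟩ _ (ih (by omega))
  have := key n le_rfl
  rwa [List.take_of_length_le (by simp)] at this

theorem Command.run_loop_induction {d : ℕ} {e : ℕ → Fin n} {c : ℕ → Command} {σ : State n}
    (P : ℕ → State n → Prop) (h0 : P 0 σ)
    (hs : ∀ (i : Fin n) τ, P i τ →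
      P (i + 1) ((c d).run k m (d + 1) (Function.update e d i) τ)) :
    P n ((Command.loop c).run k m d e σ) :=
  foldl_finRange_induction h0 hs

theorem Command.run_of_avoids {a : ℕ} (c : Command) (hc : c.Avoids a) :
    ∀ (d : ℕ) (e : ℕ → Fin n) (σ : State n), c.run k m d e σ a = σ a := by
  induction c with
  | upd b φ => intro d e σ; exact Function.update_of_ne hc _ _
  | seq c c' ih ih' => intro d e σ; simp only [run]; rw [ih' hc.2, ih hc.1]
  | ite φ c c' ih ih' =>
    intro d e σ; simp only [run]; split_ifs
    · exact ih hc.1 d e σ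
    · exact ih' hc.2 d e σ
  | loop c ih =>
    intro d e σ
    exact Command.run_loop_induction k m (fun _ τ => τ a = σ a) rfl
      fun i τ hτ => (ih d (hc d) _ _ _).trans hτ
  | nop => intro d e σ; rfl

theorem Command.run_seq {d : ℕ} {c c' : Command} {e : ℕ → Fin n} {σ : State n} :
    (Command.seq c c').run k m d e σ = c'.run k m d e (c.run k m d e σ) := rfl

theorem Command.run_upd_of_ne {a b d : ℕ} {φ : ℕ → ℕ → Formula} {e : ℕ → Fin n} {σ : State n}
    (h : a ≠ b) : (Command.upd b φ).run k m d e σ a = σ a := Function.update_of_ne h _ _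

end Semantics

/-- Run `p` with the loop variable of depth `d` set to `0, …, n - 1`. -/
def Program.forLoop (d : ℕ) (p : Program) : Program :=
  .seq (.assign (2 * d + 3) (.lit 0))
    (.while (.lt (.var (2 * d + 3)) (.var 0))
      (.seq p (.assign (2 * d + 3) (.add (.var (2 * d + 3)) (.lit 1)))))

/-- Code that leaves a nonzero number in the variable `2 * d + 4` exactly when the formula holds.
The variable `i` of a formula is kept in the memory variable `2 * i + 3`, the relation `a` in the
array `2 * a`. -/
def Formula.compile : ℕ → Formula → Program
  | d, .rel a i j => .assign (2 * d + 4) (.cell (2 * a) (.var (2 * i + 3)) (.var (2 * j + 3)))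
  | d, .eq i j => .assign (2 * d + 4) (.eq (.var (2 * i + 3)) (.var (2 * j + 3)))
  | d, .lt i j => .assign (2 * d + 4) (.lt (.var (2 * i + 3)) (.var (2 * j + 3)))
  | d, .ltK i => .assign (2 * d + 4) (.lt (.var (2 * i + 3)) (.var 1))
  | d, .ltM i => .assign (2 * d + 4) (.lt (.var (2 * i + 3)) (.var 2))
  | d, .neg φ => .seq (φ.compile d) (.assign (2 * d + 4) (.eq (.var (2 * d + 4)) (.lit 0)))
  | d, .and φ ψ => .seq (φ.compile d) (.ite (.var (2 * d + 4)) (ψ.compile d) .skip)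
  | d, .or φ ψ => .seq (φ.compile d) (.ite (.var (2 * d + 4)) .skip (ψ.compile d))
  | d, .ex φ => .seq (.assign (2 * d + 4) (.lit 0)) (.forLoop d
      (.seq ((φ d).compile (d + 1))
        (.ite (.var (2 * d + 6)) (.assign (2 * d + 4) (.lit 1)) .skip)))

/-- Write the relation defined by a formula into the array `1`. -/
def Formula.fill (d : ℕ) (φ : ℕ → ℕ → Formula) : Program :=
  .forLoop d (.forLoop (d + 1) (.seq ((φ d (d + 1)).compile (d + 2))
    (.store 1 (.var (2 * d + 3)) (.var (2 * d + 5)) (.var (2 * d + 8)))))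

/-- Copy the array `1` into the array `2 * a`. -/
def Program.copyBuffer (d a : ℕ) : Program :=
  .forLoop d (.forLoop (d + 1)
    (.store (2 * a) (.var (2 * d + 3)) (.var (2 * d + 5))
      (.cell 1 (.var (2 * d + 3)) (.var (2 * d + 5)))))

/-- The translation of commands. A relation is redefined through the buffer array `1`, since the
defining formula may refer to it. -/
def Command.compile : ℕ → Command → Program
  | d, .upd a φ => .seq (Formula.fill d φ) (.copyBuffer d a)
  | d, .seq c c' => .seq (c.compile d) (c'.compile d)
  | d, .ite φ c c' => .seq (φ.compile d) (.ite (.var (2 * d + 4)) (c.compile d) (c'.compile d))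
  | d, .loop c => .forLoop d ((c d).compile (d + 1))
  | _, .nop => .skip

section Correctness

variable {n : ℕ}

/-- `p` halts within `B` steps in a memory with the property `Q`. -/
def HaltsWithin (B : ℕ) (p : Program) (s : Memory) (Q : Memory → Prop) : Prop :=
  ∃ t s', Exec p s t s' ∧ t ≤ B ∧ Q s'

theorem HaltsWithin.mono {B B' : ℕ} {p : Program} {s : Memory} {Q Q' : Memory → Prop}
    (h : HaltsWithin B p s Q) (hB : B ≤ B') (hQ : ∀ s', Q s' → Q' s') :
    HaltsWithin B' p s Q' := by
  obtain ⟨t, s', h1, h2, h3⟩ := h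
  exact ⟨t, s', h1, h2.trans hB, hQ _ h3⟩

theorem HaltsWithin.seq {B B' : ℕ} {p p' : Program} {s : Memory} {Q Q' : Memory → Prop}
    (h : HaltsWithin B p s Q) (h' : ∀ s', Q s' → HaltsWithin B' p' s' Q') :
    HaltsWithin (B + B') (.seq p p') s Q' := by
  obtain ⟨t, s', h1, h2, h3⟩ := h
  obtain ⟨t', s'', g1, g2, g3⟩ := h' s' h3
  exact ⟨_, _, .seq h1 g1, by omega, g3⟩

theorem HaltsWithin.assign {x : ℕ} {e : Expr} {s : Memory} {Q : Memory → Prop}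
    (h : Q (s.setVar x (e.eval s))) : HaltsWithin (e.cost + 1) (.assign x e) s Q :=
  ⟨_, _, .assign s x e, le_rfl, h⟩

theorem HaltsWithin.ite {B : ℕ} {b : Expr} {p p' : Program} {s : Memory} {Q : Memory → Prop}
    (h : b.eval s ≠ 0 → HaltsWithin B p s Q) (h' : b.eval s = 0 → HaltsWithin B p' s Q) :
    HaltsWithin (b.cost + B + 1) (.ite b p p') s Q := by
  by_cases hb : b.eval s = 0
  · obtain ⟨t, s', h1, h2, h3⟩ := h' hb
    exact ⟨_, _, .iteFalse hb h1, by omega, h3⟩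
  · obtain ⟨t, s', h1, h2, h3⟩ := h hb
    exact ⟨_, _, .iteTrue hb h1, by omega, h3⟩

theorem HaltsWithin.skip {s : Memory} {Q : Memory → Prop} (h : Q s) :
    HaltsWithin 1 .skip s Q := ⟨_, _, .skip s, le_rfl, h⟩

/-- Invariant rule for `Program.forLoop`: each of the `n` rounds takes at most `B` steps. -/
theorem HaltsWithin.forLoop {B d : ℕ} {p : Program} {s : Memory}
    (P : ℕ → Memory → Prop) (hn : s.var 0 = n)
    (h0 : P 0 (s.setVar (2 * d + 3) 0))
    (hs : ∀ (i : Fin n) s', s'.var 0 = n → s'.var (2 * d + 3) = (i : ℕ) → P i s' →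
      HaltsWithin B p s' fun s'' => s''.var 0 = n ∧ s''.var (2 * d + 3) = (i : ℕ) ∧
        P (i + 1) (s''.setVar (2 * d + 3) (i + 1))) :
    HaltsWithin (n * (B + 10) + 10) (.forLoop d p) s fun s' => s'.var 0 = n ∧ P n s' := by
  have key : ∀ r i, i + r = n → ∀ s' : Memory, s'.var 0 = n → s'.var (2 * d + 3) = i → P i s' →
      HaltsWithin (r * (B + 10) + 4) (.while (.lt (.var (2 * d + 3)) (.var 0))
        (.seq p (.assign (2 * d + 3) (.add (.var (2 * d + 3)) (.lit 1))))) s'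
        fun s' => s'.var 0 = n ∧ P n s' := by
    intro r
    induction r with
    | zero =>
      intro i hi s' h1 h2 h3
      refine ⟨_, _, .whileFalse ?_, ?_, h1, ?_⟩
      · simp [Expr.eval, h1, h2]; omega
      · simp [Expr.cost]
      · rw [← hi]; exact h3
    | succ r ih =>
      intro i hi s' h1 h2 h3
      obtain ⟨t, s1, e1, b1, q1, q2, q3⟩ := hs ⟨i, by omega⟩ s' h1 h2 h3
      obtain ⟨t', s2, e2, b2, q4⟩ := ih (i + 1) (by omega) (s1.setVar (2 * d + 3) (i + 1))
        (by simp [Memory.setVar, q1]) (by simp [Memory.setVar]) q3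
      have ea := Exec.assign s1 (2 * d + 3) (.add (.var (2 * d + 3)) (.lit 1))
      have : Expr.eval s1 (.add (.var (2 * d + 3)) (.lit 1)) = i + 1 := by simp [Expr.eval, q2]
      rw [this] at ea
      refine ⟨_, _, .whileTrue ?_ (.seq e1 ea) e2, ?_, q4⟩
      · simp [Expr.eval, h1, h2]; omega
      · simp only [Expr.cost]
        have : (r + 1) * (B + 10) = r * (B + 10) + (B + 10) := by ring
        omega
  obtain ⟨t, s', h1, h2, h3⟩ := key n 0 (by simp) (s.setVar (2 * d + 3) 0)
    (by simp [Memory.setVar, hn]) (by simp [Memory.setVar]) h0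
  have ea := Exec.assign s (2 * d + 3) (.lit 0)
  refine ⟨_, _, .seq ea h1, ?_, h3⟩
  simp only [Expr.cost]; omega

variable {k m : ℕ}

/-- The memory `s` represents the parameters, the assignment `e` of the variables below `d`, and
the state `σ`. -/
structure Represents (k m d : ℕ) (e : ℕ → Fin n) (σ : State n) (s : Memory) : Prop where
  size : s.var 0 = n
  par_k : s.var 1 = k
  par_m : s.var 2 = m
  env : ∀ l < d, s.var (2 * l + 3) = e l
  rel : ∀ a (i j : Fin n), s.arr (2 * a) i j ≠ 0 ↔ σ a i j

/-- The variables that a formula may use at depth `d`. -/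
def Formula.Scoped : ℕ → Formula → Prop
  | d, .rel _ i j => i < d ∧ j < d
  | d, .eq i j => i < d ∧ j < d
  | d, .lt i j => i < d ∧ j < d
  | d, .ltK i => i < d
  | d, .ltM i => i < d
  | d, .neg φ => φ.Scoped d
  | d, .and φ ψ => φ.Scoped d ∧ ψ.Scoped d
  | d, .or φ ψ => φ.Scoped d ∧ ψ.Scoped d
  | d, .ex φ => (φ d).Scoped (d + 1)

/-- All formulas of a command use bound variables only. -/
def Command.Scoped : ℕ → Command → Prop
  | d, .upd _ φ => (φ d (d + 1)).Scoped (d + 2)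
  | d, .seq c c' => c.Scoped d ∧ c'.Scoped d
  | d, .ite φ c c' => φ.Scoped d ∧ c.Scoped d ∧ c'.Scoped d
  | d, .loop c => (c d).Scoped (d + 1)
  | _, .nop => True

/-- `s'` differs from `s` in variables of depth at least `d` only. -/
def AgreesBelow (d : ℕ) (s s' : Memory) : Prop :=
  s'.arr = s.arr ∧ ∀ x < 2 * d + 3, s'.var x = s.var x

theorem AgreesBelow.trans {d : ℕ} {s s' s'' : Memory} (h : AgreesBelow d s s')
    (h' : AgreesBelow d s' s'') : AgreesBelow d s s'' :=
  ⟨h'.1.trans h.1, fun x hx => (h'.2 x hx).trans (h.2 x hx)⟩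

theorem AgreesBelow.setVar {d x : ℕ} {s s' : Memory} (h : AgreesBelow d s s')
    (hx : 2 * d + 3 ≤ x) (c : ℕ) : AgreesBelow d s (s'.setVar x c) :=
  ⟨h.1, fun y hy => by simp only [Memory.setVar]; rw [if_neg (by omega)]; exact h.2 y hy⟩

theorem AgreesBelow.mono {d d' : ℕ} {s s' : Memory} (h : AgreesBelow d' s s') (hd : d ≤ d') :
    AgreesBelow d s s' := ⟨h.1, fun y hy => h.2 y (by omega)⟩

theorem AgreesBelow.refl (d : ℕ) (s : Memory) : AgreesBelow d s s := ⟨rfl, fun _ _ => rfl⟩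

theorem Represents.of_agreesBelow {d : ℕ} {e : ℕ → Fin n} {σ : State n} {s s' : Memory}
    (h : Represents k m d e σ s) (h' : AgreesBelow d s s') : Represents k m d e σ s' where
  size := by rw [h'.2 _ (by omega), h.size]
  par_k := by rw [h'.2 _ (by omega), h.par_k]
  par_m := by rw [h'.2 _ (by omega), h.par_m]
  env := fun l hl => by rw [h'.2 _ (by omega), h.env l hl]
  rel := fun a i j => by rw [h'.1, h.rel]

theorem Represents.bind {d : ℕ} {e : ℕ → Fin n} {σ : State n} {s : Memory}
    (h : Represents k m d e σ s) {i : Fin n} (hi : s.var (2 * d + 3) = i) :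
    Represents k m (d + 1) (Function.update e d i) σ s where
  size := h.size
  par_k := h.par_k
  par_m := h.par_m
  env := fun l hl => by
    by_cases hld : l = d
    · subst hld; simpa using hi
    · rw [Function.update_of_ne hld]; exact h.env l (by omega)
  rel := h.rel

theorem Represents.unbind {d : ℕ} {e : ℕ → Fin n} {σ : State n} {s : Memory} {i : Fin n}
    (h : Represents k m (d + 1) (Function.update e d i) σ s) :
    Represents k m d e σ s where
  size := h.size
  par_k := h.par_k
  par_m := h.par_m
  env := fun l hl => by
    rw [h.env l (by omega), Function.update_of_ne (by omega)]
  rel := h.rel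

theorem Formula.compile_correct (φ : Formula) : ∀ d, φ.Scoped d → ∃ q : Polynomial ℕ,
    ∀ (n k m : ℕ) (e : ℕ → Fin n) (σ : State n) (s : Memory), Represents k m d e σ s →
      HaltsWithin (q.eval n) (φ.compile d) s fun s' =>
        AgreesBelow d s s' ∧ (s'.var (2 * d + 4) ≠ 0 ↔ φ.Holds k m σ d e) := by
  have atom : ∀ (d : ℕ) (E : Expr) (s : Memory) (p : Prop), (E.eval s ≠ 0 ↔ p) →
      HaltsWithin (E.cost + 1) (.assign (2 * d + 4) E) s fun s' =>
        AgreesBelow d s s' ∧ (s'.var (2 * d + 4) ≠ 0 ↔ p) := fun d E s p h =>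
    HaltsWithin.assign ⟨(AgreesBelow.refl d s).setVar (by omega) _, by simpa [Memory.setVar] using h⟩
  induction φ with
  | rel a i j =>
    intro d hd
    refine ⟨Polynomial.C 4, fun n k m e σ s h => ?_⟩
    rw [Polynomial.eval_C]
    refine atom d _ s _ ?_
    simp only [Expr.eval, h.env i hd.1, h.env j hd.2]
    exact h.rel a _ _
  | eq i j =>
    intro d hd
    refine ⟨Polynomial.C 4, fun n k m e σ s h => ?_⟩
    rw [Polynomial.eval_C]
    refine atom d _ s _ ?_
    simp [Expr.eval, h.env i hd.1, h.env j hd.2, Formula.Holds, Fin.ext_iff]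
  | lt i j =>
    intro d hd
    refine ⟨Polynomial.C 4, fun n k m e σ s h => ?_⟩
    rw [Polynomial.eval_C]
    refine atom d _ s _ ?_
    simp [Expr.eval, h.env i hd.1, h.env j hd.2, Formula.Holds]
  | ltK i =>
    intro d hd
    refine ⟨Polynomial.C 4, fun n k m e σ s h => ?_⟩
    rw [Polynomial.eval_C]
    refine atom d _ s _ ?_
    simp [Expr.eval, h.env i hd, h.par_k, Formula.Holds]
  | ltM i =>
    intro d hd
    refine ⟨Polynomial.C 4, fun n k m e σ s h => ?_⟩
    rw [Polynomial.eval_C]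
    refine atom d _ s _ ?_
    simp [Expr.eval, h.env i hd, h.par_m, Formula.Holds]
  | neg φ ih =>
    intro d hd
    obtain ⟨q, hq⟩ := ih d hd
    refine ⟨q + Polynomial.C 4, fun n k m e σ s h => ?_⟩
    rw [Polynomial.eval_add, Polynomial.eval_C]
    refine (hq n k m e σ s h).seq fun s' hs' => ?_
    refine (atom d _ s' (¬ φ.Holds k m σ d e) ?_).mono le_rfl
      fun s'' h'' => ⟨hs'.1.trans h''.1, h''.2⟩
    rw [← hs'.2]
    simp only [Expr.eval]
    split_ifs with h0 <;> simp [h0]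
  | and φ ψ ih ih' =>
    intro d hd
    obtain ⟨q, hq⟩ := ih d hd.1
    obtain ⟨q', hq'⟩ := ih' d hd.2
    refine ⟨q + (Polynomial.C 1 + (q' + Polynomial.C 1) + Polynomial.C 1),
      fun n k m e σ s h => ?_⟩
    simp only [Polynomial.eval_add, Polynomial.eval_C]
    refine (hq n k m e σ s h).seq fun s' hs' => HaltsWithin.ite (fun hb => ?_) fun hb => ?_
    · refine (hq' n k m e σ s' (h.of_agreesBelow hs'.1)).mono (by omega)
        fun s'' h'' => ⟨hs'.1.trans h''.1, h''.2.trans ?_⟩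
      simp only [Formula.Holds]
      have := hs'.2.1 hb
      tauto
    · refine (HaltsWithin.skip ⟨hs'.1, ?_⟩).mono (by omega) fun _ h => h
      simp only [Formula.Holds]
      simp only [Expr.eval] at hb
      have := hs'.2
      tauto
  | or φ ψ ih ih' =>
    intro d hd
    obtain ⟨q, hq⟩ := ih d hd.1
    obtain ⟨q', hq'⟩ := ih' d hd.2
    refine ⟨q + (Polynomial.C 1 + (q' + Polynomial.C 1) + Polynomial.C 1),
      fun n k m e σ s h => ?_⟩
    simp only [Polynomial.eval_add, Polynomial.eval_C]
    refine (hq n k m e σ s h).seq fun s' hs' => HaltsWithin.ite (fun hb => ?_) fun hb => ?_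
    · refine (HaltsWithin.skip ⟨hs'.1, ?_⟩).mono (by omega) fun _ h => h
      simp only [Formula.Holds]
      simp only [Expr.eval] at hb
      have := hs'.2
      tauto
    · refine (hq' n k m e σ s' (h.of_agreesBelow hs'.1)).mono (by omega)
        fun s'' h'' => ⟨hs'.1.trans h''.1, h''.2.trans ?_⟩
      simp only [Formula.Holds]
      simp only [Expr.eval] at hb
      have := hs'.2
      tauto
  | ex φ ih =>
    intro d hd
    obtain ⟨q, hq⟩ := ih d (d + 1) hd
    refine ⟨Polynomial.C 2 + (Polynomial.X * (q + Polynomial.C 4 + Polynomial.C 10)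
      + Polynomial.C 10), fun n k m e σ s h => ?_⟩
    simp only [Polynomial.eval_add, Polynomial.eval_mul, Polynomial.eval_X, Polynomial.eval_C]
    refine HaltsWithin.seq
      (Q := fun s' => AgreesBelow d s s' ∧ s'.var (2 * d + 4) = 0)
      (HaltsWithin.assign ⟨(AgreesBelow.refl d s).setVar (by omega) _,
        by simp [Memory.setVar, Expr.eval]⟩) fun s' hs' => ?_
    -- after `i` rounds the result register tells whether some node below `i` is a witness
    refine (HaltsWithin.forLoop (P := fun i s' => AgreesBelow d s s' ∧
      (s'.var (2 * d + 4) ≠ 0 ↔ ∃ x : Fin n, (x : ℕ) < i ∧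
        (φ d).Holds k m σ (d + 1) (Function.update e d x)))
      (by rw [hs'.1.2 _ (by omega), h.size]) ?_ ?_).mono le_rfl ?_
    · refine ⟨hs'.1.setVar (by omega) _, ?_⟩
      simp [Memory.setVar, hs'.2]
    · rintro i s1 h1 h2 ⟨h3, h4⟩
      have hrep : Represents k m (d + 1) (Function.update e d i) σ s1 :=
        (h.of_agreesBelow h3).bind h2
      refine (hq n k m _ σ s1 hrep).seq (B' := 1 + 2 + 1) fun s2 hs2 => ?_
      have hsucc : (∃ x : Fin n, (x : ℕ) < i + 1 ∧
          (φ d).Holds k m σ (d + 1) (Function.update e d x)) ↔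
          (∃ x : Fin n, (x : ℕ) < i ∧ (φ d).Holds k m σ (d + 1) (Function.update e d x)) ∨
          (φ d).Holds k m σ (d + 1) (Function.update e d i) := by
        constructor
        · rintro ⟨x, hx, hφ⟩
          rcases Nat.lt_succ_iff_lt_or_eq.1 hx with hx | hx
          · exact .inl ⟨x, hx, hφ⟩
          · rw [Fin.ext hx] at hφ; exact .inr hφ
        · rintro (⟨x, hx, hφ⟩ | hφ)
          · exact ⟨x, by omega, hφ⟩
          · exact ⟨i, by omega, hφ⟩
      have a2 : AgreesBelow d s s2 := h3.trans (hs2.1.mono (by omega))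
      have hres : s2.var (2 * d + 4) = s1.var (2 * d + 4) := hs2.1.2 _ (by omega)
      have hidx : s2.var (2 * d + 3) = i := (hs2.1.2 _ (by omega)).trans h2
      have hn2 : s2.var 0 = n := (hs2.1.2 _ (by omega)).trans h1
      have hs22 := hs2.2
      rw [show 2 * (d + 1) + 4 = 2 * d + 6 by ring] at hs22
      refine HaltsWithin.ite (fun hb => ?_) fun hb => ?_
      · refine HaltsWithin.assign ⟨by simpa [Memory.setVar] using hn2,
          by simpa [Memory.setVar] using hidx, ((a2.setVar (by omega) _).setVar (by omega) _), ?_⟩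
        rw [hsucc]
        have := hs22.1 hb
        simp [Memory.setVar, Expr.eval, this]
      · refine (HaltsWithin.skip ⟨hn2, hidx, a2.setVar (by omega) _, ?_⟩).mono (by omega)
          fun _ h => h
        rw [hsucc, ← h4, ← hs22]
        simp only [Expr.eval] at hb
        simp [Memory.setVar, hb, hres]
    · rintro s1 ⟨-, h1, h2⟩
      refine ⟨h1, h2.trans ?_⟩
      simp [Formula.Holds]

/-- `s'` differs from `s` in variables of depth at least `d` and in the array `b` only. -/
def AgreesOff (d b : ℕ) (s s' : Memory) : Prop :=
  (∀ a, a ≠ b → s'.arr a = s.arr a) ∧ ∀ x < 2 * d + 3, s'.var x = s.var x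

theorem AgreesOff.setVar {d b x : ℕ} {s s' : Memory} (h : AgreesOff d b s s')
    (hx : 2 * d + 3 ≤ x) (c : ℕ) : AgreesOff d b s (s'.setVar x c) :=
  ⟨h.1, fun y hy => by simp only [Memory.setVar]; rw [if_neg (by omega)]; exact h.2 y hy⟩

theorem AgreesOff.setCell {d b : ℕ} {s s' : Memory} (h : AgreesOff d b s s')
    (i j c : ℕ) : AgreesOff d b s (s'.setCell b i j c) :=
  ⟨fun a ha => by rw [← h.1 a ha]; funext i j; simp [Memory.setCell, ha], h.2⟩

theorem AgreesOff.trans_below {d d' b : ℕ} {s s' s'' : Memory} (h : AgreesOff d b s s')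
    (h' : AgreesBelow d' s' s'') (hd : d ≤ d') : AgreesOff d b s s'' :=
  ⟨fun a ha => by rw [h'.1, h.1 a ha], fun x hx => (h'.2 x (by omega)).trans (h.2 x hx)⟩

/-- Two nested loops that store at `(i, j)` of the array `b`, for all nodes `i`, `j`, a value with
a property `W i j` that depends on nothing the loops change. -/
theorem HaltsWithin.tabulate {B d b : ℕ} {p : Program} {s : Memory} (hn : s.var 0 = n)
    (W : Fin n → Fin n → ℕ → Prop)
    (hp : ∀ (i j : Fin n) (s' : Memory), AgreesOff d b s s' → s'.var (2 * d + 3) = i →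
      s'.var (2 * d + 5) = j → HaltsWithin B p s' fun s'' => ∃ s₁ c, W i j c ∧
        AgreesBelow (d + 2) s' s₁ ∧ s'' = s₁.setCell b i j c) :
    HaltsWithin (n * (n * (B + 10) + 10 + 10) + 10) (.forLoop d (.forLoop (d + 1) p)) s
      fun s' => AgreesOff d b s s' ∧ ∀ i j : Fin n, W i j (s'.arr b i j) := by
  refine (HaltsWithin.forLoop (P := fun r s' => AgreesOff d b s s' ∧ ∀ i j : Fin n, (i : ℕ) < r →
    W i j (s'.arr b i j)) hn ?_ ?_).mono le_rfl ?_
  · exact ⟨AgreesOff.setVar ⟨fun _ _ => rfl, fun _ _ => rfl⟩ (by omega) _,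
      fun i j h => absurd h (by omega)⟩
  · rintro i s1 h1 h2 ⟨h3, h4⟩
    refine (HaltsWithin.forLoop (d := d + 1) (P := fun r s' => AgreesOff d b s s' ∧
      s'.var (2 * d + 3) = i ∧
      ∀ i' j : Fin n, ((i' : ℕ) < i ∨ i' = i ∧ (j : ℕ) < r) → W i' j (s'.arr b i' j))
      h1 ?_ ?_).mono le_rfl ?_
    · refine ⟨h3.setVar (by omega) _, ?_, ?_⟩
      · simp only [Memory.setVar]; rw [if_neg (by omega)]; exact h2
      · rintro i' j (h | h)
        · exact h4 i' j h
        · omega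
    · rintro j s2 g1 g2 ⟨g3, g4, g5⟩
      refine (hp i j s2 g3 g4 g2).mono le_rfl ?_
      rintro s3 ⟨s4, c, hc, a4, rfl⟩
      have a5 : AgreesOff d b s s4 := g3.trans_below a4 (by omega)
      refine ⟨(a4.2 0 (by omega)).trans g1, (a4.2 _ (by omega)).trans g2,
        (a5.setCell _ _ _).setVar (by omega) _, ?_, ?_⟩
      · simp only [Memory.setVar, Memory.setCell]
        rw [if_neg (by omega)]
        exact (a4.2 _ (by omega)).trans g4
      · intro i' j' h
        simp only [Memory.setVar, Memory.setCell]
        by_cases hij : i' = i ∧ j' = j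
        · obtain ⟨rfl, rfl⟩ := hij
          simpa using hc
        · rw [if_neg (by simpa [Fin.ext_iff] using hij), a4.1]
          apply g5
          rcases h with h | ⟨rfl, h⟩
          · exact .inl h
          · refine .inr ⟨rfl, ?_⟩
            rcases Nat.lt_succ_iff_lt_or_eq.1 h with h | h
            · exact h
            · exact absurd ⟨rfl, Fin.ext h⟩ hij
    · rintro s2 ⟨g1, g2, g3, g4⟩
      refine ⟨g1, g3, g2.setVar (by omega) _, fun i' j h => ?_⟩
      refine g4 i' j ?_
      rcases Nat.lt_succ_iff_lt_or_eq.1 h with h | h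
      · exact .inl h
      · exact .inr ⟨Fin.ext h, j.2⟩
  · rintro s1 ⟨-, h1, h2⟩
    exact ⟨h1, fun i j => h2 i j i.2⟩

theorem Represents.of_agreesOff {d b : ℕ} {e : ℕ → Fin n} {σ : State n} {s s' : Memory}
    (h : Represents k m d e σ s) (hb : ∀ a, b ≠ 2 * a) (h' : AgreesOff d b s s') :
    Represents k m d e σ s' where
  size := by rw [h'.2 _ (by omega), h.size]
  par_k := by rw [h'.2 _ (by omega), h.par_k]
  par_m := by rw [h'.2 _ (by omega), h.par_m]
  env := fun l hl => by rw [h'.2 _ (by omega), h.env l hl]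
  rel := fun a i j => by rw [h'.1 _ (hb a).symm, h.rel]

/-- The steps that `HaltsWithin.tabulate` allows. -/
noncomputable def tabulateBound (q : Polynomial ℕ) : Polynomial ℕ :=
  .X * (.X * (q + .C 10) + .C 10 + .C 10) + .C 10

theorem eval_tabulateBound (q : Polynomial ℕ) (n : ℕ) :
    (tabulateBound q).eval n = n * (n * (q.eval n + 10) + 10 + 10) + 10 := by
  simp only [tabulateBound, Polynomial.eval_add, Polynomial.eval_mul, Polynomial.eval_X,
    Polynomial.eval_C]

theorem Formula.fill_correct (φ : ℕ → ℕ → Formula) (d : ℕ) (hφ : (φ d (d + 1)).Scoped (d + 2)) :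
    ∃ q : Polynomial ℕ, ∀ (n k m : ℕ) (e : ℕ → Fin n) (σ : State n) (s : Memory),
      Represents k m d e σ s → HaltsWithin (q.eval n) (Formula.fill d φ) s fun s' =>
        Represents k m d e σ s' ∧ ∀ i j : Fin n, s'.arr 1 i j ≠ 0 ↔
          (φ d (d + 1)).Holds k m σ (d + 2) (Function.update (Function.update e d i) (d + 1) j) := by
  obtain ⟨q, hq⟩ := (φ d (d + 1)).compile_correct (d + 2) hφ
  refine ⟨tabulateBound (q + .C 4), fun n k m e σ s h => ?_⟩
  rw [eval_tabulateBound, Polynomial.eval_add, Polynomial.eval_C]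
  refine (HaltsWithin.tabulate (b := 1) h.size (fun i j c => c ≠ 0 ↔ (φ d (d + 1)).Holds k m σ (d + 2)
    (Function.update (Function.update e d i) (d + 1) j)) ?_).mono le_rfl ?_
  · intro i j s1 h1 h2 h3
    have hrep := ((h.of_agreesOff (fun a => by omega) h1).bind h2).bind h3
    refine (hq n k m _ σ s1 hrep).seq fun s2 hs2 => ?_
    refine ⟨_, _, Exec.store _ _ _ _ _, by simp [Expr.cost], s2, s2.var (2 * d + 8), ?_, hs2.1, ?_⟩
    · exact hs2.2
    · have e1 := hs2.1.2 (2 * d + 3) (by omega)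
      have e2 := hs2.1.2 (2 * d + 5) (by omega)
      simp [Expr.eval, e1, e2, h2, h3]
  · rintro s1 ⟨h1, h2⟩
    exact ⟨h.of_agreesOff (fun a => by omega) h1, h2⟩

theorem Program.copyBuffer_correct (a d : ℕ) {R : Fin n → Fin n → Prop} {e : ℕ → Fin n}
    {σ : State n} {s : Memory} (h : Represents k m d e σ s)
    (hR : ∀ i j : Fin n, s.arr 1 i j ≠ 0 ↔ R i j) :
    HaltsWithin ((tabulateBound (.C 7)).eval n) (.copyBuffer d a) s
      (Represents k m d e (Function.update σ a R)) := by
  rw [eval_tabulateBound, Polynomial.eval_C]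
  refine (HaltsWithin.tabulate (b := 2 * a) h.size (fun i j c => c ≠ 0 ↔ R i j) ?_).mono le_rfl ?_
  · intro i j s1 h1 h2 h3
    refine ⟨_, _, Exec.store _ _ _ _ _, by simp [Expr.cost], s1, s1.arr 1 i j, ?_,
      AgreesBelow.refl _ _, ?_⟩
    · rw [h1.1 1 (by omega)]; exact hR i j
    · simp [Expr.eval, h2, h3]
  · rintro s1 ⟨h1, h2⟩
    refine ⟨by rw [h1.2 _ (by omega), h.size], by rw [h1.2 _ (by omega), h.par_k],
      by rw [h1.2 _ (by omega), h.par_m], fun l hl => by rw [h1.2 _ (by omega), h.env l hl],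
      fun b i j => ?_⟩
    by_cases hb : b = a
    · subst hb; simpa using h2 i j
    · rw [Function.update_of_ne hb, h1.1 _ (by omega), h.rel]

/-- Compiled commands compute the semantics of the loop language in polynomial time: every loop
runs over the nodes, so only the depth of nesting matters. -/
theorem Command.compile_correct (c : Command) : ∀ d, c.Scoped d → ∃ q : Polynomial ℕ,
    ∀ (n k m : ℕ) (e : ℕ → Fin n) (σ : State n) (s : Memory), Represents k m d e σ s →
      HaltsWithin (q.eval n) (c.compile d) s (Represents k m d e (c.run k m d e σ)) := by
  induction c with
  | upd a φ =>
    intro d hd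
    obtain ⟨q, hq⟩ := Formula.fill_correct φ d hd
    refine ⟨q + tabulateBound (.C 7), fun n k m e σ s h => ?_⟩
    rw [Polynomial.eval_add]
    exact (hq n k m e σ s h).seq fun s' hs' => Program.copyBuffer_correct a d hs'.1 hs'.2
  | seq c c' ih ih' =>
    intro d hd
    obtain ⟨q, hq⟩ := ih d hd.1
    obtain ⟨q', hq'⟩ := ih' d hd.2
    refine ⟨q + q', fun n k m e σ s h => ?_⟩
    rw [Polynomial.eval_add]
    exact (hq n k m e σ s h).seq fun s' hs' => hq' n k m e _ s' hs'
  | ite φ c c' ih ih' =>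
    intro d hd
    obtain ⟨q₀, hq₀⟩ := φ.compile_correct d hd.1
    obtain ⟨q, hq⟩ := ih d hd.2.1
    obtain ⟨q', hq'⟩ := ih' d hd.2.2
    refine ⟨q₀ + (.C 1 + (q + q') + .C 1), fun n k m e σ s h => ?_⟩
    simp only [Polynomial.eval_add, Polynomial.eval_C]
    refine (hq₀ n k m e σ s h).seq fun s' hs' => HaltsWithin.ite (fun hb => ?_) fun hb => ?_
    · simp only [Command.run, if_pos (hs'.2.1 hb)]
      exact (hq n k m e σ s' (h.of_agreesBelow hs'.1)).mono (by omega) fun _ h => h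
    · have : ¬ φ.Holds k m σ d e := fun hφ => hs'.2.2 hφ hb
      simp only [Command.run, if_neg this]
      exact (hq' n k m e σ s' (h.of_agreesBelow hs'.1)).mono (by omega) fun _ h => h
  | loop c ih =>
    intro d hd
    obtain ⟨q, hq⟩ := ih d (d + 1) hd
    refine ⟨.X * (q + .C 10) + .C 10, fun n k m e σ s h => ?_⟩
    simp only [Polynomial.eval_add, Polynomial.eval_mul, Polynomial.eval_X, Polynomial.eval_C]
    refine (HaltsWithin.forLoop (P := fun r s' => Represents k m d e
      (((List.finRange n).take r).foldl
        (fun τ i => (c d).run k m (d + 1) (Function.update e d i) τ) σ) s') h.size ?_ ?_).mono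
      le_rfl ?_
    · simpa using h.of_agreesBelow ((AgreesBelow.refl d s).setVar (by omega) 0)
    · intro i s1 h1 h2 h3
      refine (hq n k m _ _ s1 (h3.bind h2)).mono le_rfl fun s2 h4 => ⟨h4.size, ?_, ?_⟩
      · simpa using h4.env d (by omega)
      · have hi : (i : ℕ) < (List.finRange n).length := by simp
        rw [List.take_add_one, List.getElem?_eq_getElem hi]
        simp only [List.foldl_append, List.getElem_finRange, Option.toList_some, List.foldl_cons,
          List.foldl_nil, Fin.cast_mk, Fin.eta]
        exact h4.unbind.of_agreesBelow ((AgreesBelow.refl d s2).setVar (by omega) _)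
    · rintro s1 ⟨-, h1⟩
      rwa [List.take_of_length_le (by simp)] at h1
  | nop =>
    intro d hd
    refine ⟨.C 1, fun n k m e σ s h => ?_⟩
    rw [Polynomial.eval_C]
    exact HaltsWithin.skip h

/-- The state that holds the graph as relation `0`, all other relations being empty. -/
def initialState (G : SimpleGraph (Fin n)) : State n := fun a i j => a = 0 ∧ G.Adj i j

theorem represents_inputMemory (k m : ℕ) (G : SimpleGraph (Fin n)) (e : ℕ → Fin n) :
    Represents k m 0 e (initialState G) (inputMemory k m G) where
  size := by simp [inputMemory]
  par_k := by simp [inputMemory]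
  par_m := by simp [inputMemory]
  env := by simp
  rel := fun a i j => by simp [inputMemory, initialState]

/-- The program that runs the command `c` on the input graph and outputs the nodes that satisfy
`φ`. The array `1` of the memory is not used for a relation, so that the output can be written
there. -/
def outputProgram (c : Command) (φ : ℕ → Formula) : Program :=
  .ite (.var 0) (.seq (c.compile 0) (Formula.fill 0 fun x _ => φ x)) .skip

theorem outputProgram_correct (c : Command) (φ : ℕ → Formula) (hc : c.Scoped 0)
    (hφ : (φ 0).Scoped 2) : ∃ q : Polynomial ℕ, ∀ (k m n : ℕ) (G : SimpleGraph (Fin n)),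
      ∃ t s, Exec (outputProgram c φ) (inputMemory k m G) t s ∧ t ≤ q.eval n ∧
        ∀ (e : ℕ → Fin n) (v : Fin n), v ∈ outputSet n s ↔
          (φ 0).Holds k m (c.run k m 0 e (initialState G)) 2
            (Function.update (Function.update e 0 v) 1 ⟨0, v.pos⟩) := by
  obtain ⟨q, hq⟩ := c.compile_correct 0 hc
  obtain ⟨q', hq'⟩ := Formula.fill_correct (fun x _ => φ x) 0 hφ
  refine ⟨.C 1 + (q + q' + .C 1) + .C 1, fun k m n G => ?_⟩
  simp only [Polynomial.eval_add, Polynomial.eval_C]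
  rcases Nat.eq_zero_or_pos n with rfl | hn
  · refine ⟨_, _, .iteFalse (by simp [Expr.eval, inputMemory]) (.skip _), ?_,
      fun e v => v.elim0⟩
    simp only [Expr.cost]; omega
  · -- the run does not depend on the assignment of the variables
    obtain ⟨t, s, h1, h2, h3⟩ := hq n k m (fun _ => ⟨0, hn⟩) _ _ (represents_inputMemory k m G _)
    have h4 : ∀ e : ℕ → Fin n, Represents k m 0 e (c.run k m 0 e (initialState G)) s := by
      intro e
      obtain ⟨t', s', g1, -, g3⟩ := hq n k m e _ _ (represents_inputMemory k m G e)
      obtain ⟨-, rfl⟩ := h1.unique g1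
      exact g3
    obtain ⟨t', s', h5, h6, -⟩ := hq' n k m _ _ _ (h4 fun _ => ⟨0, hn⟩)
    refine ⟨_, _, .iteTrue ?_ (.seq h1 h5), ?_, fun e v => ?_⟩
    · simp [Expr.eval, inputMemory]; omega
    · simp only [Expr.cost]; omega
    · obtain ⟨t'', s'', g5, -, g6⟩ := hq' n k m _ _ _ (h4 e)
      obtain ⟨-, rfl⟩ := h5.unique g5
      simpa [outputSet] using g6.2 v ⟨0, v.pos⟩

end Correctness

/-! ### Connectivity of induced subgraphs -/

section Connectivity

variable {V : Type*} [Fintype V] [DecidableEq V] {G : SimpleGraph V}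

theorem mem_boundary {X : Finset V} {v : V} :
    v ∈ boundary G X ↔ v ∉ X ∧ ∃ u ∈ X, G.Adj u v := by
  simp [boundary]

theorem mem_closedNbhd {X : Finset V} {v : V} :
    v ∈ closedNbhd G X ↔ v ∈ X ∨ ∃ u ∈ X, G.Adj u v := by
  simp only [closedNbhd, Finset.mem_union, mem_boundary]
  tauto

/-- An induced subgraph is connected if and only if an edge leaves each of its proper nonempty
sets of nodes. -/
theorem induce_preconnected_iff {S : Finset V} : (G.induce (S : Set V)).Preconnected ↔
    ∀ A ⊆ S, A.Nonempty → (S \ A).Nonempty → ∃ a ∈ A, ∃ b ∈ S \ A, G.Adj a b := by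
  constructor
  · rintro h A hA ⟨a, ha⟩ ⟨b, hb⟩
    rw [Finset.mem_sdiff] at hb
    obtain ⟨w⟩ := h ⟨a, hA ha⟩ ⟨b, hb.1⟩
    obtain ⟨d, -, h1, h2⟩ := w.exists_boundary_dart {x | (x : V) ∈ A} ha hb.2
    exact ⟨d.fst, h1, d.snd, Finset.mem_sdiff.2 ⟨d.snd.2, h2⟩, d.adj⟩
  · classical
    intro h x y
    by_contra hxy
    let A : Finset V := S.filter fun z => ∃ hz : z ∈ S, (G.induce (S : Set V)).Reachable x ⟨z, hz⟩
    obtain ⟨a, ha, b, hb, hab⟩ := h A (Finset.filter_subset _ _)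
      ⟨x, by simp only [A, Finset.mem_filter]; exact ⟨x.2, x.2, .refl _⟩⟩
      ⟨y, by
        simp only [A, Finset.mem_sdiff, Finset.mem_filter, not_and, not_exists]
        exact ⟨y.2, fun _ _ => hxy⟩⟩
    simp only [A, Finset.mem_sdiff, Finset.mem_filter, not_and, not_exists] at ha hb
    obtain ⟨-, ha, hr⟩ := ha
    exact hb.2 hb.1 hb.1 (hr.trans (SimpleGraph.Adj.reachable (by simpa using hab)))

open Classical in
/-- Adding nodes with at least `k` neighbours each preserves `k`-connectivity. -/
theorem IsKConnected.superset {k : ℕ} {A T : Finset V} (h : IsKConnected G k A) (hAT : A ⊆ T)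
    (hT : ∀ v ∈ T, v ∉ A → k ≤ (A.filter fun u => G.Adj v u).card) : IsKConnected G k T := by
  intro Z hZ hZk
  have hnb : ∀ v ∈ T, v ∉ A → ∃ u ∈ A, u ∉ Z ∧ G.Adj v u := by
    intro v hv hvA
    by_contra! hcon
    have : (A.filter fun u => G.Adj v u) ⊆ Z := fun u hu => by
      rw [Finset.mem_filter] at hu
      by_contra huZ
      exact hcon u hu.1 huZ hu.2
    have := Finset.card_le_card this
    have := hT v hv hvA
    omega
  have hA := h (Z ∩ A) Finset.inter_subset_right
    (lt_of_le_of_lt (Finset.card_le_card Finset.inter_subset_left) hZk)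
  rw [induce_preconnected_iff] at hA ⊢
  rintro B hB ⟨x, hx⟩ ⟨y, hy⟩
  have hx' := Finset.mem_sdiff.1 (hB hx)
  have hy' := Finset.mem_sdiff.1 (Finset.mem_sdiff.1 hy).1
  by_cases h1 : ∃ a ∈ A, a ∈ B
  · by_cases h2 : ∃ a ∈ A, a ∉ Z ∧ a ∉ B
    · obtain ⟨a, ha, haB⟩ := h1
      obtain ⟨a', ha', haZ', haB'⟩ := h2
      obtain ⟨c, hc, d, hd, hcd⟩ := hA (B ∩ A)
        (fun z hz => by
          have := Finset.mem_sdiff.1 (hB (Finset.mem_inter.1 hz).1)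
          simp only [Finset.mem_inter, Finset.mem_sdiff] at hz ⊢
          exact ⟨hz.2, fun h => this.2 h.1⟩)
        ⟨a, by simp [ha, haB]⟩ ⟨a', by simp [ha', haZ', haB']⟩
      simp only [Finset.mem_inter, Finset.mem_sdiff] at hc hd
      refine ⟨c, hc.1, d, ?_, hcd⟩
      simp only [Finset.mem_sdiff]
      have := hAT hd.1.1
      tauto
    · push Not at h2
      have hyA : y ∉ A := fun hyA => (Finset.mem_sdiff.1 hy).2 (h2 y hyA hy'.2)
      obtain ⟨u, hu, huZ, hyu⟩ := hnb y hy'.1 hyA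
      exact ⟨u, h2 u hu huZ, y, hy, hyu.symm⟩
  · push Not at h1
    obtain ⟨u, hu, huZ, hxu⟩ := hnb x hx'.1 fun hxA => h1 x hxA hx
    exact ⟨x, hx, u, by simp [hAT hu, huZ, h1 u hu], hxu⟩

theorem IsKConnected.mono {k k' : ℕ} {T : Finset V} (h : IsKConnected G k T) (hk : k' ≤ k) :
    IsKConnected G k' T := fun Z hZ hZk => h Z hZ (by omega)

open Classical in
theorem IsDominating.mono {m : ℕ} {D D' : Finset V} (h : IsDominating G m D) (hD : D ⊆ D') :
    IsDominating G m D' := fun v hv =>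
  (h v fun hvD => hv (hD hvD)).trans (Finset.card_le_card (Finset.filter_subset_filter _ hD))

/-- A graph with a `(k, m)`-CDS is itself `k`-connected if `k ≤ m`. -/
theorem IsCDS.univ_isKConnected {k m : ℕ} {S : Finset V} (h : IsCDS G k m S) (hkm : k ≤ m) :
    IsKConnected G k Finset.univ :=
  h.1.superset (Finset.subset_univ S) fun v _ hv => hkm.trans (h.2 v hv)

/-- More removable nodes than there are nodes at all: every set of nodes is connected. -/
theorem IsKConnected.of_card_lt {k j : ℕ} (h : IsKConnected G k Finset.univ)
    (hk : Fintype.card V < k) (T : Finset V) : IsKConnected G j T := by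
  intro Z hZ _
  have := h (T \ Z)ᶜ (Finset.subset_univ _) (lt_of_le_of_lt (Finset.card_le_univ _) hk)
  rwa [← Finset.compl_eq_univ_sdiff, compl_compl] at this

end Connectivity

/-! ### Independent sets in unit disk graphs, and the size of the first set -/

section Packing

variable {V : Type*} [Fintype V] [DecidableEq V] {G : SimpleGraph V}

open Classical in
/-- The neighbours of a node lie in a square with side length two, which 25 cells with side length
`1 / 2` cover; two independent nodes never share a cell. -/
theorem IsUnitDiskGraph.card_indep_nbrs_le (hG : IsUnitDiskGraph G) {J : Finset V}
    (hJ : G.IsIndepSet (J : Set V)) (d : V) : (J.filter fun u => G.Adj u d).card ≤ 25 := by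
  obtain ⟨p, hp⟩ := hG
  let f : V → ℤ × ℤ := fun u => (⌊2 * (p u 0 - p d 0)⌋, ⌊2 * (p u 1 - p d 1)⌋)
  have hdist : ∀ u v, dist (p u) (p v) ^ 2 = (p u 0 - p v 0) ^ 2 + (p u 1 - p v 1) ^ 2 := by
    intro u v
    rw [EuclideanSpace.dist_eq, Real.sq_sqrt (by positivity)]
    simp [Fin.sum_univ_two, Real.dist_eq, sq_abs]
  have hcard : (Finset.Icc (-2 : ℤ) 2 ×ˢ Finset.Icc (-2 : ℤ) 2).card = 25 := by decide
  rw [← hcard]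
  refine Finset.card_le_card_of_injOn f ?_ ?_
  · intro u hu
    simp only [Finset.coe_filter, Set.mem_ofPred_eq] at hu
    have h1 := ((hp u d).1 hu.2).2
    have h2 := hdist u d
    have h3 : dist (p u) (p d) ^ 2 ≤ 1 := by
      have := dist_nonneg (x := p u) (y := p d)
      nlinarith
    have key : ∀ x : ℝ, x ^ 2 ≤ 1 → ⌊2 * x⌋ ∈ Finset.Icc (-2 : ℤ) 2 := by
      intro x hx
      have h := abs_le.1 ((sq_le_one_iff_abs_le_one x).1 hx)
      rw [Finset.mem_Icc]
      constructor
      · rw [Int.le_floor]; push_cast; linarith [h.1]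
      · rw [← Int.lt_add_one_iff, Int.floor_lt]; push_cast; linarith [h.2]
    simp only [Finset.coe_product, Set.mem_prod, Finset.mem_coe, f]
    exact ⟨key _ (by nlinarith [sq_nonneg (p u 1 - p d 1)]),
      key _ (by nlinarith [sq_nonneg (p u 0 - p d 0)])⟩
  · intro u hu v hv huv
    simp only [Finset.coe_filter, Set.mem_ofPred_eq] at hu hv
    by_contra hne
    refine hJ hu.1 hv.1 hne ((hp u v).2 ⟨hne, ?_⟩)
    have key : ∀ x y : ℝ, ⌊2 * x⌋ = ⌊2 * y⌋ → (x - y) ^ 2 ≤ 1 / 4 := by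
      intro x y hxy
      have := abs_lt.1 (Int.abs_sub_lt_one_of_floor_eq_floor hxy)
      nlinarith
    have h0 := key _ _ (congrArg Prod.fst huv)
    have h1 := key _ _ (congrArg Prod.snd huv)
    have h2 := hdist u v
    have h3 : dist (p u) (p v) ^ 2 ≤ 1 := by
      rw [h2]
      calc _ = (p u 0 - p d 0 - (p v 0 - p d 0)) ^ 2 + (p u 1 - p d 1 - (p v 1 - p d 1)) ^ 2 := by
            ring
        _ ≤ 1 := by linarith
    exact (sq_le_one_iff₀ dist_nonneg).1 h3

open Classical in
theorem IsUnitDiskGraph.mul_card_sdiff_le (hG : IsUnitDiskGraph G) {m : ℕ} {D J : Finset V}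
    (hD : IsDominating G m D) (hJ : G.IsIndepSet (J : Set V)) :
    (J \ D).card * m ≤ D.card * 25 := by
  refine Finset.card_mul_le_card_mul G.Adj (fun a ha => ?_) fun b _ => ?_
  · exact hD a (Finset.mem_sdiff.1 ha).2
  · refine (Finset.card_le_card ?_).trans (hG.card_indep_nbrs_le hJ b)
    exact Finset.filter_subset_filter _ Finset.sdiff_subset

/-- Outside of `D`, each of the `m` independent sets has at most `25 |D| / m` nodes. -/
theorem IsShangOutput.card_le (hG : IsUnitDiskGraph G) {m : ℕ} (hm : 1 ≤ m) {D T : Finset V}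
    (hT : IsShangOutput G m T) (hD : IsDominating G m D) : T.card ≤ 52 * D.card := by
  obtain ⟨I, C, hI, -, hC, -, rfl⟩ := hT
  have hb : ∀ i ∈ Finset.range m, (I i \ D).card * m ≤ D.card * 25 := fun i hi =>
    hG.mul_card_sdiff_le hD (hI i (Finset.mem_range.1 hi)).prop.1
  have h1 : ((Finset.range m).biUnion I).card ≤ 26 * D.card := by
    have hsub : (Finset.range m).biUnion I ⊆ D ∪ (Finset.range m).biUnion fun i => I i \ D := by
      intro v hv
      simp only [Finset.mem_union, Finset.mem_biUnion, Finset.mem_sdiff] at hv ⊢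
      by_cases hvD : v ∈ D
      · exact .inl hvD
      · obtain ⟨i, hi, hvi⟩ := hv
        exact .inr ⟨i, hi, hvi, hvD⟩
    have h2 : ∑ i ∈ Finset.range m, (I i \ D).card ≤ D.card * 25 := by
      have h3 := Finset.sum_le_sum hb
      rw [← Finset.sum_mul, Finset.sum_const, Finset.card_range, smul_eq_mul, mul_comm m] at h3
      exact Nat.le_of_mul_le_mul_right h3 hm
    have h4 := (Finset.card_le_card hsub).trans (Finset.card_union_le _ _)
    have h5 := Finset.card_biUnion_le (s := Finset.range m) (t := fun i => I i \ D)
    omega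
  have h2 : (I 0).card ≤ ((Finset.range m).biUnion I).card :=
    Finset.card_le_card (Finset.subset_biUnion_of_mem I (Finset.mem_range.2 hm))
  have h3 := Finset.card_union_le ((Finset.range m).biUnion I) C
  omega

/-- By maximality, a node that no `I j` with `j ≤ i` contains has a neighbour in `I i`. -/
theorem exists_adj_of_maximal_indep {I : ℕ → Finset V} {i : ℕ}
    (h : Maximal (fun J : Finset V =>
      G.IsIndepSet (J : Set V) ∧ Disjoint J ((Finset.range i).biUnion I)) (I i))
    {v : V} (hv : ∀ j ≤ i, v ∉ I j) : ∃ u ∈ I i, G.Adj v u := by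
  by_contra! hcon
  refine hv i le_rfl (h.le_of_ge (y := insert v (I i)) ⟨?_, ?_⟩ (Finset.subset_insert _ _)
    (Finset.mem_insert_self _ _))
  · rw [Finset.coe_insert, SimpleGraph.isIndepSet_iff, Set.pairwise_insert]
    exact ⟨h.prop.1, fun b hb _ => ⟨hcon b hb, fun hba => hcon b hb hba.symm⟩⟩
  · rw [Finset.disjoint_insert_left]
    refine ⟨?_, h.prop.2⟩
    simp only [Finset.mem_biUnion, Finset.mem_range, not_exists, not_and]
    exact fun j hj => hv j hj.le

open Classical in
theorem IsShangOutput.isDominating {m : ℕ} {T : Finset V} (hT : IsShangOutput G m T) :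
    IsDominating G m T := by
  obtain ⟨I, C, hI, -, -, -, rfl⟩ := hT
  intro v hv
  simp only [Finset.mem_union, Finset.mem_biUnion, Finset.mem_range, not_or, not_exists,
    not_and] at hv
  have hu : ∀ i, ∃ u, i < m → u ∈ I i ∧ G.Adj v u := by
    intro i
    by_cases hi : i < m
    · obtain ⟨u, hu⟩ := exists_adj_of_maximal_indep (hI i hi) fun j hj => hv.1 j (by omega)
      exact ⟨u, fun _ => hu⟩
    · exact ⟨v, fun h => absurd h hi⟩
  choose u hu using hu
  have hdisj : ∀ i j, j < m → i < j → u i ≠ u j := by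
    intro i j hj hij heq
    have h1 := (hI j hj).prop.2
    rw [Finset.disjoint_left] at h1
    exact h1 (hu j hj).1 (Finset.mem_biUnion.2 ⟨i, Finset.mem_range.2 hij,
      heq ▸ (hu i (by omega)).1⟩)
  have hcard := Finset.card_le_card_of_injOn (s := Finset.range m)
    (t := ((Finset.range m).biUnion I ∪ C).filter fun w => G.Adj v w) u
    (fun i hi => by
      have hi' := Finset.mem_range.1 hi
      simp only [Finset.coe_filter, Set.mem_ofPred_eq, Finset.mem_union, Finset.mem_biUnion]
      exact ⟨.inl ⟨i, hi, (hu i hi').1⟩, (hu i hi').2⟩)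
    (fun i hi j hj heq => by
      simp only [Finset.coe_range, Set.mem_Iio] at hi hj
      rcases lt_trichotomy i j with h | h | h
      · exact absurd heq (hdisj i j hj h)
      · exact h
      · exact absurd heq.symm (hdisj j i hi h))
  simpa using hcard

theorem IsShangOutput.isKConnected {m : ℕ} (hm : 1 ≤ m) {T : Finset V}
    (hT : IsShangOutput G m T) : IsKConnected G 1 T := by
  classical
  obtain ⟨I, C, hI, -, -, hconn, rfl⟩ := hT
  have h0 : I 0 ⊆ (Finset.range m).biUnion I :=
    Finset.subset_biUnion_of_mem I (Finset.mem_range.2 hm)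
  refine IsKConnected.superset (A := C ∪ I 0) ?_ ?_ ?_
  · intro Z _ hZ
    have : Z = ∅ := by simpa using hZ
    subst this
    rwa [Finset.sdiff_empty]
  · exact Finset.union_subset Finset.subset_union_right (h0.trans Finset.subset_union_left)
  · intro v _ hv
    rw [Finset.mem_union, not_or] at hv
    obtain ⟨u, hu, huv⟩ := exists_adj_of_maximal_indep (hI 0 hm) (v := v) fun j hj => by
      rw [Nat.le_zero.1 hj]; exact hv.2
    exact Finset.card_pos.2 ⟨u, by simp [hu, huv]⟩

end Packing

/-! ### The number of augmentation steps -/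

section EdgeCount

variable {V : Type*} [DecidableEq V]

/-- A sequence of pairs `u i`, `v i` for `i < r`, each with a partition of `T` into `A i`, `B i`
and a set of fewer than `k` nodes, such that the `i`-th pair joins `A i` to `B i` and no earlier
pair does. -/
structure SeparatedPairs (k r : ℕ) (T : Finset V) (u v : ℕ → V) (A B : ℕ → Finset V) : Prop where
  left_mem : ∀ i < r, u i ∈ A i
  right_mem : ∀ i < r, v i ∈ B i
  left_subset : ∀ i < r, A i ⊆ T
  right_subset : ∀ i < r, B i ⊆ T
  disj : ∀ i < r, Disjoint (A i) (B i)
  card_lt : ∀ i < r, (T \ (A i ∪ B i)).card < k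
  earlier : ∀ i < r, ∀ i' < i, ¬ (u i' ∈ A i ∧ v i' ∈ B i)
  earlier' : ∀ i < r, ∀ i' < i, ¬ (v i' ∈ A i ∧ u i' ∈ B i)

namespace SeparatedPairs

variable {k r : ℕ} {T : Finset V} {u v : ℕ → V} {A B : ℕ → Finset V}

/-- The indices of the pairs with both nodes in `W`. -/
def inside (r : ℕ) (u v : ℕ → V) (W : Finset V) : Finset ℕ :=
  (Finset.range r).filter fun i => u i ∈ W ∧ v i ∈ W

/-- The indices of the pairs in `W` that contain `x`. -/
def incident (r : ℕ) (u v : ℕ → V) (W : Finset V) (x : V) : Finset ℕ :=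
  (inside r u v W).filter fun i => u i = x ∨ v i = x

theorem mem_inside {W : Finset V} {i : ℕ} : i ∈ inside r u v W ↔ i < r ∧ u i ∈ W ∧ v i ∈ W := by
  simp [inside]

theorem mem_incident {W : Finset V} {x : V} {i : ℕ} : i ∈ incident r u v W x ↔
    (i < r ∧ u i ∈ W ∧ v i ∈ W) ∧ (u i = x ∨ v i = x) := by
  simp [incident, mem_inside]

theorem ne (h : SeparatedPairs k r T u v A B) {i : ℕ} (hi : i < r) : u i ≠ v i := fun heq =>
  Finset.disjoint_left.1 (h.disj i hi) (h.left_mem i hi) (heq ▸ h.right_mem i hi)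

theorem pair_inj (h : SeparatedPairs k r T u v A B) {i i' : ℕ} (hi : i < r) (hi' : i' < r)
    (heq : u i = u i' ∧ v i = v i' ∨ u i = v i' ∧ v i = u i') : i = i' := by
  wlog hlt : i' < i generalizing i i'
  · rcases Nat.lt_or_ge i i' with h' | h'
    · exact (this hi' hi (by tauto) h').symm
    · omega
  rcases heq with ⟨h1, h2⟩ | ⟨h1, h2⟩
  · exact absurd ⟨h1 ▸ h.left_mem i hi, h2 ▸ h.right_mem i hi⟩ (h.earlier i hi i' hlt)
  · exact absurd ⟨h1 ▸ h.left_mem i hi, h2 ▸ h.right_mem i hi⟩ (h.earlier' i hi i' hlt)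

theorem card_inside_le_choose (h : SeparatedPairs k r T u v A B) (W : Finset V) :
    (inside r u v W).card ≤ W.card.choose 2 := by
  rw [← Sym2.card_image_offDiag]
  refine Finset.card_le_card_of_injOn (fun i => s(u i, v i)) (fun i hi => ?_) fun i hi i' hi' heq => ?_
  · rw [Finset.mem_coe, mem_inside] at hi
    exact Finset.mem_image.2 ⟨(u i, v i), Finset.mem_offDiag.2 ⟨hi.2.1, hi.2.2, h.ne hi.1⟩, rfl⟩
  · rw [Finset.mem_coe, mem_inside] at hi hi'
    exact h.pair_inj hi.1 hi'.1 (Sym2.eq_iff.1 heq)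

theorem card_inside_le_erase (W : Finset V) (x : V) : (inside r u v W).card ≤
    (inside r u v (W.erase x)).card + (incident r u v W x).card := by
  refine (Finset.card_le_card fun i hi => ?_).trans (Finset.card_union_le _ _)
  rw [Finset.mem_union, mem_incident, mem_inside]
  rw [mem_inside] at hi
  simp only [Finset.mem_erase]
  tauto

/-- The pairs at `x` whose other nodes lie in `W'` are at most `|W'|` many. -/
theorem card_incident_le (h : SeparatedPairs k r T u v A B) {W W' : Finset V} {x : V}
    {s : Finset ℕ} (hs : s ⊆ incident r u v W x)
    (hW' : ∀ i ∈ s, (u i = x → v i ∈ W') ∧ (v i = x → u i ∈ W')) : s.card ≤ W'.card := by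
  refine Finset.card_le_card_of_injOn (fun i => if u i = x then v i else u i)
    (fun i hi => ?_) fun i hi i' hi' heq => ?_
  · have h1 := mem_incident.1 (hs hi)
    have h2 := hW' i hi
    dsimp only
    split_ifs with hx
    · exact h2.1 hx
    · exact h2.2 (h1.2.resolve_left hx)
  · have h1 := mem_incident.1 (hs hi)
    have h2 := mem_incident.1 (hs hi')
    refine h.pair_inj h1.1.1 h2.1.1 ?_
    dsimp only at heq
    have h3 := h1.2
    have h4 := h2.2
    split_ifs at heq with g1 g2 g2
    · exact .inl ⟨g1.trans g2.symm, heq⟩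
    · exact .inr ⟨g1.trans (h4.resolve_left g2).symm, heq⟩
    · exact .inr ⟨heq, (h3.resolve_left g1).trans g2.symm⟩
    · exact .inl ⟨heq, (h3.resolve_left g1).trans (h4.resolve_left g2).symm⟩

/-- A set of at least `2 k` nodes contains at most `(2 k - 1) (|W| - k)` of the pairs. As in
Mader's theorem on highly connected subgraphs, either a node with few pairs can be deleted, or
`W` splits along the cut of its last pair into two sets with at least `2 k` nodes each. -/
theorem card_inside_add_le (h : SeparatedPairs k r T u v A B) (hk : 1 ≤ k) :
    ∀ (N : ℕ) (W : Finset V), W.card = N → W ⊆ T → 2 * k ≤ W.card →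
      (inside r u v W).card + (2 * k - 1) * k ≤ (2 * k - 1) * W.card := by
  intro N
  induction N using Nat.strong_induction_on with
  | _ N ih =>
  intro W hN hWT hW
  obtain ⟨c, rfl⟩ : ∃ c, k = c + 1 := ⟨k - 1, by omega⟩
  have hc : 2 * (c + 1) - 1 = 2 * c + 1 := by omega
  rw [hc]
  rcases hW.eq_or_lt with hW | hW
  -- exactly `2 k` nodes: the bound is the number of all pairs
  · have h1 := h.card_inside_le_choose W
    have h2 : (2 * (c + 1)).choose 2 = (c + 1) * (2 * c + 1) := by
      rw [Nat.choose_two_right, hc, Nat.div_eq_of_eq_mul_left (by norm_num)]; ring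
    rw [← hW] at h1 ⊢
    rw [h2] at h1
    nlinarith
  by_cases hdeg : ∃ x ∈ W, (incident r u v W x).card ≤ 2 * c + 1
  -- deletion of `x` loses at most `2 k - 1` pairs
  · obtain ⟨x, hx, hdx⟩ := hdeg
    have h1 := card_inside_le_erase (r := r) (u := u) (v := v) W x
    have h2 := Finset.card_erase_add_one hx
    have h3 := ih (W.erase x).card (by omega) (W.erase x) rfl ((Finset.erase_subset _ _).trans hWT)
      (by omega)
    rw [hc] at h3
    rw [← h2]
    nlinarith
  push Not at hdeg
  rcases (inside r u v W).eq_empty_or_nonempty with hE | hE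
  · rw [hE, Finset.card_empty]
    nlinarith
  -- the last pair inside `W`
  let i := (inside r u v W).max' hE
  have hi : i ∈ inside r u v W := Finset.max'_mem _ _
  have himax : ∀ i' ∈ inside r u v W, i' ≠ i → i' < i := fun i' hi' hne =>
    lt_of_le_of_ne (Finset.le_max' _ _ hi') hne
  obtain ⟨hir, hui, hvi⟩ := mem_inside.1 hi
  have hd := Finset.disjoint_left.1 (h.disj i hir)
  -- the earlier pairs do not join `A i` to `B i`, so each of them avoids one of these sets
  have hsub : inside r u v W ⊆ {i} ∪ (inside r u v (W \ B i) ∪ inside r u v (W \ A i)) := by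
    intro i' hi'
    by_cases hne : i' = i
    · simp [hne]
    · have h1 := h.earlier i hir i' (himax i' hi' hne)
      have h2 := h.earlier' i hir i' (himax i' hi' hne)
      have h3 := mem_inside.1 hi'
      have h4 := hd (a := u i')
      have h5 := hd (a := v i')
      simp only [Finset.mem_union, mem_inside, Finset.mem_sdiff]
      tauto
  have hcard := (Finset.card_le_card hsub).trans
    ((Finset.card_union_le _ _).trans (Nat.add_le_add_left (Finset.card_union_le _ _) _))
  rw [Finset.card_singleton] at hcard
  have hlt1 : (W \ B i).card < W.card := Finset.card_lt_card
    ⟨Finset.sdiff_subset, fun hs => (Finset.mem_sdiff.1 (hs hvi)).2 (h.right_mem i hir)⟩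
  have hlt2 : (W \ A i).card < W.card := Finset.card_lt_card
    ⟨Finset.sdiff_subset, fun hs => (Finset.mem_sdiff.1 (hs hui)).2 (h.left_mem i hir)⟩
  -- the two parts share only the separating nodes
  have hsum : (W \ B i).card + (W \ A i).card ≤ W.card + c := by
    rw [← Finset.card_union_add_card_inter]
    refine Nat.add_le_add (Finset.card_le_card
      (Finset.union_subset Finset.sdiff_subset Finset.sdiff_subset)) ?_
    refine (Finset.card_le_card (t := T \ (A i ∪ B i)) fun x hx => ?_).trans
      (Nat.lt_succ_iff.1 (h.card_lt i hir))
    simp only [Finset.mem_inter, Finset.mem_sdiff, Finset.mem_union] at hx ⊢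
    exact ⟨hWT hx.1.1, by tauto⟩
  -- all pairs at `u i` but the `i`-th stay in `W \ B i`
  have hbig1 : 2 * (c + 1) ≤ (W \ B i).card := by
    have h1 := h.card_incident_le (W := W) (x := u i) (W' := (W \ B i).erase (u i))
      (Finset.erase_subset i _) (fun i' hi' => by
        obtain ⟨hne, hi'⟩ := Finset.mem_erase.1 hi'
        obtain ⟨h1, -⟩ := mem_incident.1 hi'
        have hlt := himax i' (mem_inside.2 h1) hne
        have h2 := h.earlier i hir i' hlt
        have h3 := h.earlier' i hir i' hlt
        have h4 := h.ne h1.1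
        have h5 := h.left_mem i hir
        simp only [Finset.mem_erase, Finset.mem_sdiff]
        refine ⟨fun hx => ⟨hx ▸ h4.symm, h1.2.2, fun hB => h2 ⟨hx ▸ h5, hB⟩⟩,
          fun hx => ⟨hx ▸ h4, h1.2.1, fun hB => h3 ⟨hx ▸ h5, hB⟩⟩⟩)
    rw [Finset.card_erase_of_mem (mem_incident.2 ⟨⟨hir, hui, hvi⟩, .inl rfl⟩),
      Finset.card_erase_of_mem (Finset.mem_sdiff.2 ⟨hui, hd (h.left_mem i hir)⟩)] at h1
    have := hdeg (u i) hui
    omega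
  have hbig2 : 2 * (c + 1) ≤ (W \ A i).card := by
    have h1 := h.card_incident_le (W := W) (x := v i) (W' := (W \ A i).erase (v i))
      (Finset.erase_subset i _) (fun i' hi' => by
        obtain ⟨hne, hi'⟩ := Finset.mem_erase.1 hi'
        obtain ⟨h1, -⟩ := mem_incident.1 hi'
        have hlt := himax i' (mem_inside.2 h1) hne
        have h2 := h.earlier i hir i' hlt
        have h3 := h.earlier' i hir i' hlt
        have h4 := h.ne h1.1
        have h5 := h.right_mem i hir
        simp only [Finset.mem_erase, Finset.mem_sdiff]
        refine ⟨fun hx => ⟨hx ▸ h4.symm, h1.2.2, fun hA => h3 ⟨hA, hx ▸ h5⟩⟩,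
          fun hx => ⟨hx ▸ h4, h1.2.1, fun hA => h2 ⟨hA, hx ▸ h5⟩⟩⟩)
    rw [Finset.card_erase_of_mem (mem_incident.2 ⟨⟨hir, hui, hvi⟩, .inr rfl⟩),
      Finset.card_erase_of_mem (Finset.mem_sdiff.2 ⟨hvi, fun hA => hd hA (h.right_mem i hir)⟩)] at h1
    have := hdeg (v i) hvi
    omega
  have h1 := ih _ (hN ▸ hlt1) (W \ B i) rfl (Finset.sdiff_subset.trans hWT) hbig1
  have h2 := ih _ (hN ▸ hlt2) (W \ A i) rfl (Finset.sdiff_subset.trans hWT) hbig2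
  rw [hc] at h1 h2
  nlinarith

theorem le_mul_card (h : SeparatedPairs k r T u v A B) (hk : 1 ≤ k) :
    r ≤ (2 * k - 1) * T.card := by
  have hr : (inside r u v T).card = r := by
    rw [inside, Finset.filter_true_of_mem, Finset.card_range]
    intro i hi
    rw [Finset.mem_range] at hi
    exact ⟨h.left_subset i hi (h.left_mem i hi), h.right_subset i hi (h.right_mem i hi)⟩
  rcases Nat.lt_or_ge T.card (2 * k) with hT | hT
  · have h1 := h.card_inside_le_choose T
    rw [hr, Nat.choose_two_right] at h1
    calc r ≤ T.card * (T.card - 1) := h1.trans (Nat.div_le_self _ _)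
      _ ≤ T.card * (2 * k - 1) := Nat.mul_le_mul_left _ (by omega)
      _ = _ := mul_comm _ _
  · have := h.card_inside_add_le hk _ T rfl subset_rfl hT
    rw [hr] at this
    exact le_of_add_le_left this

end SeparatedPairs

end EdgeCount

/-! ### Demand cuts and covering paths -/

section Augmentation

variable {V : Type*} [Fintype V] [DecidableEq V] {G : SimpleGraph V} {j : ℕ} {T S X : Finset V}

theorem mem_sdiff_closedNbhd {v : V} :
    v ∈ T \ closedNbhd G X ↔ v ∈ T ∧ v ∉ X ∧ ∀ u ∈ X, ¬ G.Adj u v := by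
  simp only [Finset.mem_sdiff, mem_closedNbhd]
  push Not
  rfl

theorem CoversCut.two_le_length {u v : V} {P : G.Walk u v} (h : CoversCut G T X P) :
    2 ≤ P.length := by
  obtain ⟨-, hu, hv⟩ := h
  rw [mem_sdiff_closedNbhd] at hv
  match P with
  | .nil => exact absurd hu hv.2.1
  | .cons h .nil => exact absurd h (hv.2.2 u hu)
  | .cons _ (.cons _ _) => simp

/-- A covering path with two edges has one inner node. -/
theorem CoversCut.exists_of_length_two {u v : V} {P : G.Walk u v} (h : CoversCut G T X P)
    (hP : P.length = 2) : ∃ w, w ∉ T ∧ G.Adj u w ∧ G.Adj w v := by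
  obtain ⟨⟨-, -, -, hin⟩, hu, hv⟩ := h
  match P with
  | .nil => simp at hP
  | .cons h .nil => simp at hP
  | .cons (v := w) h₁ (.cons h₂ .nil) =>
    refine ⟨w, fun hw => ?_, h₁, h₂⟩
    rcases hin w (by simp) hw with rfl | rfl
    · exact G.loopless.irrefl _ h₁
    · exact G.loopless.irrefl _ h₂
  | .cons _ (.cons _ (.cons _ _)) => simp at hP

theorem coversCut_cons_cons {u w v : V} (hXT : X ⊆ T) (hu : u ∈ X) (hw : w ∉ T)
    (hv : v ∈ T \ closedNbhd G X) (h₁ : G.Adj u w) (h₂ : G.Adj w v) :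
    CoversCut G T X (.cons h₁ (.cons h₂ .nil)) := by
  have hv' := mem_sdiff_closedNbhd.1 hv
  have huv : u ≠ v := fun h => hv'.2.1 (h ▸ hu)
  refine ⟨⟨?_, hXT hu, hv'.1, ?_⟩, hu, hv⟩
  · simp [SimpleGraph.Walk.cons_isPath_iff, h₁.ne, h₂.ne, huv]
  · intro x hx hxT
    simp only [SimpleGraph.Walk.support_cons, SimpleGraph.Walk.support_nil, List.mem_cons,
      List.not_mem_nil, or_false] at hx
    rcases hx with rfl | rfl | rfl
    · exact .inl rfl
    · exact absurd hxT hw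
    · exact .inr rfl

theorem coversCut_cons_cons_cons {u w w' v : V} (hXT : X ⊆ T) (hu : u ∈ X) (hw : w ∉ T)
    (hw' : w' ∉ T) (hv : v ∈ T \ closedNbhd G X) (h₁ : G.Adj u w) (h₂ : G.Adj w w')
    (h₃ : G.Adj w' v) : CoversCut G T X (.cons h₁ (.cons h₂ (.cons h₃ .nil))) := by
  have hv' := mem_sdiff_closedNbhd.1 hv
  have huv : u ≠ v := fun h => hv'.2.1 (h ▸ hu)
  have huw' : u ≠ w' := fun h => hw' (h ▸ hXT hu)
  have hwv : w ≠ v := fun h => hw (h ▸ hv'.1)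
  refine ⟨⟨?_, hXT hu, hv'.1, ?_⟩, hu, hv⟩
  · simp [SimpleGraph.Walk.cons_isPath_iff, h₁.ne, h₂.ne, h₃.ne, huv, huw', hwv]
  · intro x hx hxT
    simp only [SimpleGraph.Walk.support_cons, SimpleGraph.Walk.support_nil, List.mem_cons,
      List.not_mem_nil, or_false] at hx
    rcases hx with rfl | rfl | rfl | rfl
    · exact .inl rfl
    · exact absurd hxT hw
    · exact absurd hxT hw'
    · exact .inr rfl

/-- `w` is the only inner node of a covering path of `X`. -/
def IsLink (G : SimpleGraph V) (T X : Finset V) (w : V) : Prop :=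
  w ∉ T ∧ (∃ u ∈ X, G.Adj u w) ∧ ∃ v ∈ T \ closedNbhd G X, G.Adj w v

/-- `w`, `w'` are the inner nodes of a covering walk of `X` with three edges. -/
def IsDoubleLink (G : SimpleGraph V) (T X : Finset V) (w w' : V) : Prop :=
  w ∉ T ∧ w' ∉ T ∧ G.Adj w w' ∧ (∃ u ∈ X, G.Adj u w) ∧ ∃ v ∈ T \ closedNbhd G X, G.Adj w' v

/-- Every node outside `T` has `j` neighbours in `T`, at most `j - 1` of them in `Γ(X)`; so a
covering path needs at most two inner nodes. -/
theorem IsDemandCut.exists_link (hX : IsDemandCut G j T X) (hdom : IsDominating G j T)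
    (hG : IsKConnected G j Finset.univ) :
    (∃ w, IsLink G T X w) ∨ ∃ w w', IsDoubleLink G T X w w' := by
  classical
  obtain ⟨⟨hXT, ⟨x, hx⟩, ⟨y, hy⟩⟩, hcard⟩ := hX
  have hnb : ∀ w ∉ T, (∃ u ∈ X, G.Adj u w) ∨ ∃ v ∈ T \ closedNbhd G X, G.Adj w v := by
    intro w hw
    by_contra! hcon
    have hsub : (T.filter fun u => G.Adj w u) ⊆ boundary G X ∩ T := by
      intro u hu
      rw [Finset.mem_filter] at hu
      rw [Finset.mem_inter, mem_boundary]
      refine ⟨⟨fun huX => hcon.1 u huX hu.2.symm, ?_⟩, hu.1⟩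
      by_contra! hno
      exact hcon.2 u (mem_sdiff_closedNbhd.2
        ⟨hu.1, fun huX => hcon.1 u huX hu.2.symm, hno⟩) hu.2
    have := Finset.card_le_card hsub
    have := hdom w hw
    omega
  have hconn := hG (boundary G X ∩ T) (Finset.subset_univ _) (by omega)
  rw [induce_preconnected_iff] at hconn
  have hyT := mem_sdiff_closedNbhd.1 hy
  obtain ⟨a, ha, b, hb, hab⟩ := hconn (X ∪ Finset.univ.filter fun w => w ∉ T ∧ ∃ u ∈ X, G.Adj u w)
    (fun z hz => by
      simp only [Finset.mem_union, Finset.mem_filter, Finset.mem_univ, true_and,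
        Finset.mem_sdiff, Finset.mem_inter, mem_boundary] at hz ⊢
      tauto)
    ⟨x, Finset.mem_union_left _ hx⟩
    ⟨y, by
      simp only [Finset.mem_union, Finset.mem_filter, Finset.mem_univ, true_and,
        Finset.mem_sdiff, Finset.mem_inter, mem_boundary]
      have h2 : ¬ ∃ u ∈ X, G.Adj u y := fun ⟨u, hu, h⟩ => hyT.2.2 u hu h
      tauto⟩
  simp only [Finset.mem_union, Finset.mem_filter, Finset.mem_univ, true_and,
    Finset.mem_sdiff, Finset.mem_inter, mem_boundary, not_or, not_and, not_exists] at ha hb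
  obtain ⟨hb1, hbX, hb2⟩ := hb
  rcases ha with haX | ⟨haT, u, hu, hua⟩
  · -- an edge that leaves `X` ends in the boundary
    by_cases hbT : b ∈ T
    · exact absurd hbT (hb1 ⟨hbX, a, haX, hab⟩)
    · exact absurd hab (hb2 hbT a haX)
  · by_cases hbT : b ∈ T
    · refine .inl ⟨a, haT, ⟨u, hu, hua⟩, b, mem_sdiff_closedNbhd.2 ⟨hbT, hbX, ?_⟩, hab⟩
      exact fun z hz hzb => hb1 ⟨hbX, z, hz, hzb⟩ hbT
    · rcases hnb b hbT with ⟨z, hz, hzb⟩ | ⟨z, hz, hbz⟩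
      · exact absurd hzb (hb2 hbT z hz)
      · exact .inr ⟨a, b, haT, hbT, hab, ⟨u, hu, hua⟩, z, hz, hbz⟩

theorem IsLink.step {w : V} (hw : IsLink G T X w) (hU : ¬ IsKConnected G j (T ∪ S))
    (hX : Minimal (fun Y => IsDemandCut G j T Y ∧ IsUncovered G T S Y) X) :
    AugmentationStep G j T S (S ∪ {w}) := by
  obtain ⟨hwT, ⟨u, hu, huw⟩, v, hv, hwv⟩ := hw
  have hXT := hX.prop.1.1.1
  have hvT := (mem_sdiff_closedNbhd.1 hv).1
  refine ⟨hU, X, hX, u, v, _, coversCut_cons_cons hXT hu hwT hv huw hwv, fun u' v' P' hP' => ?_, ?_⟩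
  · simpa using hP'.two_le_length
  · congr 1
    ext x
    simp only [Finset.mem_singleton, SimpleGraph.Walk.support_cons, SimpleGraph.Walk.support_nil,
      Finset.mem_sdiff, List.mem_toFinset, List.mem_cons, List.not_mem_nil, or_false]
    constructor
    · rintro rfl; exact ⟨.inr (.inl rfl), hwT⟩
    · rintro ⟨rfl | rfl | rfl, hx⟩
      · exact absurd (hXT hu) hx
      · rfl
      · exact absurd hvT hx

theorem IsDoubleLink.step {w w' : V} (hw : IsDoubleLink G T X w w')
    (hno : ∀ z, ¬ IsLink G T X z) (hU : ¬ IsKConnected G j (T ∪ S))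
    (hX : Minimal (fun Y => IsDemandCut G j T Y ∧ IsUncovered G T S Y) X) :
    AugmentationStep G j T S (S ∪ {w, w'}) := by
  obtain ⟨hwT, hwT', hww', ⟨u, hu, huw⟩, v, hv, hwv⟩ := hw
  have hXT := hX.prop.1.1.1
  have hvT := (mem_sdiff_closedNbhd.1 hv).1
  refine ⟨hU, X, hX, u, v, _, coversCut_cons_cons_cons hXT hu hwT hwT' hv huw hww' hwv,
    fun u' v' P' hP' => ?_, ?_⟩
  · have h2 := hP'.two_le_length
    have h3 : P'.length ≠ 2 := fun h => by
      obtain ⟨z, hz, h1, h2⟩ := hP'.exists_of_length_two h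
      exact hno z ⟨hz, ⟨u', hP'.2.1, h1⟩, v', hP'.2.2, h2⟩
    simp only [SimpleGraph.Walk.length_cons, SimpleGraph.Walk.length_nil]
    omega
  · congr 1
    ext x
    simp only [Finset.mem_insert, Finset.mem_singleton, SimpleGraph.Walk.support_cons,
      SimpleGraph.Walk.support_nil, Finset.mem_sdiff, List.mem_toFinset, List.mem_cons,
      List.not_mem_nil, or_false]
    constructor
    · rintro (rfl | rfl)
      · exact ⟨.inr (.inl rfl), hwT⟩
      · exact ⟨.inr (.inr (.inl rfl)), hwT'⟩
    · rintro ⟨rfl | rfl | rfl | rfl, hx⟩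
      · exact absurd (hXT hu) hx
      · exact .inl rfl
      · exact .inr rfl
      · exact absurd hvT hx

/-- A shortest covering path adds at most two nodes. -/
theorem card_support_sdiff_le_two (hX : IsDemandCut G j T X) (hdom : IsDominating G j T)
    (hG : IsKConnected G j Finset.univ) {u v : V} {P : G.Walk u v} (hP : CoversCut G T X P)
    (hmin : ∀ (u' v' : V) (P' : G.Walk u' v'), CoversCut G T X P' → P.length ≤ P'.length) :
    (P.support.toFinset \ T).card ≤ 2 := by
  have hlen : P.length ≤ 3 := by
    rcases hX.exists_link hdom hG with
      ⟨w, hw, ⟨a, ha, haw⟩, b, hb, hwb⟩ | ⟨w, w', hw, hw', hww', ⟨a, ha, haw⟩, b, hb, hwb⟩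
    · exact (hmin _ _ _ (coversCut_cons_cons hX.1.1 ha hw hb haw hwb)).trans (by simp)
    · exact (hmin _ _ _ (coversCut_cons_cons_cons hX.1.1 ha hw hw' hb haw hww' hwb)).trans (by simp)
  have huv : u ≠ v := fun h => (mem_sdiff_closedNbhd.1 hP.2.2).2.1 (h ▸ hP.2.1)
  have hsub : P.support.toFinset \ T ⊆ (P.support.toFinset.erase u).erase v := by
    intro x hx
    rw [Finset.mem_sdiff] at hx
    refine Finset.mem_erase.2 ⟨?_, Finset.mem_erase.2 ⟨?_, hx.1⟩⟩
    · rintro rfl; exact hx.2 hP.1.2.2.1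
    · rintro rfl; exact hx.2 hP.1.2.1
  have h1 := Finset.card_le_card hsub
  rw [Finset.card_erase_of_mem (Finset.mem_erase.2 ⟨huv.symm, by simp⟩),
    Finset.card_erase_of_mem (by simp)] at h1
  have h2 := P.support.toFinset_card_le
  rw [SimpleGraph.Walk.length_support] at h2
  omega

theorem IsUncovered.reverse (h : IsUncovered G T S X) {u v : V} {P : G.Walk u v}
    (hP : IsTPath G T P) (hS : ∀ w ∈ P.support, w ∈ T ∪ S) :
    ¬ (u ∈ X ∧ v ∈ T \ closedNbhd G X) ∧ ¬ (v ∈ X ∧ u ∈ T \ closedNbhd G X) := by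
  refine ⟨fun h' => h u v P hS ⟨hP, h'⟩, fun h' => h v u P.reverse ?_ ⟨⟨?_, hP.2.2.1, hP.2.1, ?_⟩, h'⟩⟩
  · simpa using hS
  · exact hP.1.reverse
  · intro w hw hwT
    exact (hP.2.2.2 w (by simpa using hw) hwT).symm

/-- After `r` steps there are `r` pairs of nodes, the ends of the paths, and their cuts: an
uncovered cut is not crossed by an earlier path. -/
theorem exists_separatedPairs [Nonempty V] (hdom : IsDominating G j T) (hG : IsKConnected G j Finset.univ)
    (hS : Relation.ReflTransGen (AugmentationStep G j T) ∅ S) :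
    ∃ (r : ℕ) (u v : ℕ → V) (A B : ℕ → Finset V), S.card ≤ 2 * r ∧
      SeparatedPairs j r T u v A B ∧
      ∀ i < r, ∃ P : G.Walk (u i) (v i), IsTPath G T P ∧ ∀ w ∈ P.support, w ∈ T ∪ S := by
  classical
  induction hS with
  | refl =>
    obtain ⟨x⟩ := ‹Nonempty V›
    exact ⟨0, fun _ => x, fun _ => x, fun _ => ∅, fun _ => ∅, by simp,
      ⟨by simp, by simp, by simp, by simp, by simp, by simp, by simp, by simp⟩, by simp⟩
  | tail _ hstep ih =>
    rename_i S₀ S₁ _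
    obtain ⟨r, u, v, A, B, hcard, hsep, hpath⟩ := ih
    obtain ⟨-, X, hX, a, b, P, hP, hmin, rfl⟩ := hstep
    obtain ⟨⟨⟨hXT, -, -⟩, hXcard⟩, hunc⟩ := hX.prop
    have hlt : ∀ i, i < r + 1 → i ≠ r → i < r := fun i h1 h2 => by omega
    refine ⟨r + 1, Function.update u r a, Function.update v r b, Function.update A r X,
      Function.update B r (T \ closedNbhd G X), ?_, ⟨?_, ?_, ?_, ?_, ?_, ?_, ?_, ?_⟩, ?_⟩
    · have := Finset.card_union_le S₀ (P.support.toFinset \ T)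
      have := card_support_sdiff_le_two hX.prop.1 hdom hG hP hmin
      omega
    · intro i hi
      by_cases h : i = r
      · subst h; simpa using hP.2.1
      · simpa [h] using hsep.left_mem i (hlt i hi h)
    · intro i hi
      by_cases h : i = r
      · subst h; simpa only [Function.update_self] using hP.2.2
      · simpa [h] using hsep.right_mem i (hlt i hi h)
    · intro i hi
      by_cases h : i = r
      · subst h; simpa using hXT
      · simpa [h] using hsep.left_subset i (hlt i hi h)
    · intro i hi
      by_cases h : i = r
      · subst h; simp only [Function.update_self]; exact Finset.sdiff_subset
      · simpa [h] using hsep.right_subset i (hlt i hi h)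
    · intro i hi
      by_cases h : i = r
      · subst h
        simp only [Function.update_self]
        exact Finset.disjoint_left.2 fun x hx hx' => (mem_sdiff_closedNbhd.1 hx').2.1 hx
      · simpa [h] using hsep.disj i (hlt i hi h)
    · intro i hi
      by_cases h : i = r
      · subst h
        simp only [Function.update_self]
        refine lt_of_le_of_lt (Finset.card_le_card (t := boundary G X ∩ T) fun x hx => ?_)
          (Nat.lt_of_succ_le hXcard.le)
        simp only [Finset.mem_sdiff, Finset.mem_union, closedNbhd, Finset.mem_inter] at hx ⊢
        tauto
      · simpa [h] using hsep.card_lt i (hlt i hi h)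
    · intro i hi i' hi'
      have hi'r : i' ≠ r := by omega
      by_cases h : i = r
      · subst h
        obtain ⟨Q, hQ, hQS⟩ := hpath i' hi'
        simpa only [Function.update_self, Function.update_of_ne hi'r] using (hunc.reverse hQ hQS).1
      · simpa [h, hi'r] using hsep.earlier i (hlt i hi h) i' hi'
    · intro i hi i' hi'
      have hi'r : i' ≠ r := by omega
      by_cases h : i = r
      · subst h
        obtain ⟨Q, hQ, hQS⟩ := hpath i' hi'
        simpa only [Function.update_self, Function.update_of_ne hi'r] using (hunc.reverse hQ hQS).2
      · simpa [h, hi'r] using hsep.earlier' i (hlt i hi h) i' hi'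
    · intro i hi
      by_cases h : i = r
      · subst h
        rw [Function.update_self, Function.update_self]
        refine ⟨P, hP.1, fun w hw => ?_⟩
        simp only [Finset.mem_union, Finset.mem_sdiff, List.mem_toFinset]
        tauto
      · rw [Function.update_of_ne h, Function.update_of_ne h]
        obtain ⟨Q, hQ, hQS⟩ := hpath i (hlt i hi h)
        refine ⟨Q, hQ, fun w hw => ?_⟩
        have := hQS w hw
        simp only [Finset.mem_union] at this ⊢
        tauto

/-- There are at most `(2 j - 1) |T|` steps, each of which adds at most two nodes. -/
theorem IsAugmentation.card_le {T' : Finset V} (h : IsAugmentation G j T T') (hj : 1 ≤ j)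
    (hdom : IsDominating G j T) (hG : IsKConnected G j Finset.univ) :
    T'.card ≤ 5 * j * T.card := by
  obtain ⟨S, hS, -, rfl⟩ := h
  rcases isEmpty_or_nonempty V with hV | hV
  · simp [Finset.eq_empty_of_isEmpty]
  · obtain ⟨r, u, v, A, B, hcard, hsep, -⟩ := exists_separatedPairs hdom hG hS
    have h1 := hsep.le_mul_card hj
    have h2 := Finset.card_union_le T S
    obtain ⟨c, rfl⟩ : ∃ c, j = c + 1 := ⟨j - 1, by omega⟩
    have h3 : 2 * (c + 1) - 1 = 2 * c + 1 := by omega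
    rw [h3] at h1
    nlinarith

/-! ### Demand cuts as small cuts of the augmented graph -/

variable {U : Finset V} {s t : V}

/-- `A` is a set of nodes of `G[U]` that contains `s` and that fewer than `j` nodes of `U`
separate from `t`. -/
structure IsSmallCut (G : SimpleGraph V) (j : ℕ) (U : Finset V) (s t : V) (A : Finset V) :
    Prop where
  subset : A ⊆ U
  left_mem : s ∈ A
  right_notMem : t ∉ closedNbhd G A
  card_lt : (boundary G A ∩ U).card < j

theorem IsSmallCut.not_isKConnected {A : Finset V} (h : IsSmallCut G j U s t A) (ht : t ∈ U) :
    ¬ IsKConnected G j U := by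
  intro hU
  have hconn := hU (boundary G A ∩ U) Finset.inter_subset_right h.card_lt
  rw [induce_preconnected_iff] at hconn
  have ht' := h.right_notMem
  rw [closedNbhd, Finset.mem_union, not_or] at ht'
  obtain ⟨a, ha, b, hb, hab⟩ := hconn A
    (fun z hz => Finset.mem_sdiff.2 ⟨h.subset hz, fun hz' =>
      (mem_boundary.1 (Finset.mem_inter.1 hz').1).1 hz⟩)
    ⟨s, h.left_mem⟩
    ⟨t, by simp only [Finset.mem_sdiff, Finset.mem_inter]; tauto⟩
  simp only [Finset.mem_sdiff, Finset.mem_inter, mem_boundary] at hb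
  exact hb.1.2 ⟨⟨hb.2, a, ha, hab⟩, hb.1.1⟩

/-- A set that is not `j`-connected has a small cut between two nodes of `T`, since every other
node keeps a neighbour in `T` when fewer than `j` nodes are removed. -/
theorem exists_isSmallCut (hdom : IsDominating G j T) (hTU : T ⊆ U) (hU : ¬ IsKConnected G j U) :
    ∃ s ∈ T, ∃ t ∈ T, ∃ A, IsSmallCut G j U s t A := by
  classical
  simp only [IsKConnected, not_forall] at hU
  obtain ⟨Z, hZU, hZ, hconn⟩ := hU
  have hnb : ∀ w ∈ U \ Z, ∃ a ∈ T \ Z, a = w ∨ G.Adj w a := by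
    intro w hw
    rw [Finset.mem_sdiff] at hw
    by_cases hwT : w ∈ T
    · exact ⟨w, Finset.mem_sdiff.2 ⟨hwT, hw.2⟩, .inl rfl⟩
    · by_contra! hcon
      have hsub : (T.filter fun u => G.Adj w u) ⊆ Z := by
        intro u hu
        rw [Finset.mem_filter] at hu
        by_contra huZ
        exact (hcon u (Finset.mem_sdiff.2 ⟨hu.1, huZ⟩)).2 hu.2
      have := Finset.card_le_card hsub
      have := hdom w hwT
      omega
  rw [induce_preconnected_iff] at hconn
  push Not at hconn
  obtain ⟨A, hA, ⟨x, hx⟩, ⟨y, hy⟩, hno⟩ := hconn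
  obtain ⟨s, hs, hsx⟩ := hnb x (hA hx)
  obtain ⟨t, ht, hty⟩ := hnb y (Finset.mem_sdiff.1 hy).1
  have hTZ : ∀ a, a ∈ T \ Z → a ∈ U \ Z := fun a ha => by
    rw [Finset.mem_sdiff] at ha ⊢; exact ⟨hTU ha.1, ha.2⟩
  have hsA : s ∈ A := by
    rcases hsx with rfl | hsx
    · exact hx
    · by_contra hsA
      exact hno x hx s (Finset.mem_sdiff.2 ⟨hTZ s hs, hsA⟩) hsx
  have htA : t ∉ A := by
    rcases hty with rfl | hty
    · exact (Finset.mem_sdiff.1 hy).2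
    · exact fun htA => hno t htA y hy hty.symm
  refine ⟨s, (Finset.mem_sdiff.1 hs).1, t, (Finset.mem_sdiff.1 ht).1, A,
    hA.trans Finset.sdiff_subset, hsA, ?_, ?_⟩
  · rw [mem_closedNbhd, not_or]
    refine ⟨htA, ?_⟩
    rintro ⟨u, hu, hut⟩
    exact hno u hu t (Finset.mem_sdiff.2 ⟨hTZ t ht, htA⟩) hut
  · refine lt_of_le_of_lt (Finset.card_le_card fun z hz => ?_) hZ
    rw [Finset.mem_inter, mem_boundary] at hz
    obtain ⟨⟨hzA, u, hu, huz⟩, hzU⟩ := hz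
    by_contra hzZ
    exact hno u hu z (Finset.mem_sdiff.2 ⟨Finset.mem_sdiff.2 ⟨hzU, hzZ⟩, hzA⟩) huz

/-- The trace on `T` of a small cut of `G[T ∪ S]` is an uncovered demand cut. -/
theorem IsSmallCut.isDemandCut {A : Finset V} (h : IsSmallCut G j (T ∪ S) s t A)
    (hT : IsKConnected G (j - 1) T) (hs : s ∈ T) (ht : t ∈ T) :
    IsDemandCut G j T (A ∩ T) ∧ IsUncovered G T S (A ∩ T) ∧
      (boundary G A ∩ (T ∪ S)).card + 1 = j := by
  have ht' := h.right_notMem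
  rw [mem_closedNbhd, not_or] at ht'
  have hsub : boundary G (A ∩ T) ∩ T ⊆ boundary G A ∩ (T ∪ S) := by
    intro v hv
    simp only [Finset.mem_inter, mem_boundary, Finset.mem_union] at hv ⊢
    obtain ⟨⟨h1, u, hu, huv⟩, hvT⟩ := hv
    exact ⟨⟨fun hvA => h1 ⟨hvA, hvT⟩, u, hu.1, huv⟩, .inl hvT⟩
  have htX : t ∈ T \ closedNbhd G (A ∩ T) := mem_sdiff_closedNbhd.2
    ⟨ht, fun h => ht'.1 (Finset.mem_inter.1 h).1, fun u hu hut =>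
      ht'.2 ⟨u, (Finset.mem_inter.1 hu).1, hut⟩⟩
  have hcut : IsCut G T (A ∩ T) :=
    ⟨Finset.inter_subset_right, ⟨s, Finset.mem_inter.2 ⟨h.left_mem, hs⟩⟩, ⟨t, htX⟩⟩
  have hge : j - 1 ≤ (boundary G (A ∩ T) ∩ T).card := by
    by_contra! hlt
    have htX' := mem_sdiff_closedNbhd.1 htX
    refine IsSmallCut.not_isKConnected (A := A ∩ T) (s := s) (t := t)
      ⟨Finset.inter_subset_right, Finset.mem_inter.2 ⟨h.left_mem, hs⟩, ?_, hlt⟩ ht hT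
    exact (Finset.mem_sdiff.1 htX).2
  have hle := Finset.card_le_card hsub
  have hlt := h.card_lt
  have heq : boundary G (A ∩ T) ∩ T = boundary G A ∩ (T ∪ S) :=
    Finset.eq_of_subset_of_card_le hsub (by omega)
  refine ⟨⟨hcut, by omega⟩, ?_, by omega⟩
  -- a covering path would leave `A` through the boundary, but not through a node of `T`
  rintro u v P hP ⟨hPT, hu, hv⟩
  have hvX := mem_sdiff_closedNbhd.1 hv
  obtain ⟨d, hd, h1, h2⟩ := P.exists_boundary_dart {x | x ∈ A} (Finset.mem_inter.1 hu).1
    (fun hvA => hvX.2.1 (Finset.mem_inter.2 ⟨hvA, hvX.1⟩))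
  have hdS := P.dart_snd_mem_support_of_mem_darts hd
  have hmem : d.snd ∈ boundary G (A ∩ T) ∩ T := by
    rw [heq, Finset.mem_inter, mem_boundary]
    exact ⟨⟨h2, d.fst, h1, d.adj⟩, hP _ hdS⟩
  rw [Finset.mem_inter, mem_boundary] at hmem
  rcases hPT.2.2.2 _ hdS hmem.2 with h3 | h3
  · exact hmem.1.1 (h3 ▸ hu)
  · obtain ⟨z, hz, hzv⟩ := hmem.1.2
    exact hvX.2.2 z hz (h3 ▸ hzv)

/-- An uncovered demand cut is the trace on `T` of a small cut: add the nodes of `S` that paths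
through `S` reach from it. -/
theorem IsDemandCut.exists_isSmallCut {Y : Finset V} (hY : IsDemandCut G j T Y)
    (hunc : IsUncovered G T S Y) (hs : s ∈ Y) (ht : t ∈ T \ closedNbhd G Y) :
    ∃ A, A ∩ T = Y ∧ IsSmallCut G j (T ∪ S) s t A := by
  classical
  obtain ⟨⟨hYT, -, -⟩, hcard⟩ := hY
  let A : Finset V := Y ∪ Finset.univ.filter fun w => w ∉ T ∧ w ∈ S ∧
    ∃ u ∈ Y, ∃ P : G.Walk u w, ∀ z ∈ P.support, z = u ∨ z ∉ T ∧ z ∈ S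
  have hmem : ∀ w, w ∈ A ↔ w ∈ Y ∨ w ∉ T ∧ w ∈ S ∧
      ∃ u ∈ Y, ∃ P : G.Walk u w, ∀ z ∈ P.support, z = u ∨ z ∉ T ∧ z ∈ S := by
    intro w; simp [A]
  have hAT : A ∩ T = Y := by
    ext w
    rw [Finset.mem_inter, hmem]
    constructor
    · rintro ⟨h | h, hw⟩
      · exact h
      · exact absurd hw h.1
    · exact fun h => ⟨.inl h, hYT h⟩
  have hbd : ∀ w ∈ T ∪ S, w ∉ A → (∃ a ∈ A, G.Adj a w) → w ∈ boundary G Y ∩ T := by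
    rintro w hwU hwA ⟨a, haA, haw⟩
    have hwY : w ∉ Y := fun h => hwA ((hmem w).2 (.inl h))
    -- a walk from `Y` through `S` that ends in a neighbour of `w`
    obtain ⟨u, hu, P, hP⟩ : ∃ u ∈ Y, ∃ P : G.Walk u a, ∀ z ∈ P.support, z = u ∨ z ∉ T ∧ z ∈ S := by
      rcases (hmem a).1 haA with ha | ⟨-, -, ha⟩
      · exact ⟨a, ha, .nil, by simp⟩
      · exact ha
    have hsup : ∀ z ∈ (P.concat haw).support, z = u ∨ z = w ∨ z ∉ T ∧ z ∈ S := by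
      intro z hz
      rw [SimpleGraph.Walk.support_concat, List.mem_append, List.mem_singleton] at hz
      rcases hz with hz | hz
      · rcases hP z hz with h | h
        · exact .inl h
        · exact .inr (.inr h)
      · exact .inr (.inl hz)
    have hwT : w ∈ T := by
      by_contra hwT
      have hwS : w ∈ S := (Finset.mem_union.1 hwU).resolve_left hwT
      refine hwA ((hmem w).2 (.inr ⟨hwT, hwS, u, hu, P.concat haw, fun z hz => ?_⟩))
      rcases hsup z hz with h | rfl | h
      · exact .inl h
      · exact .inr ⟨hwT, hwS⟩
      · exact .inr h
    refine Finset.mem_inter.2 ⟨?_, hwT⟩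
    by_contra hwb
    have hwX : w ∈ T \ closedNbhd G Y := by
      rw [Finset.mem_sdiff, closedNbhd, Finset.mem_union]
      exact ⟨hwT, fun h => h.elim hwY hwb⟩
    refine hunc u w (P.concat haw).bypass (fun z hz => ?_)
      ⟨⟨SimpleGraph.Walk.bypass_isPath _, hYT hu, hwT, fun z hz hzT => ?_⟩, hu, hwX⟩
    · rw [Finset.mem_union]
      rcases hsup z (SimpleGraph.Walk.support_bypass_subset_support _ hz) with rfl | rfl | h
      · exact .inl (hYT hu)
      · exact .inl hwT
      · exact .inr h.2
    · rcases hsup z (SimpleGraph.Walk.support_bypass_subset_support _ hz) with h | h | h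
      · exact .inl h
      · exact .inr h
      · exact absurd hzT h.1
  have ht' := mem_sdiff_closedNbhd.1 ht
  have htA : t ∉ A := fun h => ht'.2.1 (hAT ▸ Finset.mem_inter.2 ⟨h, ht'.1⟩)
  refine ⟨A, hAT, fun w hw => ?_, (hmem s).2 (.inl hs), ?_, ?_⟩
  · rw [Finset.mem_union]
    rcases (hmem w).1 hw with h | h
    · exact .inl (hYT h)
    · exact .inr h.2.1
  · rw [mem_closedNbhd, not_or]
    refine ⟨htA, fun hadj => ?_⟩
    have := hbd t (Finset.mem_union_left _ ht'.1) htA hadj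
    obtain ⟨z, hz, hzt⟩ := (mem_boundary.1 (Finset.mem_inter.1 this).1).2
    exact ht'.2.2 z hz hzt
  · have hsub : boundary G A ∩ (T ∪ S) ⊆ boundary G Y ∩ T := fun w hw => by
      rw [Finset.mem_inter, mem_boundary] at hw
      exact hbd w hw.2 hw.1.1 hw.1.2
    have := Finset.card_le_card hsub
    omega

end Augmentation

/-! ### Disjoint paths as matchings -/

section Linkage

variable {V : Type*} [Fintype V] [DecidableEq V] {G : SimpleGraph V} {U : Finset V} {s t : V}
  {p : V → V}

/-- A system of internally disjoint paths of `G[U]` from `s` to `t`, seen as a matching: `p x` is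
the node before `x` on its path, and `p x = x` if `x` is on no path. So each node other than `s`
is a value of `p` at most once, and those that are not values at all are the last inner nodes of
the paths. The node `t` itself is kept fixed. -/
structure IsLinkage (G : SimpleGraph V) (U : Finset V) (s t : V) (p : V → V) : Prop where
  map_left : p s = s
  map_right : p t = t
  step : ∀ x, p x = x ∨ p x ∈ U ∧ x ∈ U ∧ G.Adj (p x) x
  inj : ∀ x y, p x = p y → p x ≠ s → x = y
  last : ∀ y, y ≠ s → (∀ x, p x ≠ y) → y ∈ U ∧ G.Adj y t

/-- The number of paths of a linkage: the number of nodes that follow `s` on a path. -/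
def linkageValue (s : V) (p : V → V) : ℕ :=
  (Finset.univ.filter fun x => x ≠ s ∧ p x = s).card

theorem isLinkage_id : IsLinkage G U s t id :=
  ⟨rfl, rfl, fun _ => .inl rfl, fun _ _ h _ => h, fun y _ h => absurd rfl (h y)⟩

theorem linkageValue_id : linkageValue s (id : V → V) = 0 := by
  simp [linkageValue]

/-- The nodes that follow a node of `A` on a path, or are unused nodes of `A`, lie in `A` or in its
boundary; counting them bounds the number of paths. -/
theorem IsLinkage.card_le (h : IsLinkage G U s t p) {A : Finset V} (hs : s ∈ A)
    (ht : t ∉ closedNbhd G A) :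
    linkageValue s p ≤ (boundary G A ∩ U).card ∧
      ((boundary G A ∩ U).card ≤ linkageValue s p →
        ∀ x ∈ A ∪ (boundary G A ∩ U), p x ∈ A) := by
  have hdisj : Disjoint A (boundary G A ∩ U) := Finset.disjoint_left.2 fun x hx hx' =>
    (mem_boundary.1 (Finset.mem_inter.1 hx').1).1 hx
  -- `M₁` follows `s`, and `M₂` follows the other nodes of `A`, each of which is the predecessor of
  -- exactly one node because it is not adjacent to `t`
  let R := (A ∪ (boundary G A ∩ U)).erase s
  let M₁ : Finset V := Finset.univ.filter fun x => x ≠ s ∧ p x = s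
  let M₂ : Finset V := Finset.univ.filter fun x => p x ∈ A.erase s
  have hM : M₁ ∪ M₂ ⊆ R := by
    intro x hx
    have hx' : x ≠ s ∧ p x ∈ A := by
      simp only [M₁, M₂, Finset.mem_union, Finset.mem_filter, Finset.mem_univ, true_and,
        Finset.mem_erase] at hx
      rcases hx with ⟨h1, h2⟩ | ⟨h1, h2⟩
      · exact ⟨h1, h2 ▸ hs⟩
      · exact ⟨fun hxs => h1 (by rw [hxs, h.map_left]), h2⟩
    refine Finset.mem_erase.2 ⟨hx'.1, ?_⟩
    rw [Finset.mem_union, Finset.mem_inter, mem_boundary]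
    rcases h.step x with h1 | ⟨-, h2, h3⟩
    · exact .inl (h1 ▸ hx'.2)
    · by_cases hxA : x ∈ A
      · exact .inl hxA
      · exact .inr ⟨⟨hxA, _, hx'.2, h3⟩, h2⟩
  have hM₂ : (A.erase s).card ≤ M₂.card := by
    refine Finset.card_le_card_of_surjOn p fun y hy => ?_
    rw [Finset.mem_coe] at hy
    by_contra hno
    have hy' := Finset.mem_erase.1 hy
    refine ht (mem_closedNbhd.2 (.inr ⟨y, hy'.2, (h.last y hy'.1 fun x hx => hno ?_).2⟩))
    exact ⟨x, by simpa [M₂, hx] using hy', hx⟩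
  have hM12 : (M₁ ∪ M₂).card = M₁.card + M₂.card := by
    refine Finset.card_union_of_disjoint (Finset.disjoint_left.2 fun x h1 h2 => ?_)
    simp only [M₁, M₂, Finset.mem_filter, Finset.mem_erase] at h1 h2
    exact h2.2.1 h1.2.2
  have hR : R.card + 1 = A.card + (boundary G A ∩ U).card := by
    rw [Finset.card_erase_add_one (Finset.mem_union_left _ hs), Finset.card_union_of_disjoint hdisj]
  have hAs := Finset.card_erase_add_one hs
  have hle := Finset.card_le_card hM
  have hv : linkageValue s p = M₁.card := rfl
  refine ⟨by omega, fun hge x hx => ?_⟩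
  have heq := Finset.eq_of_subset_of_card_le hM (by omega)
  by_cases hxs : x = s
  · rw [hxs, h.map_left]; exact hs
  · have hxM : x ∈ M₁ ∪ M₂ := heq ▸ Finset.mem_erase.2 ⟨hxs, hx⟩
    simp only [M₁, M₂, Finset.mem_union, Finset.mem_filter, Finset.mem_univ, true_and,
      Finset.mem_erase] at hxM
    rcases hxM with h1 | h1
    · exact h1.2 ▸ hs
    · exact h1.2

variable {par : V → V → Prop} {ρ : V → ℕ}

/-- `x` has been reached by the search. -/
def Reached (par : V → V → Prop) (x : V) : Prop := ∃ y, par x y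

/-- The nodes from which the search goes on: `s`, and the predecessors of reached nodes. -/
def Scanned (s t : V) (p : V → V) (par : V → V → Prop) (y : V) : Prop :=
  y = s ∨ y ≠ t ∧ ∃ x, Reached par x ∧ p x = y

/-- A search for an augmenting path: `par x y` tells that `x` has been reached from the scanned
node `y`, at time `ρ x`. -/
structure IsSearch (G : SimpleGraph V) (U : Finset V) (s t : V) (p : V → V) (par : V → V → Prop)
    (ρ : V → ℕ) : Prop where
  unique : ∀ x y y', par x y → par x y' → y = y'
  ne : ∀ x y, par x y → x ≠ s
  adj : ∀ x y, par x y → x ∈ U ∧ (x = y ∨ G.Adj y x)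
  source : ∀ x y, par x y → y = s ∨ y ≠ t ∧ ∃ x', Reached par x' ∧ p x' = y ∧ ρ x' < ρ x

/-- The search cannot reach further nodes. -/
def IsExhausted (G : SimpleGraph V) (U : Finset V) (s t : V) (p : V → V)
    (par : V → V → Prop) : Prop :=
  ∀ y, Scanned s t p par y → ∀ x ∈ U, x ≠ s → (x = y ∨ G.Adj y x) → Reached par x

open Classical in
/-- If an exhausted search does not reach `t`, the scanned nodes form a cut with as many boundary
nodes as there are paths, and the least such cut. -/
theorem IsLinkage.scanned_cut (h : IsLinkage G U s t p) (hse : IsSearch G U s t p par ρ)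
    (hex : IsExhausted G U s t p par) (hfail : ¬ Reached par t) (hs : s ∈ U) (ht : t ∈ U)
    (hst : s ≠ t) {j : ℕ} (hj : linkageValue s p < j) :
    IsSmallCut G j U s t (Finset.univ.filter (Scanned s t p par)) ∧
      (boundary G (Finset.univ.filter (Scanned s t p par)) ∩ U).card = linkageValue s p ∧
      ∀ A, s ∈ A → t ∉ closedNbhd G A → (boundary G A ∩ U).card ≤ linkageValue s p →
        Finset.univ.filter (Scanned s t p par) ⊆ A := by
  set Q := Finset.univ.filter (Scanned s t p par) with hQ
  have hmem : ∀ y, y ∈ Q ↔ Scanned s t p par y := fun y => by simp [hQ]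
  have hsQ : s ∈ Q := (hmem s).2 (.inl rfl)
  have hQU : Q ⊆ U := by
    intro y hy
    rcases (hmem y).1 hy with rfl | ⟨-, x, ⟨z, hz⟩, rfl⟩
    · exact hs
    · rcases h.step x with h1 | h1
      · rw [h1]; exact (hse.adj x z hz).1
      · exact h1.1
  have htQ : t ∉ closedNbhd G Q := by
    rw [mem_closedNbhd, not_or]
    constructor
    · intro htQ
      rcases (hmem t).1 htQ with h1 | h1
      · exact hst h1.symm
      · exact h1.1 rfl
    · rintro ⟨u, hu, hut⟩
      exact hfail (hex u ((hmem u).1 hu) t ht hst.symm (.inr hut))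
  -- All scanned nodes but `s` and all their neighbours are reached, and by injectivity at most
  -- `linkageValue s p + |Q \ {s}|` nodes are reached, as their predecessors are scanned.
  let R : Finset V := Finset.univ.filter (Reached par)
  have hsub : Q.erase s ∪ (boundary G Q ∩ U) ⊆ R := by
    intro x hx
    simp only [R, Finset.mem_union, Finset.mem_erase, Finset.mem_inter, mem_boundary,
      Finset.mem_filter, Finset.mem_univ, true_and] at hx ⊢
    rcases hx with ⟨h1, h2⟩ | ⟨⟨h1, u, hu, hux⟩, h2⟩
    · exact hex x ((hmem x).1 h2) x (hQU h2) h1 (.inl rfl)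
    · exact hex u ((hmem u).1 hu) x h2 (fun hxs => h1 (hxs ▸ hsQ)) (.inr hux)
  have hcard1 : (Q.erase s ∪ (boundary G Q ∩ U)).card = (Q.erase s).card + (boundary G Q ∩ U).card := by
    refine Finset.card_union_of_disjoint (Finset.disjoint_left.2 fun x hx hx' => ?_)
    exact (mem_boundary.1 (Finset.mem_inter.1 hx').1).1 (Finset.mem_erase.1 hx).2
  have hR : R.card ≤ linkageValue s p + (Q.erase s).card := by
    rw [← Finset.card_filter_add_card_filter_not (s := R) (fun x => p x = s)]
    refine Nat.add_le_add (Finset.card_le_card fun x hx => ?_)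
      (Finset.card_le_card_of_injOn p (fun x hx => ?_) fun x hx y _ hxy => ?_)
    · simp only [R, Finset.mem_filter, Finset.mem_univ, true_and] at hx ⊢
      obtain ⟨⟨z, hz⟩, hx⟩ := hx
      exact ⟨hse.ne x z hz, hx⟩
    · simp only [R, Finset.coe_filter, Finset.mem_filter, Finset.mem_univ, true_and,
        Set.mem_ofPred_eq] at hx
      refine Finset.mem_coe.2 (Finset.mem_erase.2 ⟨hx.2, (hmem _).2 (.inr ⟨fun hxt => ?_, x, hx.1, rfl⟩)⟩)
      have : x = t := h.inj x t (hxt.trans h.map_right.symm) hx.2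
      exact hfail (this ▸ hx.1)
    · simp only [R, Finset.coe_filter, Finset.mem_filter, Finset.mem_univ, true_and,
        Set.mem_ofPred_eq] at hx
      exact h.inj x y hxy hx.2
  have hle := Finset.card_le_card hsub
  have hge := (h.card_le hsQ htQ).1
  refine ⟨⟨hQU, hsQ, htQ, by omega⟩, by omega, fun A hsA htA hAc => ?_⟩
  have hclosed := (h.card_le hsA htA).2 hAc
  -- a cut of minimum size is closed under the rules of the search
  have hreach : ∀ N x, ρ x < N → Reached par x → x ∈ A ∪ (boundary G A ∩ U) := by
    intro N
    induction N with
    | zero => intro x hx; omega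
    | succ N ih =>
      rintro x hx ⟨y, hy⟩
      have hyA : y ∈ A := by
        rcases hse.source x y hy with rfl | ⟨-, x', hx', rfl, hlt⟩
        · exact hsA
        · exact hclosed x' (ih x' (by omega) hx')
      obtain ⟨hxU, hxy⟩ := hse.adj x y hy
      rw [Finset.mem_union, Finset.mem_inter, mem_boundary]
      by_cases hxA : x ∈ A
      · exact .inl hxA
      · exact .inr ⟨⟨hxA, y, hyA, hxy.resolve_left fun h => hxA (h ▸ hyA)⟩, hxU⟩
  intro y hy
  rcases (hmem y).1 hy with rfl | ⟨-, x, hx, rfl⟩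
  · exact hsA
  · exact hclosed x (hreach _ x (Nat.lt_succ_self _) hx)

/-- An intermediate state of the augmentation of the linkage `p₀` along the parents of a search:
`p` is a linkage except that `c` has lost its predecessor to the node treated before. The parents
were reached earlier and earlier, so `p` still agrees with `p₀` where the walk is yet to come. -/
structure IsRotation (G : SimpleGraph V) (U : Finset V) (s t : V) (p₀ : V → V)
    (par : V → V → Prop) (ρ : V → ℕ) (p : V → V) (c : V) : Prop where
  reached : Reached par c
  map_left : p s = s
  map_right : p t = t
  map_right' : ∀ x, p x = t → x = t
  step : ∀ x, p x = x ∨ p x ∈ U ∧ x ∈ U ∧ G.Adj (p x) x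
  inj : ∀ x y, x ≠ c → y ≠ c → p x = p y → p x ≠ s → x = y
  last : ∀ y, y ≠ s → y ≠ t → (∀ x, x ≠ c → p x ≠ y) → y ∈ U ∧ G.Adj y t
  agree : ∀ x, ρ x < ρ c → p x = p₀ x
  value : (Finset.univ.filter fun x => x ≠ s ∧ x ≠ c ∧ p x = s).card = linkageValue s p₀

theorem IsLinkage.isRotation (h : IsLinkage G U s t p) (hst : s ≠ t) (ht : Reached par t) :
    IsRotation G U s t p par ρ p t where
  reached := ht
  map_left := h.map_left
  map_right := h.map_right
  map_right' := fun x hx => h.inj x t (hx.trans h.map_right.symm) (hx ▸ hst.symm)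
  step := h.step
  inj := fun x y _ _ => h.inj x y
  last := fun y hys hyt hno => h.last y hys fun x => by
    by_cases hx : x = t
    · rw [hx, h.map_right]; exact hyt.symm
    · exact hno x hx
  agree := fun _ _ => rfl
  value := by
    rw [linkageValue]
    congr 1
    ext x
    simp only [Finset.mem_filter, Finset.mem_univ, true_and]
    refine ⟨fun hx => ⟨hx.1, hx.2.2⟩, fun hx => ⟨hx.1, fun hxt => ?_, hx.2⟩⟩
    rw [hxt, h.map_right] at hx
    exact hst hx.2.symm

/-- When the walk along the parents arrives at `s`, there is one more path. -/
theorem IsRotation.finish {p₀ : V → V} {c : V} (h : IsRotation G U s t p₀ par ρ p c)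
    (hse : IsSearch G U s t p₀ par ρ) (hs : s ∈ U) (hadj : ¬ G.Adj s t)
    (hc : par c s) : c ≠ t ∧ IsLinkage G U s t (Function.update p c s) ∧
      linkageValue s (Function.update p c s) = linkageValue s p₀ + 1 := by
  have hcs := hse.ne c s hc
  obtain ⟨hcU, hcadj⟩ := hse.adj c s hc
  have hcadj : G.Adj s c := hcadj.resolve_left hcs
  have hct : c ≠ t := fun h => hadj (h ▸ hcadj)
  refine ⟨hct, ⟨?_, ?_, fun x => ?_, fun x y hxy hxs => ?_, fun y hys hno => ?_⟩, ?_⟩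
  · rw [Function.update_of_ne hcs.symm]; exact h.map_left
  · rw [Function.update_of_ne hct.symm]; exact h.map_right
  · by_cases hx : x = c
    · subst hx; rw [Function.update_self]; exact .inr ⟨hs, hcU, hcadj⟩
    · rw [Function.update_of_ne hx]; exact h.step x
  · have hx : x ≠ c := by rintro rfl; rw [Function.update_self] at hxs; exact hxs rfl
    have hy : y ≠ c := by
      rintro rfl; rw [hxy, Function.update_self] at hxs; exact hxs rfl
    rw [Function.update_of_ne hx] at hxy hxs
    rw [Function.update_of_ne hy] at hxy
    exact h.inj x y hx hy hxy hxs
  · refine h.last y hys (fun hyt => hno t ?_) fun x hx => ?_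
    · rw [Function.update_of_ne hct.symm, h.map_right, hyt]
    · have := hno x
      rwa [Function.update_of_ne hx] at this
  · rw [← h.value, linkageValue, ← Finset.card_insert_of_notMem (a := c) (by simp)]
    congr 1
    ext x
    simp only [Finset.mem_insert, Finset.mem_filter, Finset.mem_univ, true_and]
    by_cases hx : x = c
    · subst hx; simp [hcs]
    · simp [hx]

open Classical in
/-- One step of the walk along the parents: `c` takes over its parent `y` as predecessor, and the
node that `y` preceded so far is the next one. -/
theorem IsRotation.next {p₀ : V → V} {c y : V} (h : IsRotation G U s t p₀ par ρ p c)
    (hse : IsSearch G U s t p₀ par ρ) (hc : par c y) (hys : y ≠ s) :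
    ∃ c', c' ≠ c ∧ p c' = y ∧ (∀ x, x ≠ c → p x = y → x = c') ∧ ρ c' < ρ c ∧
      IsRotation G U s t p₀ par ρ (if c = t then p else Function.update p c y) c' := by
  have hcs := hse.ne c y hc
  obtain ⟨hcU, hcadj⟩ := hse.adj c y hc
  obtain ⟨hyt, c', hc', hpc', hρ⟩ := (hse.source c y hc).resolve_left hys
  have hne : c' ≠ c := by rintro rfl; exact lt_irrefl _ hρ
  rw [← h.agree c' hρ] at hpc'
  have hc't : c' ≠ t := by rintro rfl; rw [h.map_right] at hpc'; exact hyt hpc'.symm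
  have huniq : ∀ x, x ≠ c → p x = y → x = c' := fun x hx hxy =>
    h.inj x c' hx hne (hxy.trans hpc'.symm) (hxy ▸ hys)
  refine ⟨c', hne, hpc', huniq, hρ, ?_⟩
  set p' := if c = t then p else Function.update p c y with hp'
  have hp'ne : ∀ x, x ≠ c → p' x = p x := fun x hx => by
    rw [hp']; split_ifs
    · rfl
    · exact Function.update_of_ne hx _ _
  have hp't : c = t → p' c = t := fun hct => by rw [hp', if_pos hct, hct, h.map_right]
  have hp'c : c ≠ t → p' c = y := fun hct => by rw [hp', if_neg hct, Function.update_self]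
  have hp'cs : p' c ≠ s := by
    by_cases hct : c = t
    · rw [hp't hct, ← hct]; exact hcs
    · rw [hp'c hct]; exact hys
  have htt : p' t = t := by
    by_cases hct : c = t
    · rw [← hct]; rw [hp't hct, hct]
    · rw [hp'ne t (Ne.symm hct), h.map_right]
  have htt' : ∀ x, p' x = t → x = t := fun x hx => by
    by_cases hxc : x = c
    · subst hxc
      by_contra hct
      rw [hp'c hct] at hx
      exact hyt hx
    · rw [hp'ne x hxc] at hx
      exact h.map_right' x hx
  have hcx : ∀ x, x ≠ c → x ≠ c' → p' c ≠ p' x := by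
    intro x hxc hxc' heq
    by_cases hct : c = t
    · rw [hp't hct] at heq
      exact hxc ((htt' x heq.symm).trans hct.symm)
    · rw [hp'c hct, hp'ne x hxc] at heq
      exact hxc' (huniq x hxc heq.symm)
  refine ⟨hc', ?_, htt, htt', fun x => ?_, fun x z hx hz hxz hxs => ?_, fun z hzs hzt hno => ?_,
    fun x hx => ?_, ?_⟩
  · rw [hp'ne s hcs.symm]; exact h.map_left
  · by_cases hxc : x = c
    · subst hxc
      by_cases hct : x = t
      · exact .inl ((hp't hct).trans hct.symm)
      · rw [hp'c hct]
        rcases hcadj with h1 | h1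
        · exact .inl h1.symm
        · refine .inr ⟨?_, hcU, h1⟩
          obtain ⟨z, hz⟩ := hc'
          rcases h.step c' with h2 | h2
          · rw [hpc'] at h2; rw [h2]; exact (hse.adj c' z hz).1
          · rw [hpc'] at h2; exact h2.1
    · rw [hp'ne x hxc]; exact h.step x
  · by_cases hxc : x = c
    · by_cases hzc : z = c
      · rw [hxc, hzc]
      · rw [hxc] at hxz
        exact absurd hxz (hcx z hzc hz)
    · by_cases hzc : z = c
      · rw [hzc] at hxz
        exact absurd hxz.symm (hcx x hxc hx)
      · rw [hp'ne x hxc] at hxz hxs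
        rw [hp'ne z hzc] at hxz
        exact h.inj x z hxc hzc hxz hxs
  · by_cases hzy : c = t ∧ z = y
    · -- the parent of `t` becomes the last inner node of the new path
      obtain ⟨rfl, rfl⟩ := hzy
      have hadj := hcadj.resolve_left hyt.symm
      refine ⟨?_, hadj⟩
      obtain ⟨w, hw⟩ := hc'
      rcases h.step c' with h2 | h2
      · rw [hpc'] at h2; rw [h2]; exact (hse.adj c' w hw).1
      · rw [hpc'] at h2; exact h2.1
    · refine h.last z hzs hzt fun x hxc => ?_
      by_cases hxc' : x = c'
      · rw [hxc', hpc']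
        rintro rfl
        by_cases hct : c = t
        · exact hzy ⟨hct, rfl⟩
        · exact hno c hne.symm (hp'c hct)
      · rw [← hp'ne x hxc]; exact hno x hxc'
  · rw [hp'ne x (by rintro rfl; omega)]
    exact h.agree x (hx.trans hρ)
  · rw [← h.value]
    congr 1
    ext x
    simp only [Finset.mem_filter, Finset.mem_univ, true_and]
    by_cases hxc : x = c
    · subst hxc; simp [hp'cs]
    · rw [hp'ne x hxc]
      by_cases hxc' : x = c'
      · subst hxc'; simp [hpc', hys]
      · simp [hxc, hxc']

end Linkage

/-! ### Rounds of the search, and the choice of a cut -/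

section SearchStep

variable {n : ℕ} {G : SimpleGraph (Fin n)} {U : Finset (Fin n)} {s t : Fin n}
  {p : Fin n → Fin n} {par : Fin n → Fin n → Prop}

/-- One round of the search: every node that can be reached now gets the first possible parent. -/
def searchStep (G : SimpleGraph (Fin n)) (U : Finset (Fin n)) (s t : Fin n) (p : Fin n → Fin n)
    (par : Fin n → Fin n → Prop) (x y : Fin n) : Prop :=
  par x y ∨ ¬ Reached par x ∧ x ∈ U ∧ x ≠ s ∧ (Scanned s t p par y ∧ (x = y ∨ G.Adj y x)) ∧
    ¬ ∃ y' < y, Scanned s t p par y' ∧ (x = y' ∨ G.Adj y' x)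

open Classical in
/-- After `q` rounds the search is exhausted or has reached at least `q` nodes. -/
def SearchInvariant (G : SimpleGraph (Fin n)) (U : Finset (Fin n)) (s t : Fin n)
    (p : Fin n → Fin n) (q : ℕ) (par : Fin n → Fin n → Prop) : Prop :=
  ∃ ρ, IsSearch G U s t p par ρ ∧ (∀ x, Reached par x → ρ x < q) ∧
    (IsExhausted G U s t p par ∨ q ≤ (Finset.univ.filter (Reached par)).card)

theorem searchInvariant_zero : SearchInvariant G U s t p 0 fun _ _ => False :=
  ⟨fun _ => 0, ⟨fun _ _ _ h => h.elim, fun _ _ h => h.elim, fun _ _ h => h.elim,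
    fun _ _ h => h.elim⟩, fun _ h => h.elim fun _ h => h.elim, .inr (Nat.zero_le _)⟩

theorem SearchInvariant.step {q : ℕ} (h : SearchInvariant G U s t p q par) :
    SearchInvariant G U s t p (q + 1) (searchStep G U s t p par) := by
  classical
  obtain ⟨ρ, hse, hρ, hex⟩ := h
  have hmono : ∀ x y, par x y → searchStep G U s t p par x y := fun x y h => .inl h
  refine ⟨fun x => if Reached par x then ρ x else q, ⟨?_, ?_, ?_, ?_⟩, ?_, ?_⟩
  · rintro x y y' (h1 | ⟨h1, -, -, h2, h3⟩) (h4 | ⟨h4, -, -, h5, h6⟩)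
    · exact hse.unique x y y' h1 h4
    · exact absurd ⟨y, h1⟩ h4
    · exact absurd ⟨y', h4⟩ h1
    · rcases lt_trichotomy y y' with h | h | h
      · exact absurd ⟨y, h, h2⟩ h6
      · exact h
      · exact absurd ⟨y', h, h5⟩ h3
  · rintro x y (h1 | ⟨-, -, h1, -⟩)
    · exact hse.ne x y h1
    · exact h1
  · rintro x y (h1 | ⟨-, hU, -, h1, -⟩)
    · exact hse.adj x y h1
    · exact ⟨hU, h1.2⟩
  · rintro x y (h1 | ⟨hx, -, -, ⟨h1, -⟩, -⟩)
    · refine (hse.source x y h1).imp_right ?_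
      rintro ⟨hyt, x', ⟨z, hz⟩, h2, h3⟩
      refine ⟨hyt, x', ⟨z, .inl hz⟩, h2, ?_⟩
      rw [if_pos ⟨z, hz⟩, if_pos ⟨y, h1⟩]
      exact h3
    · refine h1.imp_right ?_
      rintro ⟨hyt, x', ⟨z, hz⟩, h2⟩
      refine ⟨hyt, x', ⟨z, .inl hz⟩, h2, ?_⟩
      rw [if_pos ⟨z, hz⟩, if_neg hx]
      exact hρ x' ⟨z, hz⟩
  · intro x _
    dsimp only
    split_ifs with hx
    · exact (hρ x hx).trans (Nat.lt_succ_self q)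
    · exact Nat.lt_succ_self q
  · by_cases hdone : IsExhausted G U s t p par
    · -- an exhausted search does not change any more
      left
      have heq : searchStep G U s t p par = par := by
        funext x y
        refine propext ⟨?_, .inl⟩
        rintro (h1 | ⟨h1, hU, hxs, h2, -⟩)
        · exact h1
        · exact absurd (hdone y h2.1 x hU hxs h2.2) h1
      rwa [heq]
    · right
      have hq := hex.resolve_left hdone
      simp only [IsExhausted, not_forall] at hdone
      obtain ⟨y, hy, x, hxU, hxs, hxy, hx⟩ := hdone
      -- `x` is reached in this round, from its first possible parent
      have hx' : Reached (searchStep G U s t p par) x := by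
        let Y := Finset.univ.filter fun y => Scanned s t p par y ∧ (x = y ∨ G.Adj y x)
        have hY : Y.Nonempty := ⟨y, by simp [Y, hy, hxy]⟩
        have h1 := Finset.min'_mem Y hY
        refine ⟨Y.min' hY, .inr ⟨hx, hxU, hxs, (Finset.mem_filter.1 h1).2, ?_⟩⟩
        rintro ⟨y', hlt, hy'⟩
        exact absurd (Finset.min'_le Y y' (by simpa [Y] using hy')) (not_le.2 hlt)
      refine hq.trans_lt (Finset.card_lt_card ⟨fun z hz => ?_, fun hsub => ?_⟩)
      · simp only [Finset.mem_filter, Finset.mem_univ, true_and] at hz ⊢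
        exact hz.imp fun w hw => .inl hw
      · have := hsub (show x ∈ _ by simpa using hx')
        simp only [Finset.mem_filter, Finset.mem_univ, true_and] at this
        exact hx this

theorem SearchInvariant.exhausted (h : SearchInvariant G U s t p n par) :
    ∃ ρ, IsSearch G U s t p par ρ ∧ (∀ x, Reached par x → ρ x < n) ∧
      IsExhausted G U s t p par := by
  classical
  obtain ⟨ρ, hse, hρ, hex⟩ := h
  refine ⟨ρ, hse, hρ, hex.resolve_right fun hn => ?_⟩
  have hs : s ∉ Finset.univ.filter (Reached par) := by
    simp only [Finset.mem_filter, Finset.mem_univ, true_and]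
    exact fun ⟨y, hy⟩ => hse.ne s y hy rfl
  have := Finset.card_lt_univ_of_notMem hs
  rw [Fintype.card_fin] at this
  omega

end SearchStep

section CutSearch

variable {V : Type*} [Fintype V] [DecidableEq V] {G : SimpleGraph V} {j : ℕ} {T S : Finset V}
  {s t : V} {p : V → V}

/-- An uncovered demand cut. -/
def IsOpenCut (G : SimpleGraph V) (j : ℕ) (T S X : Finset V) : Prop :=
  IsDemandCut G j T X ∧ IsUncovered G T S X

/-- With `j` disjoint paths from `s` to `t`, no demand cut that separates them is uncovered. -/
theorem IsLinkage.not_isOpenCut (h : IsLinkage G (T ∪ S) s t p) (hj : j ≤ linkageValue s p)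
    {Y : Finset V} (hY : IsOpenCut G j T S Y) (hs : s ∈ Y) : t ∉ T \ closedNbhd G Y := by
  intro ht
  obtain ⟨A, -, hA⟩ := hY.1.exists_isSmallCut hY.2 hs ht
  have h1 := (h.card_le hA.left_mem hA.right_notMem).1
  have h2 := hA.card_lt
  omega

open Classical in
/-- If the search fails with fewer than `j` disjoint paths, the scanned nodes of `T` form the least
uncovered demand cut that separates `s` from `t`. -/
theorem IsLinkage.isOpenCut {par : V → V → Prop} {ρ : V → ℕ} (h : IsLinkage G (T ∪ S) s t p)
    (hse : IsSearch G (T ∪ S) s t p par ρ) (hex : IsExhausted G (T ∪ S) s t p par)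
    (hfail : ¬ Reached par t) (hs : s ∈ T) (ht : t ∈ T) (hst : s ≠ t)
    (hT : IsKConnected G (j - 1) T) (hj : linkageValue s p < j) :
    IsOpenCut G j T S (Finset.univ.filter (Scanned s t p par) ∩ T) ∧
      ∀ Y, IsOpenCut G j T S Y → s ∈ Y → t ∈ T \ closedNbhd G Y →
        Finset.univ.filter (Scanned s t p par) ∩ T ⊆ Y := by
  obtain ⟨h1, h2, h3⟩ := h.scanned_cut hse hex hfail (Finset.mem_union_left _ hs)
    (Finset.mem_union_left _ ht) hst hj
  obtain ⟨h4, h5, h6⟩ := h1.isDemandCut hT hs ht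
  refine ⟨⟨h4, h5⟩, fun Y hY hsY htY => ?_⟩
  obtain ⟨A, rfl, hA⟩ := hY.1.exists_isSmallCut hY.2 hsY htY
  have := hA.card_lt
  exact Finset.inter_subset_inter_right (h3 A hA.left_mem hA.right_notMem (by omega))

theorem IsOpenCut.not_isKConnected {X : Finset V} (hX : IsOpenCut G j T S X) :
    ¬ IsKConnected G j (T ∪ S) := by
  obtain ⟨s, hs⟩ := hX.1.1.2.1
  obtain ⟨t, ht⟩ := hX.1.1.2.2
  obtain ⟨A, -, hA⟩ := hX.1.exists_isSmallCut hX.2 hs ht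
  exact hA.not_isKConnected (Finset.mem_union_left _ (Finset.mem_sdiff.1 ht).1)

theorem exists_isOpenCut (hT : IsKConnected G (j - 1) T) (hdom : IsDominating G j T)
    (hU : ¬ IsKConnected G j (T ∪ S)) : ∃ X, IsOpenCut G j T S X := by
  obtain ⟨s, hs, t, ht, A, hA⟩ := exists_isSmallCut hdom Finset.subset_union_left hU
  obtain ⟨h1, h2, -⟩ := hA.isDemandCut hT hs ht
  exact ⟨_, h1, h2⟩

theorem AugmentationStep.ssubset {S' : Finset V} (h : AugmentationStep G j T S S') : S ⊂ S' := by
  obtain ⟨-, X, hX, u, v, P, hP, -, rfl⟩ := h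
  refine ⟨Finset.subset_union_left, fun hsub => hX.prop.2 u v P (fun w hw => ?_) hP⟩
  by_cases hwT : w ∈ T
  · exact Finset.mem_union_left _ hwT
  · exact Finset.mem_union_right _ (hsub (Finset.mem_union_right _
      (Finset.mem_sdiff.2 ⟨List.mem_toFinset.2 hw, hwT⟩)))

end CutSearch

/-! ### The algorithm in the loop language -/

/-!
The relations of the state that the algorithm uses. Sets of nodes are kept on the diagonals of
`indR`, `connR` (the first independent set and its connectors), `takenR`, `layerR` (the independent
sets so far and the next one), `baseR`, `usedR`, `bestR` (the sets `T`, `T ∪ S` and the best cut),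
`curR`, `nextR` (the node treated by the walk along the parents, and its successor) and of the flags
`stuckR`, `doneR`. The relation `predR` is the graph of a linkage, and `parR` that of the parents in a
search.

Inside an augmentation the variable `0` stands for the connectivity reached so far, `1` counts the
rounds, and `2`, `3` are the pair of nodes at hand.
-/

notation "graphR" => (0 : ℕ)
notation "indR" => (1 : ℕ)
notation "connR" => (2 : ℕ)
notation "takenR" => (3 : ℕ)
notation "layerR" => (4 : ℕ)
notation "baseR" => (5 : ℕ)
notation "usedR" => (6 : ℕ)
notation "predR" => (7 : ℕ)
notation "parR" => (8 : ℕ)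
notation "curR" => (9 : ℕ)
notation "nextR" => (10 : ℕ)
notation "stuckR" => (11 : ℕ)
notation "bestR" => (12 : ℕ)
notation "doneR" => (13 : ℕ)

/-- Membership of a node in the set that the relation `a` encodes on its diagonal. -/
def Formula.mem (a x : ℕ) : Formula := .rel a x x

/-- A false formula with the variable `x`. -/
def Formula.bot (x : ℕ) : Formula := .neg (.eq x x)

/-- `y` is scanned by the search for paths from `s` to `t`. -/
def scannedF (s t y : ℕ) : Formula :=
  .or (.eq y s) (.and (.neg (.eq y t))
    (.ex fun x => .and (.ex fun z => .rel parR x z) (.rel predR x y)))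

/-- `x` equals or is adjacent to the scanned node `y`. -/
def reachesF (s t x y : ℕ) : Formula :=
  .and (scannedF s t y) (.or (.eq x y) (.rel graphR y x))

/-- The search for an augmenting path: `n` rounds of `searchStep`. -/
def searchC (s t : ℕ) : Command :=
  .seq (.upd parR fun x _ => .bot x) (.loop fun _ => .upd parR fun x y =>
    .or (.rel parR x y) (.and (.neg (.ex fun z => .rel parR x z)) (.and (.mem usedR x)
      (.and (.neg (.eq x s)) (.and (reachesF s t x y)
        (.neg (.ex fun y' => .and (.lt y' y) (reachesF s t x y'))))))))

/-- One step of the walk along the parents. -/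
def rotateStepC (s t : ℕ) : Command :=
  .seq (.upd nextR fun x _ => .ex fun c => .ex fun y => .and (.mem curR c) (.and (.rel parR c y)
      (.and (.neg (.eq y s)) (.and (.rel predR x y) (.neg (.mem curR x))))))
    (.seq (.upd predR fun x y =>
        .or (.and (.and (.mem curR x) (.neg (.eq x t))) (.rel parR x y))
          (.and (.neg (.and (.mem curR x) (.neg (.eq x t)))) (.rel predR x y)))
      (.upd curR fun x _ => .mem nextR x))

/-- The walk along the parents from `t` to `s`. -/
def rotateC (s t : ℕ) : Command :=
  .seq (.upd curR fun x _ => .eq x t) (.loop fun _ => rotateStepC s t)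

/-- Try to add a path from `s` to `t`; on failure, mark the linkage as stuck. -/
def augmentPathC (s t : ℕ) : Command :=
  .seq (searchC s t) (.ite (.ex fun y => .rel parR t y) (rotateC s t)
    (.upd stuckR fun x _ => .eq x x))

/-- Try to find `i + 1` disjoint paths from `s` to `t`. -/
def linkageC (i s t : ℕ) : Command :=
  .seq (.upd stuckR fun x _ => .bot x) (.seq (.upd predR fun x y => .eq x y)
    (.loop fun r => .ite (.and (.neg (.lt i r)) (.neg (.mem stuckR s))) (augmentPathC s t) .nop))

/-- Keep the cut that separates `s` from `t`, if there is one, when it is contained in the best cut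
found so far, or no cut has been found so far. -/
def tryPairC (i s t : ℕ) : Command :=
  .ite (.and (.mem baseR s) (.and (.mem baseR t) (.and (.neg (.eq s t)) (.neg (.rel graphR s t)))))
    (.seq (linkageC i s t)
      (.ite (.and (.mem stuckR s) (.or (.neg (.ex fun y => .mem bestR y))
          (.neg (.ex fun y => .and (.and (scannedF s t y) (.mem baseR y)) (.neg (.mem bestR y))))))
        (.upd bestR fun x _ => .and (scannedF s t x) (.mem baseR x)) .nop)) .nop

/-- Find a minimal uncovered demand cut. -/
def bestCutC (i : ℕ) : Command :=
  .seq (.upd bestR fun x _ => .bot x) (.loop fun s => .loop fun t => tryPairC i s t)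

/-- `w` is adjacent to the best cut. -/
def nearF (w : ℕ) : Formula := .ex fun u => .and (.mem bestR u) (.rel graphR u w)

/-- `w` is adjacent to the far side of the best cut. -/
def farF (w : ℕ) : Formula :=
  .ex fun v => .and (.and (.mem baseR v) (.and (.neg (.mem bestR v))
    (.neg (.ex fun u => .and (.mem bestR u) (.rel graphR u v))))) (.rel graphR w v)

/-- Add the inner node or the two inner nodes of a shortest path that covers the best cut. -/
def addPathC : Command :=
  .seq (.upd doneR fun x _ => .bot x) (.seq
    (.loop fun w => .ite (.and (.neg (.mem doneR w))
        (.and (.neg (.mem baseR w)) (.and (nearF w) (farF w))))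
      (.seq (.upd usedR fun x _ => .or (.mem usedR x) (.eq x w)) (.upd doneR fun x _ => .eq x x))
      .nop)
    (.loop fun w => .loop fun w' => .ite (.and (.neg (.mem doneR w))
        (.and (.neg (.mem baseR w)) (.and (.neg (.mem baseR w')) (.and (.rel graphR w w')
          (.and (nearF w) (farF w'))))))
      (.seq (.upd usedR fun x _ => .or (.mem usedR x) (.or (.eq x w) (.eq x w')))
        (.upd doneR fun x _ => .eq x x))
      .nop))

/-- The augmentation of the base set to connectivity `i + 1`. -/
def augmentC (i : ℕ) : Command :=
  .seq (.upd usedR fun x _ => .mem baseR x) (.seq (.loop fun _ => .seq (bestCutC i) addPathC)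
    (.upd baseR fun x _ => .mem usedR x))

/-- `x` is positive. -/
def positiveF (x : ℕ) : Formula := .ex fun y => .lt y x

/-- The first independent set, grown together with its connectors `w`: each new node `v` has
distance two from the earlier ones. -/
def firstLayerC : Command :=
  .seq (.upd indR fun x _ => .neg (positiveF x))
    (.loop fun _ => .loop fun v => .loop fun w => .ite
      (.and (.and (.neg (.mem indR v)) (.neg (.ex fun u => .and (.mem indR u) (.rel graphR u v))))
        (.and (.rel graphR v w) (.ex fun u => .and (.mem indR u) (.rel graphR u w))))
      (.seq (.upd connR fun x _ => .or (.mem connR x) (.eq x w))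
        (.upd indR fun x _ => .or (.mem indR x) (.eq x v)))
      .nop)

/-- A further independent set, grown greedily in what is left. -/
def layerC : Command :=
  .seq (.upd layerR fun x _ => .bot x)
    (.seq (.loop fun v => .upd layerR fun x _ => .or (.mem layerR x)
      (.and (.eq x v) (.and (.neg (.mem takenR x))
        (.neg (.ex fun y => .and (.mem layerR y) (.rel graphR y x))))))
    (.upd takenR fun x _ => .or (.mem takenR x) (.mem layerR x)))

/-- The algorithm of Shang et al. -/
def shangC : Command :=
  .seq firstLayerC (.seq (.upd takenR fun x _ => .mem indR x)
    (.seq (.loop fun i => .ite (.and (.ltM i) (positiveF i)) layerC .nop)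
      (.upd baseR fun x _ => .or (.mem takenR x) (.mem connR x))))

/-- The whole algorithm: the set of Shang et al. is augmented to connectivity `2`, …, `k`, or to
connectivity `n` if `n < k`. -/
def algorithmC : Command :=
  .seq shangC (.loop fun i => .ite (.and (.ltK i) (positiveF i)) (augmentC i) .nop)

theorem algorithmC_scoped : algorithmC.Scoped 0 := by
  simp [algorithmC, shangC, layerC, firstLayerC, positiveF, augmentC, addPathC, farF, nearF,
    bestCutC, tryPairC, linkageC, augmentPathC, rotateC, rotateStepC, searchC, reachesF, scannedF,
    Formula.bot, Formula.mem, Command.Scoped, Formula.Scoped]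

section Linkage

variable {n k m : ℕ} {G : SimpleGraph (Fin n)} {U : Finset (Fin n)} {p : Fin n → Fin n}
  {e : ℕ → Fin n} {σ : State n}

/-- The relation `a` encodes the set `X`. -/
def Encodes (σ : State n) (a : ℕ) (X : Finset (Fin n)) : Prop := ∀ x, σ a x x ↔ x ∈ X

/-- The relation `graphR` holds the input graph. -/
def HasGraph (σ : State n) (G : SimpleGraph (Fin n)) : Prop := ∀ x y, σ graphR x y ↔ G.Adj x y

theorem searchC_spec (hG : HasGraph σ G) (hU : Encodes σ usedR U)
    (hp : ∀ x y, σ predR x y ↔ p x = y) :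
    (∃ ρ, IsSearch G U (e 2) (e 3) p ((searchC 2 3).run k m 5 e σ parR) ρ ∧
      (∀ x, Reached ((searchC 2 3).run k m 5 e σ parR) x → ρ x < n) ∧
      IsExhausted G U (e 2) (e 3) p ((searchC 2 3).run k m 5 e σ parR)) := by
  refine SearchInvariant.exhausted ?_
  rw [searchC, Command.run]
  refine (Command.run_loop_induction k m (fun q τ => SearchInvariant G U (e 2) (e 3) p q (τ parR) ∧
    ∀ a, a ≠ parR → τ a = σ a) ⟨?_, ?_⟩ ?_).1
  · convert searchInvariant_zero (G := G) (U := U) (s := e 2) (t := e 3) (p := p) using 1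
    funext x y
    simp [Command.run, Formula.Holds, Formula.bot]
  · intro a ha
    exact Command.run_upd_of_ne k m ha
  · rintro i τ ⟨h1, h2⟩
    refine ⟨?_, fun a ha => (Command.run_upd_of_ne k m ha).trans (h2 a ha)⟩
    convert h1.step using 1
    funext x y
    have e0 := h2 graphR (by decide)
    have e6 := h2 usedR (by decide)
    have e7 := h2 predR (by decide)
    simp [Command.run, Formula.Holds, Formula.mem, reachesF, scannedF, searchStep, Reached,
      Scanned, e0, e6, e7, hG _ _, hU _, hp]

theorem rotateStepC_spec (τ : State n) (e : ℕ → Fin n) :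
    (∀ x y, (rotateStepC 2 3).run k m 6 e τ predR x y ↔
      (τ curR x x ∧ x ≠ e 3) ∧ τ parR x y ∨ ¬ (τ curR x x ∧ x ≠ e 3) ∧ τ predR x y) ∧
    (∀ x, (rotateStepC 2 3).run k m 6 e τ curR x x ↔
      ∃ c y, τ curR c c ∧ τ parR c y ∧ y ≠ e 2 ∧ τ predR x y ∧ ¬ τ curR x x) := by
  constructor
  · intro x y
    simp [rotateStepC, Command.run, Formula.Holds, Formula.mem]
  · intro x
    simp [rotateStepC, Command.run, Formula.Holds, Formula.mem]

/-- The walk along the parents gets to `s` within `n` steps, because the times at which its nodes were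
reached decrease. -/
theorem rotateC_spec (hp : ∀ x y, σ predR x y ↔ p x = y) {ρ : Fin n → ℕ}
    (h : IsLinkage G U (e 2) (e 3) p) (hse : IsSearch G U (e 2) (e 3) p (σ parR) ρ)
    (hρ : ∀ x, Reached (σ parR) x → ρ x < n) (ht : Reached (σ parR) (e 3)) (hs : e 2 ∈ U)
    (hst : e 2 ≠ e 3) (hadj : ¬ G.Adj (e 2) (e 3)) :
    ∃ p', (∀ x y, (rotateC 2 3).run k m 5 e σ predR x y ↔ p' x = y) ∧
      IsLinkage G U (e 2) (e 3) p' ∧ linkageValue (e 2) p' = linkageValue (e 2) p + 1 := by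
  classical
  rw [rotateC, Command.run]
  set σ₀ := (Command.upd curR fun x _ => .eq x 3).run k m 5 e σ with hσ₀
  have hcur : ∀ x, σ₀ curR x x ↔ x = e 3 := fun x => by
    simp [hσ₀, Command.run, Formula.Holds]
  have hne : ∀ a, a ≠ curR → σ₀ a = σ a := fun a ha => Command.run_upd_of_ne k m ha
  have key := Command.run_loop_induction k m (d := 5) (e := e) (σ := σ₀)
    (c := fun _ => rotateStepC 2 3)
    (fun q τ => τ parR = σ parR ∧ ∃ p', (∀ x y, τ predR x y ↔ p' x = y) ∧
      (((∀ x, ¬ τ curR x x) ∧ IsLinkage G U (e 2) (e 3) p' ∧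
          linkageValue (e 2) p' = linkageValue (e 2) p + 1) ∨
        ∃ c, (∀ x, τ curR x x ↔ x = c) ∧ IsRotation G U (e 2) (e 3) p (σ parR) ρ p' c ∧
          ρ c + q ≤ ρ (e 3))) ?_ ?_
  · obtain ⟨-, p', h1, h2 | ⟨c, -, -, h2⟩⟩ := key
    · exact ⟨p', h1, h2.2⟩
    · have := hρ _ ht
      omega
  · exact ⟨hne _ (by decide), p, fun x y => by rw [hne _ (by decide)]; exact hp x y,
      .inr ⟨e 3, hcur, h.isRotation hst ht, le_rfl⟩⟩
  · rintro i τ ⟨hpar, p', h1, h2⟩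
    obtain ⟨g1, g2⟩ := rotateStepC_spec (k := k) (m := m) τ (Function.update e 5 i)
    refine ⟨(Command.run_of_avoids k m _ (by simp [rotateStepC, Command.Avoids]) _ _ _).trans hpar,
      ?_⟩
    rw [Function.update_of_ne (by decide), hpar] at g1
    rw [Function.update_of_ne (by decide), hpar] at g2
    rcases h2 with ⟨h2, h3⟩ | ⟨c, h2, h3, h4⟩
    · refine ⟨p', fun x y => ?_, .inl ⟨fun x => ?_, h3⟩⟩
      · rw [g1]; simp [h2, h1]
      · rw [g2]; simp [h2]
    · obtain ⟨y, hy⟩ := h3.reached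
      by_cases hys : y = e 2
      · subst hys
        obtain ⟨f1, f2, f3⟩ := h3.finish hse hs hadj hy
        refine ⟨_, fun x z => ?_, .inl ⟨fun x => ?_, f2, f3⟩⟩
        · rw [g1, h2, h1]
          by_cases hx : x = c
          · subst hx
            rw [Function.update_self]
            simp only [f1, ne_eq, not_false_eq_true, and_self, true_and, not_true_eq_false,
              false_and, or_false]
            exact ⟨fun hz => hse.unique _ _ _ hy hz, fun hz => hz ▸ hy⟩
          · rw [Function.update_of_ne hx]; simp [hx]
        · rw [g2]
          rintro ⟨c', y, hc', hy', hys, -⟩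
          rw [h2] at hc'
          subst hc'
          exact hys (hse.unique _ _ _ hy' hy)
      · obtain ⟨c', f1, f2, f3, f4, f5⟩ := h3.next hse hy hys
        refine ⟨_, fun x z => ?_, .inr ⟨c', fun x => ?_, f5, by omega⟩⟩
        · rw [g1, h2, h1]
          by_cases hct : c = e 3
          · rw [if_pos hct]
            have : ¬ (x = c ∧ x ≠ e 3) := fun h => h.2 (h.1.trans hct)
            simp [this]
          · rw [if_neg hct]
            by_cases hx : x = c
            · subst hx
              rw [Function.update_self]
              simp only [hct, ne_eq, not_false_eq_true, and_self, true_and, not_true_eq_false,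
                false_and, or_false]
              exact ⟨fun hz => hse.unique _ _ _ hy hz, fun hz => hz ▸ hy⟩
            · rw [Function.update_of_ne hx]; simp [hx]
        · rw [g2]
          constructor
          · rintro ⟨c₁, y₁, hc₁, hy₁, -, hx, hxc⟩
            rw [h2] at hc₁ hxc
            subst hc₁
            rw [h1] at hx
            exact f3 x hxc (hx.trans (hse.unique _ _ _ hy₁ hy))
          · rintro rfl
            exact ⟨c, y, (h2 c).2 rfl, hy, hys, (h1 _ _).2 f2, fun h => f1 ((h2 _).1 h)⟩

/-- The result of the attempts to find disjoint paths: `r` of them, or a failed search when there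
are fewer than `j`. -/
def LinkageResult (G : SimpleGraph (Fin n)) (U : Finset (Fin n)) (s t : Fin n) (r j : ℕ)
    (σ : State n) : Prop :=
  ∃ p, (∀ x y, σ predR x y ↔ p x = y) ∧ IsLinkage G U s t p ∧
    ((∀ x, ¬ σ stuckR x x) ∧ linkageValue s p = r ∨
      (∀ x, σ stuckR x x) ∧ linkageValue s p < j ∧ ¬ Reached (σ parR) t ∧
        ∃ ρ, IsSearch G U s t p (σ parR) ρ ∧ IsExhausted G U s t p (σ parR))

theorem augmentPathC_spec (hG : HasGraph σ G) (hU : Encodes σ usedR U) {r j : ℕ}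
    (hres : LinkageResult G U (e 2) (e 3) r j σ) (hstuck : ∀ x, ¬ σ stuckR x x) (hrj : r < j)
    (hs : e 2 ∈ U) (hst : e 2 ≠ e 3) (hadj : ¬ G.Adj (e 2) (e 3)) :
    LinkageResult G U (e 2) (e 3) (r + 1) j ((augmentPathC 2 3).run k m 5 e σ) := by
  obtain ⟨p, hp, hlink, hval⟩ := hres
  have hval : linkageValue (e 2) p = r := by
    rcases hval with h | h
    · exact h.2
    · exact absurd (h.1 (e 2)) (hstuck _)
  rw [augmentPathC, Command.run]
  obtain ⟨ρ, h1, h2, h3⟩ := searchC_spec (k := k) (m := m) (e := e) hG hU hp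
  have hne : ∀ a, a ≠ parR → (searchC 2 3).run k m 5 e σ a = σ a := fun a ha =>
    Command.run_of_avoids k m _ (by simpa [searchC, Command.Avoids] using ha) _ _ _
  set τ := (searchC 2 3).run k m 5 e σ with hτ
  have hp' : ∀ x y, τ predR x y ↔ p x = y := fun x y => by rw [hne _ (by decide)]; exact hp x y
  have hcond : (Formula.ex fun y => .rel parR 3 y).Holds k m τ 5 e ↔ Reached (τ parR) (e 3) := by
    simp [Formula.Holds, Reached]
  by_cases ht : Reached (τ parR) (e 3)
  · rw [Command.run, if_pos (hcond.2 ht)]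
    obtain ⟨p', g1, g2, g3⟩ := rotateC_spec (k := k) (m := m) hp' hlink h1 h2 ht hs hst hadj
    refine ⟨p', g1, g2, .inl ⟨fun x => ?_, by omega⟩⟩
    rw [Command.run_of_avoids k m _ (by simp [rotateC, rotateStepC, Command.Avoids]),
      hne _ (by decide)]
    exact hstuck x
  · rw [Command.run, if_neg (hcond.not.2 ht)]
    have hne' : ∀ a, a ≠ stuckR →
        (Command.upd stuckR fun x _ => .eq x x).run k m 5 e τ a = τ a := fun a ha =>
      Command.run_upd_of_ne k m ha
    refine ⟨p, fun x y => by rw [hne' _ (by decide)]; exact hp' x y, hlink, .inr ⟨fun x => ?_,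
      by omega, ?_, ρ, ?_⟩⟩
    · simp [Command.run, Formula.Holds]
    · rwa [hne' _ (by decide)]
    · rw [hne' _ (by decide)]; exact ⟨h1, h3⟩

theorem linkageC_spec (hG : HasGraph σ G) (hU : Encodes σ usedR U) (hs : e 2 ∈ U)
    (hst : e 2 ≠ e 3) (hadj : ¬ G.Adj (e 2) (e 3)) :
    LinkageResult G U (e 2) (e 3) (e 0 + 1) (e 0 + 1) ((linkageC 0 2 3).run k m 4 e σ) := by
  simp only [linkageC]
  rw [Command.run, Command.run]
  set σ₀ := (Command.upd predR fun x y => .eq x y).run k m 4 e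
    ((Command.upd stuckR fun x _ => .bot x).run k m 4 e σ) with hσ₀
  have hne : ∀ a, a ≠ stuckR → a ≠ predR → σ₀ a = σ a := fun a h1 h2 =>
    (Command.run_upd_of_ne k m h2).trans (Command.run_upd_of_ne k m h1)
  have hpred : ∀ x y, σ₀ predR x y ↔ id x = y := fun x y => by
    simp [hσ₀, Command.run, Formula.Holds]
  have hstuck : ∀ x, ¬ σ₀ stuckR x x := fun x => by
    simp [hσ₀, Command.run, Formula.Holds, Formula.bot]
  have key := Command.run_loop_induction k m (d := 4) (e := e) (σ := σ₀)
    (c := fun r => .ite (.and (.neg (.lt 0 r)) (.neg (.mem stuckR 2))) (augmentPathC 2 3) .nop)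
    (fun r τ => HasGraph τ G ∧ Encodes τ usedR U ∧
      LinkageResult G U (e 2) (e 3) (min r (e 0 + 1)) (e 0 + 1) τ) ?_ ?_
  · have h1 := key.2.2
    rwa [min_eq_right (Nat.succ_le_of_lt (e 0).2)] at h1
  · refine ⟨fun x y => by rw [hne _ (by decide) (by decide)]; exact hG x y,
      fun x => by rw [hne _ (by decide) (by decide)]; exact hU x, id, hpred, isLinkage_id,
      .inl ⟨hstuck, ?_⟩⟩
    rw [linkageValue_id]; simp
  · rintro i τ ⟨h1, h2, h3⟩
    have hcond : (Formula.and (.neg (.lt 0 4)) (.neg (.mem stuckR 2))).Holds k m τ 5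
        (Function.update e 4 i) ↔ ¬ e 0 < i ∧ ¬ τ stuckR (e 2) (e 2) := by
      simp [Formula.Holds, Formula.mem]
    by_cases hc : ¬ e 0 < i ∧ ¬ τ stuckR (e 2) (e 2)
    · simp only [Command.run]
      rw [if_pos (hcond.2 hc)]
      have hi : (i : ℕ) ≤ e 0 := not_lt.1 hc.1
      have hnst : ∀ x, ¬ τ stuckR x x := by
        obtain ⟨p, -, -, h4 | h4⟩ := h3
        · exact h4.1
        · exact absurd (h4.1 _) hc.2
      refine ⟨fun x y => ?_, fun x => ?_, ?_⟩
      · rw [Command.run_of_avoids k m _ (by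
          simp [augmentPathC, searchC, rotateC, rotateStepC, Command.Avoids])]
        exact h1 x y
      · rw [Command.run_of_avoids k m _ (by
          simp [augmentPathC, searchC, rotateC, rotateStepC, Command.Avoids])]
        exact h2 x
      · rw [min_eq_left (by omega)] at h3 ⊢
        have h4 := augmentPathC_spec (k := k) (m := m) (e := Function.update e 4 i) (r := i)
          (j := e 0 + 1) h1 h2
        rw [Function.update_of_ne (by decide), Function.update_of_ne (by decide)] at h4
        exact h4 h3 hnst (by omega) hs hst hadj
    · simp only [Command.run]
      rw [if_neg (hcond.not.2 hc)]
      refine ⟨h1, h2, ?_⟩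
      obtain ⟨p, h4, h5, ⟨h6, h7⟩ | h6⟩ := h3
      · refine ⟨p, h4, h5, .inl ⟨h6, ?_⟩⟩
        have hi : (e 0 : ℕ) < i := by
          by_contra hi
          exact hc ⟨fun h => hi h, h6 _⟩
        rw [h7, min_eq_right (by omega), min_eq_right (by omega)]
      · exact ⟨p, h4, h5, .inr h6⟩

end Linkage

/-! ### Correctness of the augmentation -/

section Augment

variable {n k m : ℕ} {G : SimpleGraph (Fin n)} {T S : Finset (Fin n)} {e : ℕ → Fin n} {σ : State n}

/-- The set `B` is empty or an uncovered demand cut, and it is at least as good as every uncovered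
demand cut that separates one of the pairs in `D`. -/
def IsBestCut (G : SimpleGraph (Fin n)) (j : ℕ) (T S : Finset (Fin n)) (D : Fin n → Fin n → Prop)
    (B : Finset (Fin n)) : Prop :=
  (B = ∅ ∨ IsOpenCut G j T S B) ∧ ∀ s t, D s t → ∀ Y, IsOpenCut G j T S Y → s ∈ Y →
    t ∈ T \ closedNbhd G Y → B ≠ ∅ ∧ ¬ Y ⊂ B

theorem tryPairC_spec (hG : HasGraph σ G) (hT : Encodes σ baseR T) (hU : Encodes σ usedR (T ∪ S))
    (hconn : IsKConnected G (e 0) T) {D : Fin n → Fin n → Prop} {B : Finset (Fin n)}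
    (hB : Encodes σ bestR B) (hbest : IsBestCut G (e 0 + 1) T S D B) :
    ∃ B', Encodes ((tryPairC 0 2 3).run k m 4 e σ) bestR B' ∧
      IsBestCut G (e 0 + 1) T S (fun s t => D s t ∨ s = e 2 ∧ t = e 3) B' := by
  classical
  have hcond : (Formula.and (.mem baseR 2) (.and (.mem baseR 3) (.and (.neg (.eq 2 3))
      (.neg (.rel graphR 2 3))))).Holds k m σ 4 e ↔
      e 2 ∈ T ∧ e 3 ∈ T ∧ e 2 ≠ e 3 ∧ ¬ G.Adj (e 2) (e 3) := by
    simp [Formula.Holds, Formula.mem, hT _, hG _ _]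
  rw [tryPairC, Command.run]
  by_cases hc : e 2 ∈ T ∧ e 3 ∈ T ∧ e 2 ≠ e 3 ∧ ¬ G.Adj (e 2) (e 3)
  swap
  · rw [if_neg (hcond.not.2 hc), Command.run]
    refine ⟨B, hB, hbest.1, ?_⟩
    rintro s t (h | ⟨rfl, rfl⟩) Y hY hs ht
    · exact hbest.2 s t h Y hY hs ht
    · have ht' := mem_sdiff_closedNbhd.1 ht
      exact absurd ⟨hY.1.1.1 hs, ht'.1, fun h => ht'.2.1 (h ▸ hs), ht'.2.2 _ hs⟩ hc
  rw [if_pos (hcond.2 hc), Command.run]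
  obtain ⟨hsT, htT, hst, hadj⟩ := hc
  have hres := linkageC_spec (k := k) (m := m) (e := e) hG hU (Finset.mem_union_left _ hsT) hst hadj
  have hne : ∀ a, a ≠ stuckR → a ≠ predR → a ≠ parR → a ≠ curR → a ≠ nextR →
      (linkageC 0 2 3).run k m 4 e σ a = σ a := fun a h1 h2 h3 h4 h5 =>
    Command.run_of_avoids k m _ (by
      simp [linkageC, augmentPathC, searchC, rotateC, rotateStepC, Command.Avoids, h1, h2, h3, h4,
        h5]) _ _ _
  set τ := (linkageC 0 2 3).run k m 4 e σ with hτ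
  have hT' : Encodes τ baseR T := fun x => by
    rw [hne] <;> first | exact hT x | decide
  have hB' : Encodes τ bestR B := fun x => by
    rw [hne] <;> first | exact hB x | decide
  obtain ⟨p, hp, hlink, ⟨hstuck, hval⟩ | ⟨hstuck, hval, hfail, ρ, hse, hex⟩⟩ := hres
  · -- enough disjoint paths: no cut separates the pair
    rw [Command.run, if_neg (by simp [Formula.Holds, Formula.mem, hstuck]), Command.run]
    refine ⟨B, hB', hbest.1, ?_⟩
    rintro s t (h | ⟨rfl, rfl⟩) Y hY hs ht
    · exact hbest.2 s t h Y hY hs ht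
    · exact absurd ht (hlink.not_isOpenCut hval.ge hY hs)
  · obtain ⟨hX, hmin⟩ := hlink.isOpenCut (j := e 0 + 1) hse hex hfail hsT htT hst (by simpa using hconn)
      hval
    set X := Finset.univ.filter (Scanned (e 2) (e 3) p (τ parR)) ∩ T with hXdef
    have hXne : X ≠ ∅ := fun h => by
      have := hX.1.1.2.1
      rw [h] at this
      exact Finset.not_nonempty_empty this
    have hmem : ∀ x, x ∈ X ↔ Scanned (e 2) (e 3) p (τ parR) x ∧ x ∈ T := fun x => by simp [hXdef]
    have hcond' : (Formula.and (.mem stuckR 2) (.or (.neg (.ex fun y => .mem bestR y))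
        (.neg (.ex fun y => .and (.and (scannedF 2 3 y) (.mem baseR y)) (.neg (.mem bestR y)))))).Holds
          k m τ 4 e ↔ (B = ∅ ∨ X ⊆ B) := by
      simp only [Formula.Holds, Formula.mem, hstuck, true_and, scannedF]
      simp [hB' _, hT' _, hp, Finset.eq_empty_iff_forall_notMem, Finset.subset_iff, hmem, Scanned,
        Reached]
    rw [Command.run]
    by_cases hrep : B = ∅ ∨ X ⊆ B
    · rw [if_pos (hcond'.2 hrep)]
      refine ⟨X, fun x => ?_, .inr hX, ?_⟩
      · rw [hmem]
        simp [Command.run, Formula.Holds, Formula.mem, scannedF, Scanned, Reached, hp, hT' _]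
      · rintro s t (h | ⟨rfl, rfl⟩) Y hY hs ht
        · have h1 := hbest.2 s t h Y hY hs ht
          exact ⟨hXne, fun h2 => h1.2 (h2.trans_subset (hrep.resolve_left h1.1))⟩
        · exact ⟨hXne, fun h2 => h2.2 (hmin Y hY hs ht)⟩
    · rw [if_neg (hcond'.not.2 hrep), Command.run]
      rw [not_or] at hrep
      refine ⟨B, hB', hbest.1, ?_⟩
      rintro s t (h | ⟨rfl, rfl⟩) Y hY hs ht
      · exact hbest.2 s t h Y hY hs ht
      · exact ⟨hrep.1, fun h2 => hrep.2 ((hmin Y hY hs ht).trans h2.1)⟩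

theorem bestCutC_avoids {a : ℕ} (h1 : a ≠ stuckR) (h2 : a ≠ predR) (h3 : a ≠ parR) (h4 : a ≠ curR)
    (h5 : a ≠ nextR) (h6 : a ≠ bestR) : (bestCutC 0).Avoids a := by
  simp [bestCutC, tryPairC, linkageC, augmentPathC, searchC, rotateC, rotateStepC, Command.Avoids,
    h1, h2, h3, h4, h5, h6]

theorem tryPairC_avoids {s t a : ℕ} (h1 : a ≠ stuckR) (h2 : a ≠ predR) (h3 : a ≠ parR)
    (h4 : a ≠ curR) (h5 : a ≠ nextR) (h6 : a ≠ bestR) : (tryPairC 0 s t).Avoids a := by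
  simp [tryPairC, linkageC, augmentPathC, searchC, rotateC, rotateStepC, Command.Avoids,
    h1, h2, h3, h4, h5, h6]

/-- A best cut for all pairs is a minimal uncovered demand cut, if there is any. -/
theorem bestCutC_spec (hG : HasGraph σ G) (hT : Encodes σ baseR T)
    (hU : Encodes σ usedR (T ∪ S)) (hconn : IsKConnected G (e 0) T) :
    ∃ B, Encodes ((bestCutC 0).run k m 2 e σ) bestR B ∧
      (B = ∅ ∧ (∀ Y, ¬ IsOpenCut G (e 0 + 1) T S Y) ∨
        Minimal (IsOpenCut G (e 0 + 1) T S) B) := by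
  rw [bestCutC, Command.run]
  set σ₀ := (Command.upd bestR fun x _ => .bot x).run k m 2 e σ with hσ₀
  have hne : ∀ a, a ≠ bestR → σ₀ a = σ a := fun a ha => Command.run_upd_of_ne k m ha
  let Ctx : State n → Prop := fun τ =>
    HasGraph τ G ∧ Encodes τ baseR T ∧ Encodes τ usedR (T ∪ S)
  have hctx₀ : Ctx σ₀ := by
    refine ⟨fun x y => ?_, fun x => ?_, fun x => ?_⟩ <;> rw [hne _ (by decide)]
    exacts [hG x y, hT x, hU x]
  have key := Command.run_loop_induction k m (d := 2) (e := e) (σ := σ₀)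
    (c := fun s => .loop fun t => tryPairC 0 s t)
    (fun q τ => Ctx τ ∧ ∃ B, Encodes τ bestR B ∧
      IsBestCut G (e 0 + 1) T S (fun s _ => (s : ℕ) < q) B) ?_ ?_
  · obtain ⟨-, B, hB, hbest, hmin⟩ := key
    refine ⟨B, hB, ?_⟩
    have hall : ∀ Y, IsOpenCut G (e 0 + 1) T S Y → B ≠ ∅ ∧ ¬ Y ⊂ B := by
      intro Y hY
      obtain ⟨s, hs⟩ := hY.1.1.2.1
      obtain ⟨t, ht⟩ := hY.1.1.2.2
      exact hmin s t s.2 Y hY hs ht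
    rcases hbest with rfl | hbest
    · exact .inl ⟨rfl, fun Y hY => (hall Y hY).1 rfl⟩
    · refine .inr ⟨hbest, fun Y hY hYB => ?_⟩
      by_contra hBY
      exact (hall Y hY).2 ⟨hYB, hBY⟩
  · refine ⟨hctx₀, ∅, fun x => ?_, .inl rfl, fun s t h => absurd h (Nat.not_lt_zero _)⟩
    simp [hσ₀, Command.run, Formula.Holds, Formula.bot]
  · rintro i τ ⟨h1, B, h2, h3⟩
    have key' := Command.run_loop_induction k m (d := 3) (e := Function.update e 2 i) (σ := τ)
      (c := fun t => tryPairC 0 2 t)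
      (fun q τ => Ctx τ ∧ ∃ B, Encodes τ bestR B ∧
        IsBestCut G (e 0 + 1) T S (fun s t => (s : ℕ) < i ∨ s = i ∧ (t : ℕ) < q) B) ?_ ?_
    · obtain ⟨g1, B', g2, g3⟩ := key'
      refine ⟨g1, B', g2, g3.1, fun s t hs => g3.2 s t ?_⟩
      rcases Nat.lt_succ_iff_lt_or_eq.1 hs with h | h
      · exact .inl h
      · exact .inr ⟨Fin.ext h, t.2⟩
    · refine ⟨h1, B, h2, h3.1, fun s t hst => h3.2 s t ?_⟩
      rcases hst with h | h
      · exact h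
      · exact absurd h.2 (Nat.not_lt_zero _)
    · rintro j τ' ⟨⟨g1, g2, g3⟩, B', g4, g5⟩
      have hav : ∀ a, a ≠ stuckR → a ≠ predR → a ≠ parR → a ≠ curR → a ≠ nextR → a ≠ bestR →
          (tryPairC 0 2 3).run k m 4 (Function.update (Function.update e 2 i) 3 j) τ' a = τ' a :=
        fun a h1 h2 h3 h4 h5 h6 =>
          Command.run_of_avoids k m _ (tryPairC_avoids h1 h2 h3 h4 h5 h6) _ _ _
      refine ⟨⟨fun x y => ?_, fun x => ?_, fun x => ?_⟩, ?_⟩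
      · rw [hav] <;> first | exact g1 x y | decide
      · rw [hav] <;> first | exact g2 x | decide
      · rw [hav] <;> first | exact g3 x | decide
      · have h0 : Function.update (Function.update e 2 i) 3 j 0 = e 0 := by simp
        obtain ⟨B'', f1, f2⟩ := tryPairC_spec (k := k) (m := m)
          (e := Function.update (Function.update e 2 i) 3 j) g1 g2 g3 (by rwa [h0]) g4
          (by rw [h0]; exact g5)
        rw [h0] at f2
        refine ⟨B'', f1, f2.1, fun s t hst => f2.2 s t ?_⟩
        simp only [Function.update_self, Function.update_of_ne (show (2 : ℕ) ≠ 3 by decide)]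
        rcases hst with h | ⟨rfl, h⟩
        · exact .inl (.inl h)
        · rcases Nat.lt_succ_iff_lt_or_eq.1 h with h | h
          · exact .inl (.inr ⟨rfl, h⟩)
          · exact .inr ⟨rfl, Fin.ext h⟩

theorem nearF_holds {B : Finset (Fin n)} (hG : HasGraph σ G) (hB : Encodes σ bestR B) {d w : ℕ}
    (hw : w < d) : (nearF w).Holds k m σ d e ↔ ∃ u ∈ B, G.Adj u (e w) := by
  simp [nearF, Formula.Holds, Formula.mem, hG _ _, hB _, Function.update_of_ne hw.ne]

theorem farF_holds {B : Finset (Fin n)} (hG : HasGraph σ G) (hB : Encodes σ bestR B)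
    (hT : Encodes σ baseR T) {d w : ℕ} (hw : w < d) :
    (farF w).Holds k m σ d e ↔ ∃ v ∈ T \ closedNbhd G B, G.Adj (e w) v := by
  simp only [farF, Formula.Holds, Formula.mem, hG _ _, hB _, hT _, Function.update_of_ne hw.ne,
    Function.update_self, mem_sdiff_closedNbhd,
    Function.update_of_ne (show d ≠ d + 1 by omega)]
  push Not
  rfl

/-- The state of the search for a link of `B`: nothing is found, and no pair in `D` is a link or
double link, or the nodes of a shortest covering path have been added. -/
def LinkSearch (G : SimpleGraph (Fin n)) (T S B : Finset (Fin n)) (L : Fin n → Prop)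
    (D : Fin n → Fin n → Prop) (σ : State n) : Prop :=
  HasGraph σ G ∧ Encodes σ baseR T ∧ Encodes σ bestR B ∧
  ((∀ x, ¬ σ doneR x x) ∧ Encodes σ usedR (T ∪ S) ∧ (∀ w, L w → ¬ IsLink G T B w) ∧
      (∀ w w', D w w' → ¬ IsDoubleLink G T B w w') ∨
    (∀ x, σ doneR x x) ∧ ((∃ w, IsLink G T B w ∧ Encodes σ usedR (T ∪ (S ∪ {w}))) ∨
      (∀ z, ¬ IsLink G T B z) ∧ ∃ w w', IsDoubleLink G T B w w' ∧
        Encodes σ usedR (T ∪ (S ∪ {w, w'}))))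

theorem LinkSearch.mono {B : Finset (Fin n)} {L L' : Fin n → Prop} {D D' : Fin n → Fin n → Prop}
    (h : LinkSearch G T S B L D σ) (hL : ∀ w, L' w → L w) (hD : ∀ w w', D' w w' → D w w') :
    LinkSearch G T S B L' D' σ :=
  ⟨h.1, h.2.1, h.2.2.1, h.2.2.2.imp_left fun ⟨h1, h2, h3, h4⟩ =>
    ⟨h1, h2, fun w hw => h3 w (hL w hw), fun w w' hw => h4 w w' (hD w w' hw)⟩⟩

theorem addPathC_spec {B : Finset (Fin n)} (hG : HasGraph σ G) (hT : Encodes σ baseR T)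
    (hU : Encodes σ usedR (T ∪ S)) (hB : Encodes σ bestR B) :
    LinkSearch G T S B (fun _ => True) (fun _ _ => True) (addPathC.run k m 2 e σ) := by
  rw [addPathC, Command.run_seq, Command.run_seq]
  set σ₀ := (Command.upd doneR fun x _ => .bot x).run k m 2 e σ with hσ₀
  have hne : ∀ a, a ≠ doneR → σ₀ a = σ a := fun a ha => Command.run_upd_of_ne k m ha
  have h₀ : LinkSearch G T S B (fun w => (w : ℕ) < 0) (fun _ _ => False) σ₀ := by
    refine ⟨fun x y => ?_, fun x => ?_, fun x => ?_, .inl ⟨fun x => ?_, fun x => ?_,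
      fun w h => absurd h (Nat.not_lt_zero _), fun _ _ h => h.elim⟩⟩
    · rw [hne _ (by decide)]; exact hG x y
    · rw [hne _ (by decide)]; exact hT x
    · rw [hne _ (by decide)]; exact hB x
    · simp [hσ₀, Command.run, Formula.Holds, Formula.bot]
    · rw [hne _ (by decide)]; exact hU x
  -- single links
  have h₁ := Command.run_loop_induction k m (d := 2) (e := e) (σ := σ₀)
    (c := fun w => .ite (.and (.neg (.mem doneR w))
        (.and (.neg (.mem baseR w)) (.and (nearF w) (farF w))))
      (.seq (.upd usedR fun x _ => .or (.mem usedR x) (.eq x w)) (.upd doneR fun x _ => .eq x x))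
      .nop)
    (fun q τ => LinkSearch G T S B (fun w => (w : ℕ) < q) (fun _ _ => False) τ) h₀ (by
      rintro i τ ⟨g1, g2, g3, g4⟩
      have hcond : (Formula.and (.neg (.mem doneR 2)) (.and (.neg (.mem baseR 2))
          (.and (nearF 2) (farF 2)))).Holds k m τ 3 (Function.update e 2 i) ↔
          ¬ τ doneR i i ∧ IsLink G T B i := by
        simp only [Formula.Holds, nearF_holds g1 g3 (show 2 < 3 by decide),
          farF_holds g1 g3 g2 (show 2 < 3 by decide), Formula.mem, Function.update_self, g2 _, IsLink]
      simp only [Command.run]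
      rcases g4 with ⟨f1, f2, f3, f4⟩ | ⟨f1, f2⟩
      · by_cases hlink : IsLink G T B i
        · rw [if_pos (hcond.2 ⟨f1 i, hlink⟩)]
          refine ⟨g1, g2, g3, .inr ⟨fun x => ?_, .inl ⟨i, hlink, fun x => ?_⟩⟩⟩
          · simp [Formula.Holds]
          · simp [Formula.Holds, Formula.mem, f2 _, or_assoc]; tauto
        · rw [if_neg (hcond.not.2 fun h => hlink h.2)]
          refine ⟨g1, g2, g3, .inl ⟨f1, f2, fun w hw => ?_, f4⟩⟩
          rcases Nat.lt_succ_iff_lt_or_eq.1 hw with h | h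
          · exact f3 w h
          · rwa [Fin.ext h]
      · rw [if_neg (hcond.not.2 fun h => h.1 (f1 i))]
        exact ⟨g1, g2, g3, .inr ⟨f1, f2⟩⟩)
  -- double links
  refine (Command.run_loop_induction k m (d := 2) (e := e)
    (fun q τ => LinkSearch G T S B (fun _ => True) (fun w _ => (w : ℕ) < q) τ) ?_ ?_).mono
    (fun _ h => h) fun w _ _ => w.2
  · exact h₁.mono (fun w _ => w.2) fun _ _ h => absurd h (Nat.not_lt_zero _)
  · intro i τ hτ
    refine (Command.run_loop_induction k m (d := 3) (e := Function.update e 2 i) (σ := τ)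
      (fun q τ => LinkSearch G T S B (fun _ => True)
        (fun w w' => (w : ℕ) < i ∨ w = i ∧ (w' : ℕ) < q) τ) ?_ ?_).mono (fun _ h => h)
      fun w w' hw => ?_
    · exact hτ.mono (fun _ h => h) fun w w' h =>
        h.resolve_right fun h => absurd h.2 (Nat.not_lt_zero _)
    · rintro j τ ⟨g1, g2, g3, g4⟩
      have hcond : (Formula.and (.neg (.mem doneR 2)) (.and (.neg (.mem baseR 2))
          (.and (.neg (.mem baseR 3)) (.and (.rel graphR 2 3) (.and (nearF 2) (farF 3)))))).Holds
            k m τ 4 (Function.update (Function.update e 2 i) 3 j) ↔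
          ¬ τ doneR i i ∧ IsDoubleLink G T B i j := by
        simp only [Formula.Holds, nearF_holds g1 g3 (show 2 < 4 by decide),
          farF_holds g1 g3 g2 (show 3 < 4 by decide), Formula.mem, Function.update_self, g2 _, g1 _ _,
          IsDoubleLink, Function.update_of_ne (show (2 : ℕ) ≠ 3 by decide)]
      simp only [Command.run]
      rcases g4 with ⟨f1, f2, f3, f4⟩ | ⟨f1, f2⟩
      · by_cases hlink : IsDoubleLink G T B i j
        · rw [if_pos (hcond.2 ⟨f1 i, hlink⟩)]
          refine ⟨g1, g2, g3, .inr ⟨fun x => ?_, .inr ⟨fun z => f3 z trivial, i, j, hlink,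
            fun x => ?_⟩⟩⟩
          · simp [Formula.Holds]
          · simp [Formula.Holds, Formula.mem, f2 _, or_assoc]; tauto
        · rw [if_neg (hcond.not.2 fun h => hlink h.2)]
          refine ⟨g1, g2, g3, .inl ⟨f1, f2, f3, fun w w' hw => ?_⟩⟩
          rcases hw with h | ⟨rfl, h⟩
          · exact f4 w w' (.inl h)
          · rcases Nat.lt_succ_iff_lt_or_eq.1 h with h | h
            · exact f4 w w' (.inr ⟨rfl, h⟩)
            · rwa [Fin.ext h]
      · rw [if_neg (hcond.not.2 fun h => h.1 (f1 i))]
        exact ⟨g1, g2, g3, .inr ⟨f1, f2⟩⟩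
    · rcases Nat.lt_succ_iff_lt_or_eq.1 hw with h | h
      · exact .inl h
      · exact .inr ⟨Fin.ext h, w'.2⟩

/-- The augmentation: as long as the connectivity is too small every round adds a node, and there
are as many rounds as nodes. -/
theorem augmentC_spec (hG : HasGraph σ G) (hT : Encodes σ baseR T) (hconn : IsKConnected G (e 0) T)
    (hdom : IsDominating G (e 0 + 1) T) (huniv : IsKConnected G (e 0 + 1) Finset.univ) :
    ∃ T', IsAugmentation G (e 0 + 1) T T' ∧ Encodes ((augmentC 0).run k m 1 e σ) baseR T' := by
  rw [augmentC, Command.run_seq, Command.run_seq]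
  set σ₀ := (Command.upd usedR fun x _ => .mem baseR x).run k m 1 e σ with hσ₀
  have hne : ∀ a, a ≠ usedR → σ₀ a = σ a := fun a ha => Command.run_upd_of_ne k m ha
  have key := Command.run_loop_induction k m (d := 1) (e := e) (σ := σ₀)
    (c := fun _ => .seq (bestCutC 0) addPathC)
    (fun q τ => HasGraph τ G ∧ Encodes τ baseR T ∧
      ∃ S, Relation.ReflTransGen (AugmentationStep G (e 0 + 1) T) ∅ S ∧ Encodes τ usedR (T ∪ S) ∧
        (IsKConnected G (e 0 + 1) (T ∪ S) ∨ q ≤ S.card)) ?_ ?_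
  · obtain ⟨-, -, S, h1, h2, h3⟩ := key
    refine ⟨T ∪ S, ⟨S, h1, ?_, rfl⟩, fun x => ?_⟩
    · rcases h3 with h3 | h3
      · exact h3
      · have hS : S = Finset.univ := by
          rw [← Finset.card_eq_iff_eq_univ, Fintype.card_fin]
          exact le_antisymm (card_finset_fin_le S) h3
        rwa [hS, Finset.union_eq_right.2 (Finset.subset_univ T)]
    · simpa [Command.run, Formula.Holds, Formula.mem] using h2 x
  · refine ⟨fun x y => ?_, fun x => ?_, ∅, .refl, fun x => ?_, .inr (Nat.zero_le _)⟩
    · rw [hne _ (by decide)]; exact hG x y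
    · rw [hne _ (by decide)]; exact hT x
    · simpa [hσ₀, Command.run, Formula.Holds, Formula.mem] using hT x
  · rintro i τ ⟨h1, h2, S, h3, h4, h5⟩
    rw [Command.run]
    have h0 : Function.update e 1 i 0 = e 0 := Function.update_of_ne (by decide) _ _
    obtain ⟨B, hB, hBmin⟩ := bestCutC_spec (k := k) (m := m) (e := Function.update e 1 i) h1 h2 h4
      (by rwa [h0])
    rw [h0] at hBmin
    have hav : ∀ a, a ≠ stuckR → a ≠ predR → a ≠ parR → a ≠ curR → a ≠ nextR → a ≠ bestR →
        (bestCutC 0).run k m 2 (Function.update e 1 i) τ a = τ a := fun a h1 h2 h3 h4 h5 h6 =>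
      Command.run_of_avoids k m _ (bestCutC_avoids h1 h2 h3 h4 h5 h6) _ _ _
    set τ' := (bestCutC 0).run k m 2 (Function.update e 1 i) τ with hτ'
    have g1 : HasGraph τ' G := fun x y => by rw [hav] <;> first | exact h1 x y | decide
    have g2 : Encodes τ' baseR T := fun x => by rw [hav] <;> first | exact h2 x | decide
    have g4 : Encodes τ' usedR (T ∪ S) := fun x => by rw [hav] <;> first | exact h4 x | decide
    obtain ⟨f1, f2, -, f4⟩ := addPathC_spec (k := k) (m := m) (e := Function.update e 1 i) g1 g2 g4 hB
    refine ⟨f1, f2, ?_⟩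
    rcases hBmin with ⟨rfl, hno⟩ | hBmin
    · -- no uncovered demand cut is left
      refine ⟨S, h3, ?_, .inl ?_⟩
      · rcases f4 with f4 | ⟨-, ⟨w, ⟨-, ⟨u, hu, -⟩, -⟩, -⟩ | ⟨-, w, w', ⟨-, -, -, ⟨u, hu, -⟩, -⟩, -⟩⟩
        · exact f4.2.1
        · exact absurd hu (Finset.notMem_empty _)
        · exact absurd hu (Finset.notMem_empty _)
      · by_contra hU
        obtain ⟨Y, hY⟩ := exists_isOpenCut (j := e 0 + 1) (by simpa using hconn) hdom hU
        exact hno Y hY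
    · have hU : ¬ IsKConnected G (e 0 + 1) (T ∪ S) := hBmin.prop.not_isKConnected
      have hq := h5.resolve_left hU
      rcases f4 with ⟨-, -, f5, f6⟩ | ⟨-, ⟨w, hw, f5⟩ | ⟨hno, w, w', hw, f5⟩⟩
      · rcases hBmin.prop.1.exists_link hdom huniv with ⟨w, hw⟩ | ⟨w, w', hw⟩
        · exact absurd hw (f5 w trivial)
        · exact absurd hw (f6 w w' trivial)
      · have hstep := hw.step hU hBmin
        exact ⟨_, h3.tail hstep, f5, .inr (hq.trans_lt (Finset.card_lt_card hstep.ssubset))⟩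
      · have hstep := hw.step hno hU hBmin
        exact ⟨_, h3.tail hstep, f5, .inr (hq.trans_lt (Finset.card_lt_card hstep.ssubset))⟩

end Augment

/-! ### Growing the first set -/

section Layers

variable {V : Type*} [Fintype V] [DecidableEq V] {G : SimpleGraph V}

open Classical in
theorem IsKConnected.insert_of_adj {A : Finset V} (h : IsKConnected G 1 A) {u v : V} (hu : u ∈ A)
    (huv : G.Adj u v) : IsKConnected G 1 (insert v A) := by
  refine h.superset (Finset.subset_insert _ _) fun x hx hxA => Finset.card_pos.2 ⟨u, ?_⟩
  rw [(Finset.mem_insert.1 hx).resolve_right hxA]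
  simp [hu, huv.symm]

theorem isKConnected_singleton (v : V) : IsKConnected G 1 {v} := by
  intro Z _ _
  rw [induce_preconnected_iff]
  rintro A hA ⟨a, ha⟩ ⟨b, hb⟩
  obtain ⟨hb1, hb2⟩ := Finset.mem_sdiff.1 hb
  have h1 := Finset.mem_singleton.1 (Finset.mem_sdiff.1 (hA ha)).1
  have h2 := Finset.mem_singleton.1 (Finset.mem_sdiff.1 hb1).1
  exact absurd (h2 ▸ h1 ▸ ha) hb2

/-- Every node is in `I` or adjacent to it. -/
def Covers (G : SimpleGraph V) (I : Finset V) (v : V) : Prop := v ∈ I ∨ ∃ u ∈ I, G.Adj u v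

theorem maximal_indep {I K : Finset V} (hI : G.IsIndepSet (I : Set V)) (hK : Disjoint I K)
    (hcov : ∀ v, v ∉ K → Covers G I v) :
    Maximal (fun J : Finset V => G.IsIndepSet (J : Set V) ∧ Disjoint J K) I := by
  refine ⟨⟨hI, hK⟩, fun J hJ hIJ x hx => ?_⟩
  rcases hcov x (Finset.disjoint_left.1 hJ.2 hx) with h | ⟨u, hu, hux⟩
  · exact h
  · exact absurd hux (hJ.1 (hIJ hu) hx hux.ne)

theorem isIndepSet_insert {I : Finset V} (hI : G.IsIndepSet (I : Set V)) {v : V}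
    (hv : ∀ u ∈ I, ¬ G.Adj u v) : G.IsIndepSet ((insert v I : Finset V) : Set V) := by
  rw [Finset.coe_insert, SimpleGraph.isIndepSet_iff, Set.pairwise_insert]
  exact ⟨hI, fun b hb _ => ⟨fun h => hv b hb h.symm, hv b hb⟩⟩

/-- The pair `v`, `w` can be used to enlarge the first independent set `I`: `v` is not covered
and `w` connects it to `I`. -/
def CanGrow (G : SimpleGraph V) (I : Finset V) (v w : V) : Prop :=
  (v ∉ I ∧ ¬ ∃ u ∈ I, G.Adj u v) ∧ G.Adj v w ∧ ∃ u ∈ I, G.Adj u w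

/-- In a connected graph, a nonempty independent set that leaves a node uncovered can be
enlarged by a node at distance two. -/
theorem exists_canGrow (hG : IsKConnected G 1 Finset.univ) {I : Finset V} (hI : I.Nonempty)
    (hcov : ¬ ∀ v, Covers G I v) : ∃ v w, CanGrow G I v w := by
  classical
  push Not at hcov
  obtain ⟨x, hx⟩ := hcov
  have hconn := hG ∅ (Finset.empty_subset _) (by simp)
  rw [Finset.sdiff_empty, induce_preconnected_iff] at hconn
  obtain ⟨y, hy⟩ := hI
  obtain ⟨w, hw, v, hv, hwv⟩ := hconn (Finset.univ.filter (Covers G I)) (Finset.subset_univ _)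
    ⟨y, by simp [Covers, hy]⟩ ⟨x, by simp [hx]⟩
  simp only [Finset.mem_filter, Finset.mem_univ, true_and, Finset.mem_sdiff, Covers, not_or] at hw hv
  refine ⟨v, w, hv, hwv.symm, hw.resolve_left fun h => hv.2 ⟨w, h, hwv⟩⟩

/-- An independent set `I` with a set `C` of connectors. -/
structure IsConnectedIndep (G : SimpleGraph V) (I C : Finset V) : Prop where
  indep : G.IsIndepSet (I : Set V)
  nbr : ∀ w ∈ C, ∃ u ∈ I, G.Adj u w
  card_lt : C.card < I.card
  conn : IsKConnected G 1 (C ∪ I)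

theorem IsConnectedIndep.grow {I C : Finset V} (h : IsConnectedIndep G I C) {v w : V}
    (hvw : CanGrow G I v w) : IsConnectedIndep G (insert v I) (insert w C) where
  indep := isIndepSet_insert h.indep fun u hu huv => hvw.1.2 ⟨u, hu, huv⟩
  nbr := fun z hz => by
    rcases Finset.mem_insert.1 hz with rfl | hz
    · obtain ⟨u, hu, huz⟩ := hvw.2.2
      exact ⟨u, Finset.mem_insert_of_mem hu, huz⟩
    · obtain ⟨u, hu, huz⟩ := h.nbr z hz
      exact ⟨u, Finset.mem_insert_of_mem hu, huz⟩
  card_lt := by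
    rw [Finset.card_insert_of_notMem hvw.1.1]
    exact (Finset.card_insert_le _ _).trans_lt (Nat.succ_lt_succ h.card_lt)
  conn := by
    obtain ⟨u, hu, huw⟩ := hvw.2.2
    have h1 := (h.conn.insert_of_adj (Finset.mem_union_right _ hu) huw).insert_of_adj
      (Finset.mem_insert_self _ _) hvw.2.1.symm
    rwa [← Finset.insert_union, ← Finset.union_insert] at h1

/-- `I` is a maximal independent set of what the sets before the `i`-th leave over. -/
def IsLayer (G : SimpleGraph V) (I : ℕ → Finset V) (i : ℕ) : Prop :=
  Maximal (fun J : Finset V =>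
    G.IsIndepSet (J : Set V) ∧ Disjoint J ((Finset.range i).biUnion I)) (I i)

theorem IsLayer.congr {I I' : ℕ → Finset V} {i : ℕ} (h : IsLayer G I i)
    (hI : ∀ j ≤ i, I' j = I j) : IsLayer G I' i := by
  have : (Finset.range i).biUnion I' = (Finset.range i).biUnion I :=
    Finset.biUnion_congr rfl fun j hj => hI j (Finset.mem_range.1 hj).le
  rw [IsLayer, this, hI i le_rfl]
  exact h

/-- As many layers as there are nodes exhaust the graph. -/
theorem biUnion_layers_eq_univ {I : ℕ → Finset V} {c : ℕ} (hI : ∀ i < c, IsLayer G I i)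
    (hc : Fintype.card V ≤ c) : (Finset.range c).biUnion I = Finset.univ := by
  have key : ∀ i ≤ c, (Finset.range i).biUnion I = Finset.univ ∨
      i ≤ ((Finset.range i).biUnion I).card := by
    intro i
    induction i with
    | zero => intro _; exact .inr (Nat.zero_le _)
    | succ i ih =>
      intro hi
      rw [Finset.range_add_one, Finset.biUnion_insert]
      by_cases huniv : (Finset.range i).biUnion I = Finset.univ
      · left; rw [huniv, Finset.union_eq_right.2 (Finset.subset_univ _)]
      · have hcard := (ih (by omega)).resolve_left huniv
        right
        obtain ⟨x, hx⟩ : ∃ x, x ∉ (Finset.range i).biUnion I := by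
          by_contra! hall
          exact huniv (Finset.eq_univ_iff_forall.2 hall)
        have hlay := hI i (by omega)
        have hne : (I i).Nonempty := by
          by_contra hemp
          rw [Finset.not_nonempty_iff_eq_empty] at hemp
          obtain ⟨u, hu, -⟩ := exists_adj_of_maximal_indep hlay (v := x) fun j hj => by
            rcases hj.eq_or_lt with rfl | hj
            · rw [hemp]; exact Finset.notMem_empty _
            · exact fun hxj => hx (Finset.mem_biUnion.2 ⟨j, Finset.mem_range.2 hj, hxj⟩)
          rw [hemp] at hu
          exact Finset.notMem_empty _ hu
        rw [Finset.card_union_of_disjoint hlay.prop.2]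
        have := hne.card_pos
        omega
  rcases key c le_rfl with h | h
  · exact h
  · rw [← Finset.card_eq_iff_eq_univ]
    exact le_antisymm (Finset.card_le_univ _) (hc.trans h)

/-- If the layers exhaust the graph before the `m`-th one, the remaining ones are empty. -/
theorem isShangOutput_of_layers {I : ℕ → Finset V} {C : Finset V} {m c : ℕ}
    (hc : 1 ≤ c) (hcm : c ≤ m) (hI : ∀ i < c, IsLayer G I i) (h0 : IsConnectedIndep G (I 0) C)
    (hexh : c = m ∨ Fintype.card V ≤ c) :
    IsShangOutput G m ((Finset.range c).biUnion I ∪ C) := by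
  have hdisj : Disjoint C (I 0) := Finset.disjoint_left.2 fun w hw hwI => by
    obtain ⟨u, hu, huw⟩ := h0.nbr w hw
    exact h0.indep hu hwI huw.ne huw
  have hconn : (G.induce (↑(C ∪ I 0) : Set V)).Preconnected := by
    have := h0.conn ∅ (Finset.empty_subset _) (by simp)
    rwa [Finset.sdiff_empty] at this
  rcases hexh with rfl | hexh
  · exact ⟨I, C, hI, hdisj, h0.card_lt.le, hconn, rfl⟩
  · let I' : ℕ → Finset V := fun i => if i < c then I i else ∅
    have hI' : ∀ i < c, I' i = I i := fun i hi => if_pos hi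
    have hsub : (Finset.range c).biUnion I = (Finset.range c).biUnion I' :=
      Finset.biUnion_congr rfl fun j hj => (hI' j (Finset.mem_range.1 hj)).symm
    have huniv : ∀ i, c ≤ i → (Finset.range i).biUnion I' = Finset.univ := fun i hi => by
      rw [Finset.eq_univ_iff_forall]
      intro x
      have hx : x ∈ (Finset.range c).biUnion I' := by
        rw [← hsub, biUnion_layers_eq_univ hI hexh]; exact Finset.mem_univ x
      obtain ⟨j, hj, hxj⟩ := Finset.mem_biUnion.1 hx
      exact Finset.mem_biUnion.2 ⟨j, Finset.mem_range.2 ((Finset.mem_range.1 hj).trans_le hi), hxj⟩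
    refine ⟨I', C, fun i _ => ?_, ?_, ?_, ?_, ?_⟩
    · by_cases hi : i < c
      · exact (hI i hi).congr fun j hj => hI' j (hj.trans_lt hi)
      · refine maximal_indep ?_ ?_ fun v hv => absurd ?_ hv
        · simp [I', hi]
        · simp [I', hi]
        · rw [huniv i (not_lt.1 hi)]; exact Finset.mem_univ v
    · rwa [hI' 0 hc]
    · rw [hI' 0 hc]; exact h0.card_lt.le
    · rwa [hI' 0 hc]
    · rw [huniv m hcm, hsub, huniv c le_rfl]

end Layers

section Shang

variable {n k m : ℕ} {G : SimpleGraph (Fin n)} {e : ℕ → Fin n} {σ : State n}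

/-- The state of the construction of the first layer: it is finished, or has more than `q`
nodes. In the second case no pair in `D` can enlarge it, unless it has more than `q + 1`. -/
def FirstLayerState (G : SimpleGraph (Fin n)) (q : ℕ) (D : Fin n → Fin n → Prop) (σ : State n) :
    Prop :=
  HasGraph σ G ∧ ∃ I C, Encodes σ indR I ∧ Encodes σ connR C ∧ IsConnectedIndep G I C ∧
    ((∀ v, Covers G I v) ∨ q + 1 < I.card ∨ q < I.card ∧ ∀ v w, D v w → ¬ CanGrow G I v w)

theorem FirstLayerState.mono {q : ℕ} {D D' : Fin n → Fin n → Prop} (h : FirstLayerState G q D σ)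
    (hD : ∀ v w, D' v w → D v w) : FirstLayerState G q D' σ := by
  obtain ⟨h1, I, C, h2, h3, h4, h5⟩ := h
  exact ⟨h1, I, C, h2, h3, h4, h5.imp_right fun h => h.imp_right fun h =>
    ⟨h.1, fun v w hvw => h.2 v w (hD v w hvw)⟩⟩

theorem firstLayerC_spec (hG : HasGraph σ G) (hC : Encodes σ connR ∅)
    (hconn : IsKConnected G 1 Finset.univ) :
    ∃ I C, Encodes (firstLayerC.run k m 0 e σ) indR I ∧ Encodes (firstLayerC.run k m 0 e σ) connR C ∧
      IsConnectedIndep G I C ∧ ∀ v, Covers G I v := by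
  rw [firstLayerC, Command.run_seq]
  set σ₀ := (Command.upd indR fun x _ => .neg (positiveF x)).run k m 0 e σ with hσ₀
  have hne : ∀ a, a ≠ indR → σ₀ a = σ a := fun a ha => Command.run_upd_of_ne k m ha
  have key := Command.run_loop_induction k m (d := 0) (e := e) (σ := σ₀)
    (c := fun _ => .loop fun v => .loop fun w => .ite
      (.and (.and (.neg (.mem indR v)) (.neg (.ex fun u => .and (.mem indR u) (.rel graphR u v))))
        (.and (.rel graphR v w) (.ex fun u => .and (.mem indR u) (.rel graphR u w))))
      (.seq (.upd connR fun x _ => .or (.mem connR x) (.eq x w))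
        (.upd indR fun x _ => .or (.mem indR x) (.eq x v)))
      .nop)
    (fun q τ => FirstLayerState G q (fun _ _ => False) τ) ?_ ?_
  · obtain ⟨-, I, C, h1, h2, h3, h4⟩ := key
    refine ⟨I, C, h1, h2, h3, ?_⟩
    have := card_finset_fin_le I
    rcases h4 with h4 | h4 | ⟨h4, -⟩
    · exact h4
    · omega
    · omega
  · refine ⟨fun x y => by rw [hne _ (by decide)]; exact hG x y, {⟨0, (e 0).pos⟩}, ∅, fun x => ?_,
      fun x => by rw [hne _ (by decide)]; exact hC x,
      ⟨by simp, by simp, by simp, by simpa using isKConnected_singleton _⟩,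
      .inr (.inr ⟨by simp, fun _ _ h => h.elim⟩)⟩
    have : (∀ y : Fin n, x ≤ y) ↔ x = ⟨0, (e 0).pos⟩ := by
      constructor
      · intro h
        have := h ⟨0, (e 0).pos⟩
        exact Fin.ext (Nat.le_zero.1 this)
      · rintro rfl y
        exact Nat.zero_le (y : ℕ)
    simp [hσ₀, Command.run, positiveF, Formula.Holds, this]
  · rintro q τ hτ
    have round := Command.run_loop_induction k m (d := 1) (e := Function.update e 0 q) (σ := τ)
      (c := fun v => .loop fun w => .ite
        (.and (.and (.neg (.mem indR v)) (.neg (.ex fun u => .and (.mem indR u) (.rel graphR u v))))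
          (.and (.rel graphR v w) (.ex fun u => .and (.mem indR u) (.rel graphR u w))))
        (.seq (.upd connR fun x _ => .or (.mem connR x) (.eq x w))
          (.upd indR fun x _ => .or (.mem indR x) (.eq x v)))
        .nop)
      (fun r τ => FirstLayerState G q (fun v _ => (v : ℕ) < r) τ) ?_ ?_
    · obtain ⟨h1, I, C, h2, h3, h4, h5⟩ := round
      refine ⟨h1, I, C, h2, h3, h4, ?_⟩
      rcases h5 with h5 | h5 | ⟨-, h6⟩
      · exact .inl h5
      · exact .inr (.inr ⟨h5, fun _ _ h => h.elim⟩)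
      · left
        by_contra hcov
        obtain ⟨v, w, hvw⟩ := exists_canGrow hconn
          (Finset.card_pos.1 (lt_of_le_of_lt (Nat.zero_le _) h4.card_lt)) hcov
        exact h6 v w v.2 hvw
    · obtain ⟨h1, I, C, h2, h3, h4, h5⟩ := hτ
      exact ⟨h1, I, C, h2, h3, h4, h5.imp_right fun h => h.imp_right fun h =>
        ⟨h.1, fun v w h => absurd h (Nat.not_lt_zero _)⟩⟩
    · intro i τ hτ
      refine (Command.run_loop_induction k m (d := 2)
        (e := Function.update (Function.update e 0 q) 1 i) (σ := τ)
        (fun r τ => FirstLayerState G q (fun v w => (v : ℕ) < i ∨ v = i ∧ (w : ℕ) < r) τ) ?_ ?_).mono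
        fun v w hv => ?_
      · exact hτ.mono fun v w h => h.resolve_right fun h => absurd h.2 (Nat.not_lt_zero _)
      · rintro j τ ⟨h1, I, C, h2, h3, h4, h5⟩
        have hcond : (Formula.and
            (.and (.neg (.mem indR 1)) (.neg (.ex fun u => .and (.mem indR u) (.rel graphR u 1))))
            (.and (.rel graphR 1 2) (.ex fun u => .and (.mem indR u) (.rel graphR u 2)))).Holds k m τ 3
            (Function.update (Function.update (Function.update e 0 q) 1 i) 2 j) ↔ CanGrow G I i j := by
          simp [Formula.Holds, Formula.mem, CanGrow, h1 _ _, h2 _]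
        simp only [Command.run]
        by_cases hgrow : CanGrow G I i j
        · rw [if_pos (hcond.2 hgrow)]
          refine ⟨h1, insert i I, insert j C, fun x => ?_, fun x => ?_, h4.grow hgrow, ?_⟩
          · simp [Formula.Holds, Formula.mem, h2 _, or_comm]
          · simp [Formula.Holds, Formula.mem, h3 _, or_comm]
          · rw [Finset.card_insert_of_notMem hgrow.1.1]
            rcases h5 with h5 | h5 | h5
            · exact absurd (h5 i) (not_or.2 hgrow.1)
            · exact .inr (.inl (by omega))
            · exact .inr (.inl (by omega))
        · rw [if_neg (hcond.not.2 hgrow)]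
          refine ⟨h1, I, C, h2, h3, h4, h5.imp_right fun h => h.imp_right fun h => ⟨h.1, ?_⟩⟩
          rintro v w (hv | ⟨rfl, hw⟩)
          · exact h.2 v w (.inl hv)
          · rcases Nat.lt_succ_iff_lt_or_eq.1 hw with hw | hw
            · exact h.2 v w (.inr ⟨rfl, hw⟩)
            · rwa [Fin.ext hw]
      · rcases Nat.lt_succ_iff_lt_or_eq.1 hv with h | h
        · exact .inl h
        · exact .inr ⟨Fin.ext h, w.2⟩

theorem layerC_spec {K : Finset (Fin n)} (hG : HasGraph σ G) (hK : Encodes σ takenR K) :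
    ∃ I, Encodes (layerC.run k m 1 e σ) takenR (K ∪ I) ∧
      Maximal (fun J : Finset (Fin n) => G.IsIndepSet (J : Set (Fin n)) ∧ Disjoint J K) I := by
  rw [layerC, Command.run_seq, Command.run_seq]
  set σ₀ := (Command.upd layerR fun x _ => .bot x).run k m 1 e σ with hσ₀
  have hne : ∀ a, a ≠ layerR → σ₀ a = σ a := fun a ha => Command.run_upd_of_ne k m ha
  have key := Command.run_loop_induction k m (d := 1) (e := e) (σ := σ₀)
    (c := fun v => .upd layerR fun x _ => .or (.mem layerR x)
      (.and (.eq x v) (.and (.neg (.mem takenR x))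
        (.neg (.ex fun y => .and (.mem layerR y) (.rel graphR y x))))))
    (fun q τ => (HasGraph τ G ∧ Encodes τ takenR K) ∧ ∃ I, Encodes τ layerR I ∧
      G.IsIndepSet (I : Set (Fin n)) ∧ Disjoint I K ∧
      ∀ v : Fin n, (v : ℕ) < q → v ∉ K → Covers G I v) ?_ ?_
  · obtain ⟨⟨-, h1⟩, I, h2, h3, h4, h5⟩ := key
    refine ⟨I, fun x => ?_, maximal_indep h3 h4 fun v => h5 v v.2⟩
    rw [Finset.mem_union, ← h1 x, ← h2 x]
    simp only [Command.run, Formula.Holds, Formula.mem]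
    simp
  · refine ⟨⟨fun x y => ?_, fun x => ?_⟩, ∅, fun x => ?_, by simp, by simp, fun v h => ?_⟩
    · rw [hne _ (by decide)]; exact hG x y
    · rw [hne _ (by decide)]; exact hK x
    · simp [hσ₀, Command.run, Formula.Holds, Formula.bot]
    · exact absurd h (Nat.not_lt_zero _)
  · rintro i τ ⟨⟨h1, h1'⟩, I, h2, h3, h4, h5⟩
    refine ⟨⟨fun x y => ?_, fun x => ?_⟩, ?_⟩
    · rw [Command.run_upd_of_ne k m (by decide)]; exact h1 x y
    · rw [Command.run_upd_of_ne k m (by decide)]; exact h1' x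
    · have henc : ∀ x, (Command.upd layerR fun x _ => .or (.mem layerR x)
          (.and (.eq x 1) (.and (.neg (.mem takenR x))
          (.neg (.ex fun y => .and (.mem layerR y) (.rel graphR y x)))))).run k m 2
            (Function.update e 1 i) τ layerR x x ↔
          x ∈ I ∨ x = i ∧ x ∉ K ∧ ¬ ∃ y ∈ I, G.Adj y x := fun x => by
        simp [Command.run, Formula.Holds, Formula.mem, h1 _ _, h1' _, h2 _]
      by_cases hi : i ∉ K ∧ ¬ ∃ y ∈ I, G.Adj y i
      · refine ⟨insert i I, fun x => ?_, isIndepSet_insert h3 fun u hu h => hi.2 ⟨u, hu, h⟩,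
          Finset.disjoint_insert_left.2 ⟨hi.1, h4⟩, fun v hv hvK => ?_⟩
        · rw [henc, Finset.mem_insert]
          constructor
          · rintro (h | h)
            · exact .inr h
            · exact .inl h.1
          · rintro (rfl | h)
            · exact .inr ⟨rfl, hi⟩
            · exact .inl h
        · rcases Nat.lt_succ_iff_lt_or_eq.1 hv with h | h
          · exact (h5 v h hvK).imp (fun h => Finset.mem_insert_of_mem h)
              fun ⟨u, hu, huv⟩ => ⟨u, Finset.mem_insert_of_mem hu, huv⟩
          · rw [Fin.ext h]; exact .inl (Finset.mem_insert_self _ _)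
      · refine ⟨I, fun x => ?_, h3, h4, fun v hv hvK => ?_⟩
        · rw [henc, or_iff_left]
          rintro ⟨rfl, h⟩
          exact hi h
        · rcases Nat.lt_succ_iff_lt_or_eq.1 hv with h | h
          · exact h5 v h hvK
          · have := Fin.ext h
            subst this
            by_contra hcov
            exact hi ⟨hvK, (not_or.1 hcov).2⟩

theorem positiveF_holds {d x : ℕ} (hx : x < d) :
    (positiveF x).Holds k m σ d e ↔ 0 < (e x : ℕ) := by
  simp only [positiveF, Formula.Holds, Function.update_self, Function.update_of_ne hx.ne]
  exact ⟨fun ⟨y, hy⟩ => lt_of_le_of_lt (Nat.zero_le _) (Fin.lt_def.1 hy),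
    fun h => ⟨⟨0, (e x).pos⟩, h⟩⟩

theorem shangC_spec (hm : 1 ≤ m) (hG : HasGraph σ G) (hC : Encodes σ connR ∅)
    (hconn : IsKConnected G 1 Finset.univ) :
    ∃ T, IsShangOutput G m T ∧ Encodes (shangC.run k m 0 e σ) baseR T := by
  rw [shangC, Command.run_seq, Command.run_seq, Command.run_seq]
  obtain ⟨I₀, C, h1, h2, h3, h4⟩ := firstLayerC_spec (k := k) (m := m) (e := e) hG hC hconn
  have hg : HasGraph (firstLayerC.run k m 0 e σ) G := fun x y => by
    rw [Command.run_of_avoids k m _ (by simp [firstLayerC, Command.Avoids])]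
    exact hG x y
  set σ₁ := firstLayerC.run k m 0 e σ
  set σ₂ := (Command.upd takenR fun x _ => .mem indR x).run k m 0 e σ₁ with hσ₂
  have hne : ∀ a, a ≠ takenR → σ₂ a = σ₁ a := fun a ha => Command.run_upd_of_ne k m ha
  -- after round `q` the first `max 1 (min q m)` layers are complete
  have key := Command.run_loop_induction k m (d := 0) (e := e) (σ := σ₂)
    (c := fun i => .ite (.and (.ltM i) (positiveF i)) layerC .nop)
    (fun q τ => (HasGraph τ G ∧ Encodes τ connR C) ∧ ∃ I : ℕ → Finset (Fin n), I 0 = I₀ ∧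
      Encodes τ takenR ((Finset.range (max 1 (min q m))).biUnion I) ∧
      ∀ i < max 1 (min q m), IsLayer G I i) ?_ ?_
  · obtain ⟨⟨-, g1⟩, I, rfl, g2, g3⟩ := key
    refine ⟨_, isShangOutput_of_layers (le_max_left _ _) (max_le hm (min_le_right _ _)) g3 h3 ?_,
      fun x => ?_⟩
    · have := (e 0).pos
      rw [Fintype.card_fin]
      omega
    · rw [Finset.mem_union, ← g1 x, ← g2 x]
      simp only [Command.run, Formula.Holds, Formula.mem]
      simp
  · refine ⟨⟨fun x y => ?_, fun x => ?_⟩, fun _ => I₀, rfl, fun x => ?_, fun i hi => ?_⟩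
    · rw [hne _ (by decide)]; exact hg x y
    · rw [hne _ (by decide)]; exact h2 x
    · simpa [hσ₂, Command.run, Formula.Holds, Formula.mem] using h1 x
    · have : i = 0 := by simp at hi; omega
      subst this
      exact maximal_indep h3.indep (by simp) fun v _ => h4 v
  · rintro i τ ⟨⟨g1, g2⟩, I, rfl, g3, g4⟩
    have hcond : (Formula.and (.ltM 0) (positiveF 0)).Holds k m τ 1 (Function.update e 0 i) ↔
        (i : ℕ) < m ∧ 0 < (i : ℕ) := by
      simp only [Formula.Holds, positiveF_holds (show 0 < 1 by decide), Function.update_self]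
    rw [Command.run]
    by_cases hi : (i : ℕ) < m ∧ 0 < (i : ℕ)
    · rw [if_pos (hcond.2 hi)]
      have e1 : max 1 (min (i : ℕ) m) = i := by omega
      have e2 : max 1 (min ((i : ℕ) + 1) m) = i + 1 := by omega
      rw [e1] at g3 g4
      rw [e2]
      obtain ⟨J, f1, f2⟩ := layerC_spec (k := k) (m := m) (e := Function.update e 0 i) g1 g3
      have hav : ∀ a, a ≠ layerR → a ≠ takenR →
          layerC.run k m 1 (Function.update e 0 i) τ a = τ a := fun a h1 h2 =>
        Command.run_of_avoids k m _ (by simp [layerC, Command.Avoids, h1, h2]) _ _ _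
      have hup : ∀ j : ℕ, j < (i : ℕ) → Function.update I i J j = I j := fun j hj =>
        Function.update_of_ne (by omega) _ _
      have hbi : (Finset.range i).biUnion (Function.update I i J) = (Finset.range i).biUnion I :=
        Finset.biUnion_congr rfl fun j hj => hup j (Finset.mem_range.1 hj)
      refine ⟨⟨fun x y => ?_, fun x => ?_⟩, Function.update I i J, hup 0 hi.2, fun x => ?_,
        fun j hj => ?_⟩
      · rw [hav _ (by decide) (by decide)]; exact g1 x y
      · rw [hav _ (by decide) (by decide)]; exact g2 x
      · rw [f1 x, Finset.range_add_one, Finset.biUnion_insert, Function.update_self, hbi,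
          Finset.union_comm]
      · rcases Nat.lt_succ_iff_lt_or_eq.1 hj with hj | rfl
        · exact (g4 j hj).congr fun l hl => hup l (by omega)
        · rw [IsLayer, hbi, Function.update_self]
          exact f2
    · rw [if_neg (hcond.not.2 hi), Command.run]
      have e1 : max 1 (min ((i : ℕ) + 1) m) = max 1 (min (i : ℕ) m) := by omega
      rw [e1]
      exact ⟨⟨g1, g2⟩, I, rfl, g3, g4⟩

end Shang

/-! ### The sequence of sets -/

section Main

variable {n k m : ℕ} {G : SimpleGraph (Fin n)}

/-- The sets `T 1`, …, `T c`: the output of the algorithm of Shang et al. and its successive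
augmentations. -/
structure IsChain (G : SimpleGraph (Fin n)) (m c : ℕ) (T : ℕ → Finset (Fin n)) : Prop where
  first : IsShangOutput G m (T 1)
  next : ∀ j, 2 ≤ j → j ≤ c → IsAugmentation G j (T (j - 1)) (T j)

theorem IsChain.spec {c : ℕ} {T : ℕ → Finset (Fin n)} (h : IsChain G m c T) (hm : 1 ≤ m) :
    ∀ j, 1 ≤ j → j ≤ c → IsKConnected G j (T j) ∧ IsDominating G m (T j) := by
  intro j hj
  induction j, hj using Nat.le_induction with
  | base => exact fun _ => ⟨h.first.isKConnected hm, h.first.isDominating⟩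
  | succ j hj ih =>
    intro hjc
    obtain ⟨S, -, hS, hT⟩ := h.next (j + 1) (by omega) hjc
    rw [Nat.add_sub_cancel] at hS hT
    rw [hT]
    exact ⟨hS, (ih (by omega)).2.mono Finset.subset_union_left⟩

theorem IsDominating.of_le {D : Finset (Fin n)} {j : ℕ} (h : IsDominating G m D) (hj : j ≤ m) :
    IsDominating G j D := fun v hv => hj.trans (h v hv)

theorem algorithmC_spec (hk : 1 ≤ k) (hkm : k ≤ m) (hG : IsKConnected G k Finset.univ)
    (e : ℕ → Fin n) : ∃ T, IsChain G m (max 1 (min n k)) T ∧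
      Encodes (algorithmC.run k m 0 e (initialState G)) baseR (T (max 1 (min n k))) := by
  rw [algorithmC, Command.run_seq]
  obtain ⟨T₁, h1, h2⟩ := shangC_spec (k := k) (m := m) (e := e) (σ := initialState G) (G := G)
    (hk.trans hkm) (fun x y => by simp [initialState]) (fun x => by simp [initialState]) (hG.mono hk)
  have hg : HasGraph (shangC.run k m 0 e (initialState G)) G := fun x y => by
    rw [Command.run_of_avoids k m _ (by simp [shangC, layerC, firstLayerC, Command.Avoids])]
    simp [initialState]
  set σ₁ := shangC.run k m 0 e (initialState G)
  have key := Command.run_loop_induction k m (d := 0) (e := e) (σ := σ₁)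
    (c := fun i => .ite (.and (.ltK i) (positiveF i)) (augmentC i) .nop)
    (fun q τ => HasGraph τ G ∧ ∃ T, IsChain G m (max 1 (min q k)) T ∧
      Encodes τ baseR (T (max 1 (min q k)))) ?_ ?_
  · exact key.2
  · exact ⟨hg, fun _ => T₁, ⟨h1, fun j hj hj' => by omega⟩, h2⟩
  · rintro i τ ⟨g1, T, g2, g3⟩
    have hcond : (Formula.and (.ltK 0) (positiveF 0)).Holds k m τ 1 (Function.update e 0 i) ↔
        (i : ℕ) < k ∧ 0 < (i : ℕ) := by
      simp only [Formula.Holds, positiveF_holds (show 0 < 1 by decide), Function.update_self]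
    rw [Command.run]
    by_cases hi : (i : ℕ) < k ∧ 0 < (i : ℕ)
    · rw [if_pos (hcond.2 hi)]
      have e1 : max 1 (min (i : ℕ) k) = i := by omega
      have e2 : max 1 (min ((i : ℕ) + 1) k) = i + 1 := by omega
      rw [e1] at g2 g3
      rw [e2]
      obtain ⟨hc, hd⟩ := g2.spec (hk.trans hkm) i hi.2 le_rfl
      have h0 : (Function.update e 0 i 0 : ℕ) = i := by simp
      obtain ⟨T', f1, f2⟩ := augmentC_spec (k := k) (m := m) (e := Function.update e 0 i) g1 g3
        (by rwa [h0]) (by rw [h0]; exact hd.of_le (by omega)) (by rw [h0]; exact hG.mono hi.1)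
      rw [h0] at f1
      have hup : ∀ j : ℕ, j ≤ (i : ℕ) → Function.update T (i + 1) T' j = T j := fun j hj =>
        Function.update_of_ne (by omega) _ _
      refine ⟨fun x y => ?_, Function.update T (i + 1) T', ⟨?_, fun j hj hj' => ?_⟩, ?_⟩
      · rw [Command.run_of_avoids k m _ (by
          simp [augmentC, addPathC, bestCutC, tryPairC, linkageC, augmentPathC, searchC, rotateC,
            rotateStepC, Command.Avoids])]
        exact g1 x y
      · rw [hup 1 hi.2]; exact g2.first
      · rcases Nat.lt_succ_iff_lt_or_eq.1 (Nat.lt_succ_of_le hj') with hlt | rfl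
        · rw [hup j (by omega), hup (j - 1) (by omega)]
          exact g2.next j hj (by omega)
        · rw [Function.update_self, Nat.add_sub_cancel, hup i le_rfl]
          exact f1
      · rwa [Function.update_self]
    · rw [if_neg (hcond.not.2 hi), Command.run]
      have e1 : max 1 (min ((i : ℕ) + 1) k) = max 1 (min (i : ℕ) k) := by omega
      rw [e1]
      exact ⟨g1, T, g2, g3⟩

/-- If `n < k` then all sets of nodes are connected, and the chain can be continued by its last
set. -/
theorem IsChain.extend {T : ℕ → Finset (Fin n)} (h : IsChain G m (max 1 (min n k)) T)
    (hk : 1 ≤ k) (hG : IsKConnected G k Finset.univ) :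
    ∃ T', IsChain G m k T' ∧ T' k = T (max 1 (min n k)) := by
  rcases Nat.lt_or_ge n k with hnk | hnk
  · refine ⟨fun j => T (max 1 (min n j)), ⟨by simpa using h.first, fun j hj hjk => ?_⟩, rfl⟩
    by_cases hjn : j ≤ n
    · have e1 : max 1 (min n (j - 1)) = j - 1 := by omega
      have e2 : max 1 (min n j) = j := by omega
      simp only [e1, e2]
      exact h.next j hj (by omega)
    · have e1 : max 1 (min n (j - 1)) = max 1 (min n j) := by omega
      simp only [e1]
      exact ⟨∅, .refl, hG.of_card_lt (by simpa using hnk) _, (Finset.union_empty _).symm⟩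
  · have e1 : max 1 (min n k) = k := by omega
    rw [e1] at h ⊢
    exact ⟨T, h, rfl⟩

theorem isShangOutput_empty (G : SimpleGraph (Fin 0)) (m : ℕ) : IsShangOutput G m ∅ := by
  refine ⟨fun _ => ∅, ∅, fun i _ => ⟨by simp, fun J _ _ x _ => x.elim0⟩, by simp, by simp,
    fun x => (x : Fin 0).elim0, by ext x; exact x.elim0⟩

theorem IsChain.card_step {T : ℕ → Finset (Fin n)} (h : IsChain G m k T) (hm : 1 ≤ m) (hkm : k ≤ m)
    (hG : IsKConnected G k Finset.univ) {j : ℕ} (hj : 2 ≤ j) (hjk : j ≤ k) :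
    (T j).card ≤ 5 * j * (T (j - 1)).card :=
  (h.next j hj hjk).card_le (by omega)
    ((h.spec hm (j - 1) (by omega) (by omega)).2.of_le (by omega)) (hG.mono hjk)

/-- The factors `5 j` of the single augmentations multiply to `5 ^ j * j!`. -/
theorem IsChain.card_le {T : ℕ → Finset (Fin n)} (h : IsChain G m k T) (hm : 1 ≤ m) (hkm : k ≤ m)
    (hG : IsKConnected G k Finset.univ) :
    ∀ j, 1 ≤ j → j ≤ k → (T j).card ≤ 5 ^ j * j.factorial * (T 1).card := by
  intro j hj
  induction j, hj using Nat.le_induction with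
  | base => intro _; simp; omega
  | succ j hj ih =>
    intro hjk
    have h1 := h.card_step hm hkm hG (j := j + 1) (by omega) hjk
    rw [Nat.add_sub_cancel] at h1
    calc (T (j + 1)).card ≤ 5 * (j + 1) * (T j).card := h1
      _ ≤ 5 * (j + 1) * (5 ^ j * j.factorial * (T 1).card) := Nat.mul_le_mul_left _ (ih (by omega))
      _ = _ := by rw [Nat.factorial_succ, pow_succ]; ring

end Main

end KMCDS

theorem mainTheorem2 :
    ∃ (C : ℕ) (A : KMCDS.Program) (q : Polynomial ℕ),
      ∀ (k m : ℕ), 1 ≤ k → k ≤ m →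
      ∀ (n : ℕ) (G : SimpleGraph (Fin n)), KMCDS.IsUnitDiskGraph G →
        (∃ S : Finset (Fin n), KMCDS.IsCDS G k m S) →
        ∃ (t : ℕ) (s : KMCDS.Memory) (T : ℕ → Finset (Fin n)),
          -- the algorithm runs in polynomial time
          KMCDS.Exec A (KMCDS.inputMemory k m G) t s ∧ t ≤ q.eval n ∧
          -- its output comes from the algorithm of Shang et al. and `k - 1` augmentations
          KMCDS.IsShangOutput G m (T 1) ∧ KMCDS.IsDominating G m (T 1) ∧
          (∀ j, 2 ≤ j → j ≤ k →
            KMCDS.IsAugmentation G j (T (j - 1)) (T j) ∧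
              (T j).card ≤ 5 * j * (T (j - 1)).card) ∧
          KMCDS.outputSet n s = T k ∧
          -- its output is feasible and within the approximation factor
          KMCDS.IsCDS G k m (KMCDS.outputSet n s) ∧
          ∀ S : Finset (Fin n), KMCDS.IsCDS G k m S →
            (KMCDS.outputSet n s).card ≤ C * (5 ^ k * k.factorial) * S.card := by
  obtain ⟨q, hq⟩ := KMCDS.outputProgram_correct KMCDS.algorithmC (fun x => .mem baseR x)
    KMCDS.algorithmC_scoped (by simp [KMCDS.Formula.mem, KMCDS.Formula.Scoped])
  refine ⟨52, KMCDS.outputProgram KMCDS.algorithmC (fun x => .mem baseR x), q, fun k m hk hkm n G hdisk ⟨S₀, hS₀⟩ => ?_⟩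
  have hm : 1 ≤ m := hk.trans hkm
  have huniv := hS₀.univ_isKConnected hkm
  obtain ⟨t, s, hexec, ht, hout⟩ := hq k m n G
  obtain ⟨T₀, hT₀, hT₀out⟩ : ∃ T₀, KMCDS.IsChain G m (max 1 (min n k)) T₀ ∧
      KMCDS.outputSet n s = T₀ (max 1 (min n k)) := by
    rcases Nat.eq_zero_or_pos n with rfl | hn
    · exact ⟨fun _ => ∅, ⟨KMCDS.isShangOutput_empty G m, fun j hj hj' => by omega⟩,
        by ext x; exact x.elim0⟩
    · obtain ⟨T, h1, h2⟩ := KMCDS.algorithmC_spec hk hkm huniv fun _ => ⟨0, hn⟩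
      refine ⟨T, h1, ?_⟩
      ext v
      rw [hout fun _ => ⟨0, hn⟩, ← h2 v]
      simp [KMCDS.Formula.mem, KMCDS.Formula.Holds]
  obtain ⟨T, hT, hTk⟩ := hT₀.extend hk huniv
  rw [← hTk] at hT₀out
  obtain ⟨h1, h2⟩ := hT.spec hm k hk le_rfl
  refine ⟨t, s, T, hexec, ht, hT.first, hT.first.isDominating,
    fun j hj hjk => ⟨hT.next j hj hjk, hT.card_step hm hkm huniv hj hjk⟩, hT₀out,
    hT₀out ▸ ⟨h1, h2⟩, fun S hS => ?_⟩
  rw [hT₀out]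
  calc (T k).card ≤ 5 ^ k * k.factorial * (T 1).card := hT.card_le hm hkm huniv k hk le_rfl
    _ ≤ 5 ^ k * k.factorial * (52 * S.card) :=
        Nat.mul_le_mul_left _ (hT.first.card_le hdisk hm hS.2)
    _ = _ := by ring
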